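/- Let $K$ be a knot type. Knot diagrams are taken either on the plane or on the $2$-sphere, up to (orientation-preserving) isotopy of that surface; the diagram without crossings is allowed. Isotopy classes of diagrams are described combinatorially, as planar $4$-valent maps with over/under information, consisting of one closed curve, with a marked unbounded region in the case of the plane; a knot type is an equivalence class of diagrams under Reidemeister moves. The Reidemeister graph of $K$ ($\mathcal{G}(K)$ for the plane, $\mathcal{G}_S(K)$ for the sphere) is the multigraph whose vertices are the diagrams of $K$ up to isotopy and whose edges are the Reidemeister moves of type $\Omega_1,\Omega_2,\Omega_3$ between them, two moves being the same edge if and only if they coincide up to isotopy (a move and its inverse give one edge); so two diagrams may be joined by several edges. Let $\mathcal{CG}(K)$ be the clique complex of this multigraph: its $n$-simplices are given by $n+1$ distinct, pairwise adjacent vertices together with the choice of one edge between any two of them, so that its $1$-skeleton is the Reidemeister graph and every triangle of edges is filled by a $2$-simplex. Simplices are oriented by an arbitrary linear order of the vertices, and $H_n(\mathcal{CG}(K);\mathbb{Z})$ is simplicial homology. Then, for every $K$, both for the plane and for the sphere: 1. for every $n\ge 3$ the complex $\mathcal{CG}(K)$ has no $n$-simplices (in particular there are no tetrahedra), and $H_n(\mathcal{CG}(K);\mathbb{Z})=0$;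 2. $H_2(\mathcal{CG}(K);\mathbb{Z})\cong\mathbb{Z}^{\infty}=\bigoplus_{k\in\mathbb{N}}\mathbb{Z}$, the free abelian group of countably infinite rank; 3. there are infinitely many $2$-spheres embedded in $\mathcal{CG}(K)$ as subcomplexes whose classes in $H_2(\mathcal{CG}(K);\mathbb{Z})$ are linearly independent over $\mathbb{Z}$. -/

import Mathlib

/-!
Knot diagrams on the plane and on the 2-sphere, Reidemeister moves, the Reidemeister graph
(a multigraph) of a knot type, the clique complex of a multigraph, and its simplicial homology.
-/

namespace KnotDiag

/-! ### Knot diagrams up to isotopy -/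

/-- The surface on which diagrams are drawn. -/
inductive Ambient where
  | plane
  | sphere

/-- The darts (half-edges) of a 4-valent graph with `n` crossings. The darts at the crossing `c`
are `(c, 0), (c, 1), (c, 2), (c, 3)`, in counterclockwise order; `(c, 0)` and `(c, 2)` belong
to the under-strand and `(c, 1)` and `(c, 3)` to the over-strand. -/
abbrev Dart (n : ℕ) : Type := Fin n × ZMod 4

/-- The next dart at the same crossing, counterclockwise. -/
def rot (n : ℕ) : Equiv.Perm (Dart n) := Equiv.prodCongr (Equiv.refl _) (Equiv.addRight 1)

/-- The opposite dart at the same crossing, on the same strand. -/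
def opp (n : ℕ) : Equiv.Perm (Dart n) := Equiv.prodCongr (Equiv.refl _) (Equiv.addRight 2)

/-- The dart lies on the over-strand of its crossing. -/
def IsOver {n : ℕ} (x : Dart n) : Prop := x.2 = 1 ∨ x.2 = 3

/-- A dart `x` also names the corner between `x` and `rot x`, that is, the corner to the left
of `x` when one leaves the crossing along `x`. For an edge involution `e`, this permutation takes a
corner to the next corner met when one walks around the same region of the complement of the
diagram; its cycles are the regions. -/
def nextCorner {n : ℕ} (e : Equiv.Perm (Dart n)) : Equiv.Perm (Dart n) := e.trans (rot n).symm

/-- A knot diagram on the surface `A`, given as a combinatorial map: the crossings are numbered, and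
an involution of the darts says which darts are the two ends of an arc. For the plane the
unbounded region (as a set of corners) is part of the data. The diagram without
crossings is the round circle, which needs no data. -/
structure Diagram (A : Ambient) where
  /-- the number of crossings -/
  crossings : ℕ
  /-- the other end of the arc that starts with a given dart -/
  edge : Equiv.Perm (Dart crossings)
  edge_edge : ∀ x, edge (edge x) = x
  edge_ne : ∀ x, edge x ≠ x
  /-- going along arcs and straight through crossings one meets the whole diagram, so that it is
  the image of one closed curve -/
  one_component : ∀ x y, ∃ g ∈ Subgroup.closure {edge, opp crossings}, g x = y
  /-- The number `F` of regions satisfies Euler's formula `V - E + F = 2` with `V = crossings` and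
  `E = 2 * crossings`, so that the surface obtained by gluing in the regions is a sphere. -/
  planar : crossings ≠ 0 →
    Nat.card (Quotient (Equiv.Perm.SameCycle.setoid (nextCorner edge))) = crossings + 2
  /-- the corners of the unbounded region -/
  outer : Set (Dart crossings)
  outer_sphere : A = Ambient.sphere → outer = ∅
  outer_plane : A = Ambient.plane → crossings ≠ 0 →
    ∃ x, outer = {y | (nextCorner edge).SameCycle x y}

namespace Diagram

variable {A : Ambient}

/-- Two corners belong to the same region. -/
def SameRegion (D : Diagram A) (x y : Dart D.crossings) : Prop :=
  (nextCorner D.edge).SameCycle x y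

/-- Walking along the knot: go along an arc, then straight through the crossing at its end. -/
def next (D : Diagram A) : Equiv.Perm (Dart D.crossings) := D.edge.trans (opp D.crossings)

/-- An isomorphism of diagrams; it exists exactly when the diagrams drawn from the data
differ by an (orientation preserving) isotopy of the surface. -/
structure Iso (D D' : Diagram A) where
  toEquiv : Dart D.crossings ≃ Dart D'.crossings
  map_rot : ∀ x, toEquiv (rot _ x) = rot _ (toEquiv x)
  map_edge : ∀ x, toEquiv (D.edge x) = D'.edge (toEquiv x)
  map_over : ∀ x, IsOver (toEquiv x) ↔ IsOver x
  map_outer : ∀ x, toEquiv x ∈ D'.outer ↔ x ∈ D.outer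

/-- The identity isomorphism. -/
def Iso.refl (D : Diagram A) : Iso D D where
  toEquiv := Equiv.refl _
  map_rot _ := rfl
  map_edge _ := rfl
  map_over _ := Iff.rfl
  map_outer _ := Iff.rfl

/-- The inverse isomorphism. -/
def Iso.symm {D D' : Diagram A} (f : Iso D D') : Iso D' D where
  toEquiv := f.toEquiv.symm
  map_rot x := by rw [Equiv.symm_apply_eq, f.map_rot, Equiv.apply_symm_apply]
  map_edge x := by rw [Equiv.symm_apply_eq, f.map_edge, Equiv.apply_symm_apply]
  map_over x := by rw [← f.map_over, Equiv.apply_symm_apply]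
  map_outer x := by rw [← f.map_outer, Equiv.apply_symm_apply]

/-- The composition of two isomorphisms. -/
def Iso.trans {D D' D'' : Diagram A} (f : Iso D D') (g : Iso D' D'') : Iso D D'' where
  toEquiv := f.toEquiv.trans g.toEquiv
  map_rot x := by simp [f.map_rot, g.map_rot]
  map_edge x := by simp [f.map_edge, g.map_edge]
  map_over x := by simp [f.map_over, g.map_over]
  map_outer x := by simp [f.map_outer, g.map_outer]

/-- Isotopy of diagrams, as an equivalence relation. -/
instance isotopySetoid (A : Ambient) : Setoid (Diagram A) where
  r D D' := Nonempty (Iso D D')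
  iseqv :=
    { refl := fun D => ⟨Iso.refl D⟩
      symm := fun ⟨f⟩ => ⟨f.symm⟩
      trans := fun ⟨f⟩ ⟨g⟩ => ⟨f.trans g⟩ }

/-! ### Reidemeister moves -/

/-- `D'` is obtained from `D`, as far as the crossings and arcs are concerned, by erasing the
crossings in `S` from the course of the knot; `f` identifies the darts of `D'` with the darts of `D`
at the other crossings. -/
structure IsErasure (D : Diagram A) (S : Set (Fin D.crossings)) (D' : Diagram A)
    (f : Dart D'.crossings → Dart D.crossings) : Prop where
  injective : Function.Injective f
  range_eq : Set.range f = {x | x.1 ∉ S}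
  map_rot : ∀ x, f (rot _ x) = rot _ (f x)
  map_over : ∀ x, IsOver (f x) ↔ IsOver x
  map_next : ∀ x, ∃ k : ℕ, f (D'.next x) = (D.next ^ (k + 1)) (f x) ∧
    ∀ j < k, ((D.next ^ (j + 1)) (f x)).1 ∈ S

/-- The corner `x` is the only corner of its region, which is not the unbounded one. -/
def IsMonogon (D : Diagram A) (x : Dart D.crossings) : Prop :=
  nextCorner D.edge x = x ∧ x ∉ D.outer

/-- The move of type 1 that removes the crossing at the monogon with corner `x` turns `D`
into `D'`. -/
def IsOmega1 (D : Diagram A) (x : Dart D.crossings) (D' : Diagram A) : Prop :=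
  D.IsMonogon x ∧ ∃ f, D.IsErasure {x.1} D' f ∧ ∀ z, z ∈ D'.outer ↔ f z ∈ D.outer

/-- The corner `x` belongs to a bounded region with two corners, at different crossings, such that
one of its two sides passes over the other at both crossings. -/
def IsBigon (D : Diagram A) (x : Dart D.crossings) : Prop :=
  nextCorner D.edge (nextCorner D.edge x) = x ∧ (nextCorner D.edge x).1 ≠ x.1 ∧
    (IsOver (D.edge x) ↔ IsOver x) ∧ x ∉ D.outer

/-- The move of type 2 that removes the bigon with corner `x` and its two crossings turns `D` into
`D'`. The bigon and the two regions that touch it only at its corners merge to one region. -/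
def IsOmega2 (D : Diagram A) (x : Dart D.crossings) (D' : Diagram A) : Prop :=
  let y := nextCorner D.edge x
  D.IsBigon x ∧ ∃ f, D.IsErasure {x.1, y.1} D' f ∧
    ∀ z, z ∈ D'.outer ↔ f z ∈ D.outer ∨
      ((opp _ x ∈ D.outer ∨ opp _ y ∈ D.outer) ∧
        (D.SameRegion (opp _ x) (f z) ∨ D.SameRegion (opp _ y) (f z)))

/-- The corner `x` belongs to a bounded region with three corners, at different crossings, such that
one of its sides passes over the other two sides. (If no side does, then the three sides
overlap cyclically.) -/
def IsTriangle (D : Diagram A) (x : Dart D.crossings) : Prop :=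
  let y := nextCorner D.edge x
  let z := nextCorner D.edge y
  nextCorner D.edge z = x ∧ x.1 ≠ y.1 ∧ y.1 ≠ z.1 ∧ z.1 ≠ x.1 ∧
    ¬ ((IsOver x ↔ IsOver y) ∧ (IsOver y ↔ IsOver z)) ∧ x ∉ D.outer

/-- The strand that leaves the corner `x` along `x` arrives at the corner `y` along `rot y`. If it
is pushed across the third crossing of a triangle, then it meets the two crossings in the
opposite order, so that the darts are interchanged as given here. -/
def exchange {n : ℕ} (x y : Dart n) : Equiv.Perm (Dart n) :=
  Equiv.swap (opp n x) (rot n y) * Equiv.swap x (opp n (rot n y))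

/-- The move of type 3 at the triangle with corner `x` turns `D` into `D'`, and the new triangle has
the corner `x'`. The end of an arc at a dart `w` of `D` is attached to the dart `p w` after the move.
All regions except the triangle persist: outside the three sides of the triangle, the
region to the left of `w` is afterwards to the left of `p w`. -/
def IsOmega3 (D : Diagram A) (x : Dart D.crossings)
    (D' : Diagram A) (x' : Dart D'.crossings) : Prop :=
  let y := nextCorner D.edge x
  let z := nextCorner D.edge y
  let p := exchange x y * exchange y z * exchange z x
  D.IsTriangle x ∧ ∃ f : Dart D.crossings ≃ Dart D'.crossings,
    (∀ w, f (rot _ w) = rot _ (f w)) ∧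
    (∀ w, IsOver (f w) ↔ IsOver w) ∧
    (∀ w, D'.edge (f (p w)) = f (p (D.edge w))) ∧
    f (opp _ x) = x' ∧ x' ∉ D'.outer ∧
    ∀ w, w ∉ ({x, y, z, rot _ x, rot _ y, rot _ z} : Set (Dart D.crossings)) →
      (f (p w) ∈ D'.outer ↔ w ∈ D.outer)

end Diagram

open Diagram

/-- A diagram up to isotopy of the surface. -/
abbrev DiagramClass (A : Ambient) : Type := Quotient (isotopySetoid A)

/-- A Reidemeister move, given by the two diagrams and the region of the first diagram at
which it happens. A move of type 1 or 2 is listed in its crossing-decreasing direction. -/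
inductive Move (A : Ambient) where
  | omega1 (D : Diagram A) (x : Dart D.crossings) (D' : Diagram A) (h : D.IsOmega1 x D')
  | omega2 (D : Diagram A) (x : Dart D.crossings) (D' : Diagram A) (h : D.IsOmega2 x D')
  | omega3 (D : Diagram A) (x : Dart D.crossings) (D' : Diagram A) (x' : Dart D'.crossings)
      (h : D.IsOmega3 x D' x')

namespace Move

variable {A : Ambient}

/-- The two diagrams that a move connects, up to isotopy. -/
def ends : Move A → Sym2 (DiagramClass A)
  | omega1 D _ D' _ => s(⟦D⟧, ⟦D'⟧)
  | omega2 D _ D' _ => s(⟦D⟧, ⟦D'⟧)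
  | omega3 D _ D' _ _ => s(⟦D⟧, ⟦D'⟧)

/-- Two moves coincide up to isotopy: an isotopy takes the one diagram to the other diagram and the
region where the one move happens to that of the other move. A move of type 3 is
identified with its inverse. -/
inductive Same : Move A → Move A → Prop
  | omega1 {D x D' h E y E' k} (f : Iso D E) (f' : Iso D' E')
      (hx : E.SameRegion (f.toEquiv x) y) : Same (omega1 D x D' h) (omega1 E y E' k)
  | omega2 {D x D' h E y E' k} (f : Iso D E) (f' : Iso D' E')
      (hx : E.SameRegion (f.toEquiv x) y) : Same (omega2 D x D' h) (omega2 E y E' k)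
  | omega3 {D x D' x' h E y E' y' k} (f : Iso D E) (f' : Iso D' E')
      (hx : E.SameRegion (f.toEquiv x) y) : Same (omega3 D x D' x' h) (omega3 E y E' y' k)
  | omega3_inverse {D x D' x' h k} : Same (omega3 D x D' x' h) (omega3 D' x' D x k)

theorem ends_eq_of_same {m m' : Move A} (h : Same m m') : m.ends = m'.ends := by
  cases h with
  | omega1 f f' _ =>
    simp only [ends]
    rw [Quotient.sound (s := isotopySetoid A) ⟨f⟩, Quotient.sound (s := isotopySetoid A) ⟨f'⟩]
  | omega2 f f' _ =>
    simp only [ends]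
    rw [Quotient.sound (s := isotopySetoid A) ⟨f⟩, Quotient.sound (s := isotopySetoid A) ⟨f'⟩]
  | omega3 f f' _ =>
    simp only [ends]
    rw [Quotient.sound (s := isotopySetoid A) ⟨f⟩, Quotient.sound (s := isotopySetoid A) ⟨f'⟩]
  | omega3_inverse => exact Sym2.eq_swap

end Move

/-- A Reidemeister move up to isotopy (for the equivalence relation that `Move.Same`
generates). -/
abbrev MoveClass (A : Ambient) : Type := Quot (Move.Same (A := A))

/-- The two isotopy classes of diagrams that a move connects. -/
def MoveClass.ends {A : Ambient} : MoveClass A → Sym2 (DiagramClass A) :=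
  Quot.lift Move.ends fun _ _ => Move.ends_eq_of_same

/-- A knot type: a class of diagrams up to isotopy and Reidemeister moves. -/
abbrev KnotType (A : Ambient) : Type :=
  Quot fun d d' : DiagramClass A => ∃ m : MoveClass A, m.ends = s(d, d')

/-- The knot type that a diagram represents. -/
def knotType {A : Ambient} (d : DiagramClass A) : KnotType A := Quot.mk _ d

/-- The Reidemeister graph of the knot type `K`: the vertices are the diagrams of `K` up to isotopy,
the edges are the Reidemeister moves between them up to isotopy. It may have multiple edges. -/
def reidemeisterGraph {A : Ambient} (K : KnotType A) : Graph (DiagramClass A) (MoveClass A) where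
  vertexSet := {d | knotType d = K}
  IsLink m d d' := m.ends = s(d, d') ∧ knotType d = K
  isLink_symm m _ := ⟨fun d d' ⟨h, hK⟩ =>
    ⟨h.trans Sym2.eq_swap, (Quot.sound ⟨m, h⟩ : knotType d = knotType d').symm.trans hK⟩⟩
  eq_or_eq_of_isLink_of_isLink m d d' c c' h h' := by
    have := h.1.symm.trans h'.1
    rw [Sym2.eq_iff] at this
    exact this.imp And.left And.left
  left_mem_of_isLink _ _ _ h := h.2

end KnotDiag

/-! ### The clique complex of a multigraph and its homology -/

namespace CliqueComplex

variable {α β : Type*} [LinearOrder α] (G : Graph α β)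

/-- An `n`-simplex of the clique complex of the multigraph `G`: a set of `n + 1` distinct, pairwise
adjacent vertices together with the choice of one edge between any two of them, so that the
1-skeleton is `G` (without loops) and every clique of edges is filled. The vertices are listed in
increasing order with respect to a linear order, which serves to orient the simplices. -/
@[ext]
structure Simplex (n : ℕ) where
  vertex : Fin (n + 1) → α
  edge : ∀ i j : Fin (n + 1), i < j → β
  vertex_mem : ∀ i, vertex i ∈ G.vertexSet
  strictMono : StrictMono vertex
  isLink : ∀ i j h, G.IsLink (edge i j h) (vertex i) (vertex j)

variable {G}

/-- The face opposite to the vertex `i`. -/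
def Simplex.face {n : ℕ} (s : Simplex G (n + 1)) (i : Fin (n + 2)) : Simplex G n where
  vertex j := s.vertex (i.succAbove j)
  edge j k h := s.edge (i.succAbove j) (i.succAbove k) (Fin.strictMono_succAbove i h)
  vertex_mem _ := s.vertex_mem _
  strictMono := s.strictMono.comp (Fin.strictMono_succAbove i)
  isLink _ _ _ := s.isLink _ _ _

variable (G)

/-- The simplicial `n`-chains with integer coefficients. -/
abbrev Chain (n : ℕ) : Type _ := Simplex G n →₀ ℤ

/-- The simplicial boundary operator. -/
noncomputable def boundary (n : ℕ) : Chain G (n + 1) →ₗ[ℤ] Chain G n :=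
  Finsupp.linearCombination ℤ fun s : Simplex G (n + 1) =>
    ∑ i : Fin (n + 2), (-1 : ℤ) ^ (i : ℕ) • Finsupp.single (s.face i) (1 : ℤ)

theorem Simplex.face_face {n : ℕ} (s : Simplex G (n + 2)) (i : Fin (n + 3)) (j : Fin (n + 2)) :
    (s.face (i.succAbove j)).face (j.predAbove i) = (s.face i).face j := by
  have key : ∀ k : Fin (n + 1),
      (i.succAbove j).succAbove ((j.predAbove i).succAbove k) = i.succAbove (j.succAbove k) :=
    fun k => Fin.succAbove_succAbove_succAbove_predAbove i j k
  have hedge : ∀ {a a' b b'} (ha : a = a') (hb : b = b') (h : a < b) (h' : a' < b'),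
      s.edge a b h = s.edge a' b' h' := by
    rintro _ _ _ _ rfl rfl _ _
    rfl
  ext
  · simp only [Simplex.face, key]
  · exact hedge (key _) (key _) _ _

/-- The boundary of a boundary vanishes. -/
theorem boundary_boundary (n : ℕ) (c : Chain G (n + 2)) :
    boundary G n (boundary G (n + 1) c) = 0 := by
  suffices h : boundary G n ∘ₗ boundary G (n + 1) = 0 from LinearMap.congr_fun h c
  ext1 s
  ext1
  simp only [boundary, LinearMap.comp_apply, Finsupp.lsingle_apply,
    Finsupp.linearCombination_single, map_sum, map_smul, LinearMap.zero_apply,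
    Finset.smul_sum, smul_smul]
  rw [← Finset.sum_product']
  refine Finset.sum_involution (fun p _ => (p.1.succAbove p.2, p.2.predAbove p.1)) ?_ ?_ ?_ ?_
  · rintro ⟨i, j⟩ -
    simp only
    rw [Simplex.face_face, one_mul, one_mul, one_mul, one_mul, ← pow_add, ← pow_add, Fin.neg_one_pow_succAbove_add_predAbove]
    simp
  · rintro ⟨i, j⟩ - - h
    exact Fin.succAbove_ne i j (congrArg Prod.fst h)
  · simp
  · rintro ⟨i, j⟩ -
    simp only [Prod.mk.injEq]
    exact ⟨Fin.succAbove_succAbove_predAbove i j, Fin.predAbove_predAbove_succAbove i j⟩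

/-- The simplicial `n`-cycles. -/
noncomputable def cycles : (n : ℕ) → Submodule ℤ (Chain G n)
  | 0 => ⊤
  | n + 1 => LinearMap.ker (boundary G n)

/-- The simplicial homology group with integer coefficients in degree `n`: cycles modulo
boundaries. -/
abbrev Homology (n : ℕ) : Type _ :=
  cycles G n ⧸ (LinearMap.range (boundary G n)).submoduleOf (cycles G n)

variable {G}

/-- The vertices of the subcomplex that consists of the triangles in `T` and their faces. -/
def vertices (T : Finset (Simplex G 2)) : Set α := {v | ∃ t ∈ T, ∃ i, t.vertex i = v}

/-- The edges of the subcomplex that consists of the triangles in `T` and their faces. -/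
def edges (T : Finset (Simplex G 2)) : Set (Simplex G 1) := {e | ∃ t ∈ T, ∃ i, t.face i = e}

/-- The triangles in `T` and their faces form an embedded 2-sphere: every edge lies on
exactly two triangles, any two triangles are connected by a sequence of triangles in `T` such that
consecutive ones share an edge, and the Euler characteristic is 2. (If one glues the triangles
along their edges only, one gets a connected closed surface with at least as many vertices. Its
Euler characteristic is therefore 2, so that it is a sphere and no vertices are identified.) -/
structure IsSphere (T : Finset (Simplex G 2)) : Prop where
  two_triangles : ∀ e ∈ edges T, {t ∈ (T : Set (Simplex G 2)) | ∃ i, t.face i = e}.ncard = 2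
  connected : ∀ s ∈ T, ∀ t ∈ T,
    Relation.ReflTransGen (fun a b => b ∈ T ∧ ∃ i j, a.face i = b.face j) s t
  euler : ((vertices T).ncard : ℤ) - ((edges T).ncard : ℤ) + (T.card : ℤ) = 2

/-- The homology class is represented by an embedded 2-sphere: by a cycle in which the triangles
of the sphere occur with coefficients `1` or `-1`, and no other triangles occur. -/
def IsSphereClass (h : Homology G 2) : Prop :=
  ∃ T : Finset (Simplex G 2), IsSphere T ∧ ∃ c : cycles G 2, Submodule.Quotient.mk c = h ∧
    (∀ t ∈ T, c.1 t = 1 ∨ c.1 t = -1) ∧ ∀ t ∉ T, c.1 t = 0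

end CliqueComplex

/-! Dimension bound. Orient the knot and record each crossing as a chord of the circle (a Gauss
diagram without over/under information), directed from the strand that leaves along `w` to the one
that leaves along `rot w`. Two numbers are summed over ordered pairs of chords: modulo 4 the number
of linked pairs, and modulo 3 the sign, for unlinked pairs, that compares their directions. Every
unordered pair counts twice. The result, `chordInvariant`, does not depend on the orientation.

A type 1 move deletes a chord with neighbouring ends, which is linked with no other, so the first
component stays. A type 2 move deletes two oppositely directed chords with neighbouring ends; their
contributions with any third chord cancel, and what remains is their mutual weight, (2,0) for
parallel strands and (0,2) for antiparallel ones. A type 3 move exchanges one pair of neighbouring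
ends for each two of its three chords, so it toggles three linkings, and the total change is (2,0).

Suppose that two diagrams with equally many crossings are adjacent. They differ by a type 3 move,
hence by (2,0). A common neighbour is joined to both by moves of one type and in the same direction.
Two type 1 moves would force equal first components; two type 2 moves leave a difference 0 or
±((2,0)-(0,2)), which is not (2,0); three type 3 moves would add up to (2,0), not to 0. So the
crossing numbers in a triangle are distinct (`crossings_ne_of_triangle`). As a move changes them by
at most 2, a clique has at most three vertices.

Homology. Without 3-simplices the second homology group is the group of 2-cycles, a subgroup of a
free abelian group on a countable set, hence free of countable rank. It remains to find infinitely
many independent spheres.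

Spheres. The suspension of a double edge is a sphere made of four triangles (`exists_sphere`). To
get one, put two equal small loops side by side on an arc: deleting either loop gives the same
diagram `a` from the diagram `b`, by two different type 1 moves. Twisting the first or the second
loop once more, with the suitable crossing, gives `c` or `d`; each is joined to `b` by a type 1 move
and to `a` by a type 2 move. The loops sit on a larger loop, so that their neighbourhood is known;
this allows a proof that the two moves and the diagrams `c`, `d` differ (`exists_suspension`). Every
triangle contains `a`, the vertex with the fewest crossings. Letting that number grow yields spheres
without common triangles, whose cycles are therefore independent. -/

/-! ### The cyclic order along a cycle of a permutation -/

namespace CyclicWalk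

open Equiv.Perm

variable {X Y : Type*}

/-- Walking from `a` along `σ`, one meets `b` before `c`. -/
def Reaches (σ : Equiv.Perm X) (a b c : X) : Prop :=
  ∃ j : ℕ, (σ ^ j) a = b ∧ ∀ i ≤ j, (σ ^ i) a ≠ c

noncomputable instance (σ : Equiv.Perm X) (a b c : X) : Decidable (Reaches σ a b c) :=
  Classical.propDecidable _

/-- The injection `f` identifies `τ` with the first return map of `σ` to the range of `f`. -/
structure FirstReturn (σ : Equiv.Perm X) (τ : Equiv.Perm Y) (f : Y → X) : Prop where
  injective : Function.Injective f
  return_eq : ∀ y, ∃ k : ℕ, f (τ y) = (σ ^ (k + 1)) (f y) ∧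
    ∀ j < k, (σ ^ (j + 1)) (f y) ∉ Set.range f

namespace FirstReturn

variable {σ : Equiv.Perm X} {τ : Equiv.Perm Y} {f : Y → X}

/-- Concatenating the returns lifts a walk along `τ` to a walk along `σ`. The second clause says
that the longer walk meets no additional points of the range. -/
theorem exists_pow_eq (h : FirstReturn σ τ f) (y : Y) (m : ℕ) :
    ∃ k, f ((τ ^ m) y) = (σ ^ k) (f y) ∧
      ∀ i ≤ k, ∀ c, (σ ^ i) (f y) = f c → ∃ m' ≤ m, (τ ^ m') y = c := by
  induction m with
  | zero =>
    refine ⟨0, rfl, fun i hi c hc => ⟨0, le_rfl, ?_⟩⟩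
    obtain rfl : i = 0 := by omega
    exact h.injective hc
  | succ m ih =>
    obtain ⟨k, hk, hv⟩ := ih
    obtain ⟨l, hl, hl'⟩ := h.return_eq ((τ ^ m) y)
    refine ⟨l + 1 + k, ?_, fun i hi c hc => ?_⟩
    · rw [pow_succ', mul_apply, hl, hk, ← mul_apply, ← pow_add]
    · rcases le_or_gt i k with hik | hik
      · obtain ⟨m', hm', e⟩ := hv i hik c hc
        exact ⟨m', by omega, e⟩
      · obtain ⟨j, rfl⟩ : ∃ j, i = (j + 1) + k := ⟨i - k - 1, by omega⟩
        rw [pow_add, mul_apply, ← hk] at hc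
        rcases lt_or_ge j l with hj | hj
        · exact absurd ⟨c, hc.symm⟩ (hl' j hj)
        · obtain rfl : j = l := by omega
          refine ⟨m + 1, le_rfl, h.injective ?_⟩
          rw [← hc, pow_succ', mul_apply, hl]

/-- The converse of `exists_pow_eq`: a walk along `σ` between points of the range is cut at its
returns, by strong induction on its length. -/
theorem exists_of_pow_eq (h : FirstReturn σ τ f) (j : ℕ) : ∀ (y b : Y),
    (σ ^ j) (f y) = f b → ∃ m, (τ ^ m) y = b ∧
      ∀ m' ≤ m, ∃ i ≤ j, (σ ^ i) (f y) = f ((τ ^ m') y) := by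
  induction j using Nat.strong_induction_on with
  | _ j ih =>
    intro y b hb
    rcases Nat.eq_zero_or_pos j with rfl | hj
    · exact ⟨0, h.injective hb, fun m' hm' => ⟨0, le_rfl, by
        obtain rfl : m' = 0 := by omega
        rfl⟩⟩
    · obtain ⟨k, hk, hk'⟩ := h.return_eq y
      have hkj : k + 1 ≤ j := by
        by_contra hlt
        obtain ⟨i, rfl⟩ : ∃ i, j = i + 1 := ⟨j - 1, by omega⟩
        exact hk' i (by omega) ⟨b, hb.symm⟩
      obtain ⟨m, hm, hm'⟩ := ih (j - (k + 1)) (by omega) (τ y) b (by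
        rw [hk, ← mul_apply, ← pow_add, Nat.sub_add_cancel hkj, hb])
      refine ⟨m + 1, by rw [pow_succ, mul_apply, hm], fun m' hle => ?_⟩
      rcases m' with _ | m'
      · exact ⟨0, by omega, rfl⟩
      · obtain ⟨i, hi, e⟩ := hm' m' (by omega)
        refine ⟨i + (k + 1), by omega, ?_⟩
        rw [pow_add, mul_apply, ← hk, e, pow_succ, mul_apply]

theorem sameCycle_iff [Finite X] [Finite Y] (h : FirstReturn σ τ f) (a b : Y) :
    SameCycle σ (f a) (f b) ↔ SameCycle τ a b := by
  constructor
  · intro hs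
    obtain ⟨j, hj⟩ := hs.exists_nat_pow_eq
    obtain ⟨m, hm, -⟩ := h.exists_of_pow_eq j a b hj
    exact ⟨m, by simpa using hm⟩
  · intro hs
    obtain ⟨m, rfl⟩ := hs.exists_nat_pow_eq
    obtain ⟨k, hk, -⟩ := h.exists_pow_eq a m
    exact ⟨k, by simpa using hk.symm⟩

/-- Skipping points outside the range does not affect the order in which the others are met. This
makes the chords at the surviving crossings insensitive to an erasure. -/
theorem reaches_iff (h : FirstReturn σ τ f) (a b c : Y) :
    Reaches σ (f a) (f b) (f c) ↔ Reaches τ a b c := by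
  constructor
  · rintro ⟨j, hj, hc⟩
    obtain ⟨m, hm, hm'⟩ := h.exists_of_pow_eq j a b hj
    refine ⟨m, hm, fun i hi e => ?_⟩
    obtain ⟨i', hi', e'⟩ := hm' i hi
    exact hc i' hi' (by rw [e', e])
  · rintro ⟨m, rfl, hc⟩
    obtain ⟨k, hk, hv⟩ := h.exists_pow_eq a m
    refine ⟨k, hk.symm, fun i hi e => ?_⟩
    obtain ⟨m', hm', e'⟩ := hv i hi c e
    exact hc m' hm' e'

end FirstReturn

theorem Reaches.map {σ : Equiv.Perm X} {τ : Equiv.Perm Y} {f : X → Y}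
    (hf : Function.Injective f) (h : ∀ x, f (σ x) = τ (f x)) (a b c : X) :
    Reaches τ (f a) (f b) (f c) ↔ Reaches σ a b c :=
  FirstReturn.reaches_iff ⟨hf, fun y => ⟨0, by simp [h], by simp⟩⟩ a b c

/-- Going up cyclically from `p`, one meets `q` before `r`. -/
def Cyc (p q r : ℕ) : Prop := (p ≤ q ∧ q < r) ∨ (q < r ∧ r < p) ∨ (r < p ∧ p ≤ q)

instance (p q r : ℕ) : Decidable (Cyc p q r) := by unfold Cyc; infer_instance

theorem reaches_iff_of_modEq {σ : Equiv.Perm X} {x : X} {N : ℕ} 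
    (h : ∀ m n : ℕ, (σ ^ m) x = (σ ^ n) x ↔ m ≡ n [MOD N]) {p q r : ℕ} (hp : p < N) (hq : q < N)
    (hr : r < N) : Reaches σ ((σ ^ p) x) ((σ ^ q) x) ((σ ^ r) x) ↔ Cyc p q r := by
  have key : ∀ i s, (σ ^ i) ((σ ^ p) x) = (σ ^ s) x ↔ i + p ≡ s [MOD N] := by
    intro i s
    rw [← mul_apply, ← pow_add, h]
  -- Counting from `p` instead of 0 replaces `q` and `r` by their distances from `p`; the claim
  -- becomes a comparison of these.
  have red : ∀ s < N, ∃ s' < N, (∀ i, i + p ≡ s [MOD N] ↔ i ≡ s' [MOD N]) ∧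
      ((p ≤ s ∧ s' = s - p) ∨ (s < p ∧ s' = s + N - p)) := by
    intro s hs
    rcases le_or_gt p s with hps | hps
    · refine ⟨s - p, by omega, fun i => ?_, Or.inl ⟨hps, rfl⟩⟩
      rw [← Nat.ModEq.add_iff_right (a := i) (Nat.ModEq.refl p), Nat.sub_add_cancel hps]
    · refine ⟨s + N - p, by omega, fun i => ?_, Or.inr ⟨hps, rfl⟩⟩
      rw [← Nat.ModEq.add_iff_right (c := p) (d := p) (a := i) (Nat.ModEq.refl p),
        Nat.sub_add_cancel (by omega : p ≤ s + N)]
      simp [Nat.ModEq]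
  obtain ⟨q', hq', eq, cq⟩ := red q hq
  obtain ⟨r', hr', er, cr⟩ := red r hr
  have : Reaches σ ((σ ^ p) x) ((σ ^ q) x) ((σ ^ r) x) ↔ q' < r' := by
    simp only [Reaches, key, eq, er, ne_eq]
    constructor
    · rintro ⟨j, hj, hi⟩
      by_contra hle
      refine hi r' ?_ rfl
      have := Nat.mod_le j N
      rw [Nat.ModEq, Nat.mod_eq_of_lt hq'] at hj
      omega
    · intro hlt
      refine ⟨q', rfl, fun i hi e => ?_⟩
      rw [Nat.ModEq, Nat.mod_eq_of_lt hr', Nat.mod_eq_of_lt (by omega)] at e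
      omega
  rw [this]
  unfold Cyc
  omega

theorem minimalPeriod_pos [Finite X] (σ : Equiv.Perm X) (x : X) :
    0 < Function.minimalPeriod σ x := by
  apply Function.minimalPeriod_pos_of_mem_periodicPts
  refine ⟨orderOf σ, orderOf_pos σ, ?_⟩
  rw [Function.IsPeriodicPt, Function.IsFixedPt, iterate_eq_pow, pow_orderOf_eq_one, one_apply]

theorem pow_eq_pow_iff_modEq_minimalPeriod [Finite X] (σ : Equiv.Perm X) (x : X) (m n : ℕ) :
    (σ ^ m) x = (σ ^ n) x ↔ m ≡ n [MOD Function.minimalPeriod σ x] := by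
  have hpos := minimalPeriod_pos σ x
  rw [← iterate_eq_pow, ← iterate_eq_pow, ← Function.iterate_mod_minimalPeriod_eq (n := m),
    ← Function.iterate_mod_minimalPeriod_eq (n := n),
    Function.iterate_eq_iterate_iff_of_lt_minimalPeriod (Nat.mod_lt _ hpos) (Nat.mod_lt _ hpos)]
  rfl

/-- Positions along the cycle of `x`, counted from `x`. -/
theorem exists_position [Finite X] (σ : Equiv.Perm X) (x : X) :
    ∃ pos : X → ℕ, pos x = 0 ∧
      (∀ a b, SameCycle σ x a → SameCycle σ x b → pos a = pos b → a = b) ∧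
      (∀ a, SameCycle σ x a → σ a ≠ x → pos (σ a) = pos a + 1) ∧
      ∀ a b c, SameCycle σ x a → SameCycle σ x b → SameCycle σ x c →
        (Reaches σ a b c ↔ Cyc (pos a) (pos b) (pos c)) := by
  classical
  set N := Function.minimalPeriod σ x with hN
  have h := pow_eq_pow_iff_modEq_minimalPeriod σ x
  rw [← hN] at h
  have hpos : 0 < N := minimalPeriod_pos σ _
  have hex : ∀ a, SameCycle σ x a → ∃ k < N, (σ ^ k) x = a := by
    intro a ha
    obtain ⟨k, rfl⟩ := ha.exists_nat_pow_eq
    exact ⟨k % N, Nat.mod_lt _ hpos, (h _ _).2 (Nat.mod_modEq k N)⟩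
  choose! pos hlt hpe using hex
  have uniq : ∀ k < N, pos ((σ ^ k) x) = k := by
    intro k hk
    have hs : SameCycle σ x ((σ ^ k) x) := ⟨k, by simp⟩
    have := (h _ _).1 (hpe _ hs)
    rwa [Nat.ModEq, Nat.mod_eq_of_lt (hlt _ hs), Nat.mod_eq_of_lt hk] at this
  refine ⟨pos, uniq 0 hpos, fun a b ha hb e => by rw [← hpe a ha, ← hpe b hb, e], ?_, ?_⟩
  · intro a ha hne
    have e : σ a = (σ ^ (pos a + 1)) x := by rw [pow_succ', mul_apply, hpe a ha]
    have := hlt a ha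
    rcases Nat.lt_or_ge (pos a + 1) N with hl | hl
    · rw [e, uniq _ hl]
    · exfalso
      apply hne
      rw [e, show pos a + 1 = N by omega]
      exact (h N 0).2 (by simp [Nat.ModEq])
  · intro a b c ha hb hc
    conv_lhs => rw [← hpe a ha, ← hpe b hb, ← hpe c hc]
    exact reaches_iff_of_modEq h (hlt a ha) (hlt b hb) (hlt c hc)

/-- Position `k` becomes `N - k` for the inverse, which reverses the order of distinct nonzero
positions. -/
theorem reaches_inv_iff [Finite X] (σ : Equiv.Perm X) {a b c : X} (hb : SameCycle σ a b)
    (hc : SameCycle σ a c) (hab : a ≠ b) (hac : a ≠ c) (hbc : b ≠ c) :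
    Reaches σ⁻¹ a b c ↔ ¬ Reaches σ a b c := by
  set N := Function.minimalPeriod σ a with hN
  have h := pow_eq_pow_iff_modEq_minimalPeriod σ a
  rw [← hN] at h
  have hpos : 0 < N := minimalPeriod_pos σ _
  have h' : ∀ m n : ℕ, (σ⁻¹ ^ m) a = (σ⁻¹ ^ n) a ↔ m ≡ n [MOD N] := by
    intro m n
    rw [Nat.ModEq.comm, ← h, ← (σ ^ (m + n)).injective.eq_iff, ← mul_apply, ← mul_apply]
    have e1 : σ ^ (m + n) * σ⁻¹ ^ m = σ ^ n := by rw [add_comm, pow_add]; simp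
    have e2 : σ ^ (m + n) * σ⁻¹ ^ n = σ ^ m := by rw [pow_add]; simp
    rw [e1, e2]
  have hex : ∀ b, SameCycle σ a b → a ≠ b → ∃ k, 0 < k ∧ k < N ∧ (σ ^ k) a = b ∧
      (σ⁻¹ ^ (N - k)) a = b := by
    intro b hb hne
    obtain ⟨k, rfl⟩ := hb.exists_nat_pow_eq
    have e : (σ ^ (k % N)) a = (σ ^ k) a := (h _ _).2 (Nat.mod_modEq k N)
    have hlt := Nat.mod_lt k hpos
    refine ⟨k % N, ?_, hlt, e, ?_⟩
    · by_contra h0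
      rw [show k % N = 0 by omega] at e
      exact hne e
    · rw [← e, ← (σ ^ (N - k % N)).injective.eq_iff, ← mul_apply, ← mul_apply, ← pow_add,
        Nat.sub_add_cancel hlt.le, (h N 0).2 (by simp [Nat.ModEq])]
      simp
  obtain ⟨q, hq0, hq, rfl, eq⟩ := hex b hb hab
  obtain ⟨r, hr0, hr, rfl, er⟩ := hex c hc hac
  have h1 := reaches_iff_of_modEq h hpos hq hr
  have h2 := reaches_iff_of_modEq h' hpos (Nat.sub_lt hpos hq0) (Nat.sub_lt hpos hr0)
  rw [eq, er] at h2
  simp only [pow_zero, one_apply] at h1 h2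
  rw [h1, h2]
  have : q ≠ r := by rintro rfl; exact hbc rfl
  unfold Cyc
  omega

/-! ### Weights of pairs of chords -/

/-- The side of the chord `(a, c)`, for a ternary relation that describes a cyclic order, on which
`b` lies. -/
def side (r : X → X → X → Prop) [∀ a b c, Decidable (r a b c)] (a b c : X) : ZMod 3 :=
  if r a b c then -1 else 1

/-- The first component (times two) tells whether the chords `(t, h)` and `(t', h')` are linked, the
second component is, for unlinked chords, the sign that tells whether they are coherently
directed. -/
def chordWeight (r : X → X → X → Prop) [∀ a b c, Decidable (r a b c)] (t h t' h' : X) :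
    ZMod 4 × ZMod 3 :=
  (if (r t t' h ↔ r t h' h) then 0 else 1,
    (side r t t' h + side r t h' h) * (side r t' t h' + side r t' h h'))

theorem chordWeight_congr {r : X → X → X → Prop} {s : Y → Y → Y → Prop}
    [∀ a b c, Decidable (r a b c)] [∀ a b c, Decidable (s a b c)]
    {t h t' h' : X} {k l k' l' : Y}
    (h1 : r t t' h ↔ s k k' l) (h2 : r t h' h ↔ s k l' l) (h3 : r t' t h' ↔ s k' k l')
    (h4 : r t' h h' ↔ s k' l l') : chordWeight r t h t' h' = chordWeight s k l k' l' := by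
  simp only [chordWeight, side, h1, h2, h3, h4]

/-- Reversing the circle negates every `side`. The two factors of the second component change sign
together, and linking is symmetric in the two sides, so the weight survives. -/
theorem chordWeight_compl {r : X → X → X → Prop} {s : Y → Y → Y → Prop}
    [∀ a b c, Decidable (r a b c)] [∀ a b c, Decidable (s a b c)]
    {t h t' h' : X} {k l k' l' : Y}
    (h1 : r t t' h ↔ ¬ s k k' l) (h2 : r t h' h ↔ ¬ s k l' l) (h3 : r t' t h' ↔ ¬ s k' k l')
    (h4 : r t' h h' ↔ ¬ s k' l l') : chordWeight r t h t' h' = chordWeight s k l k' l' := by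
  simp only [chordWeight, side, h1, h2, h3, h4, not_iff_not]
  congr 1
  split_ifs <;> decide

/-- Only the relative order of the four ends matters. Arbitrary positions can thus be replaced by
small numerals, for which the weights are decidable. -/
theorem chordWeight_cyc_congr {a b : Fin 4 → ℕ} (h : ∀ i j, a i < a j ↔ b i < b j) :
    chordWeight Cyc (a 0) (a 1) (a 2) (a 3) = chordWeight Cyc (b 0) (b 1) (b 2) (b 3) := by
  have key : ∀ i j k, Cyc (a i) (a j) (a k) ↔ Cyc (b i) (b j) (b k) := by
    intro i j k
    simp only [Cyc, ← not_lt, h]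
  exact chordWeight_congr (key _ _ _) (key _ _ _) (key _ _ _) (key _ _ _)

/-- The sum over the ordered pairs of distinct elements of a finite set. -/
def pairSum {ι R : Type*} [DecidableEq ι] [AddCommMonoid R] (W : Finset ι) (g : ι → ι → R) : R :=
  ∑ v ∈ W, ∑ w ∈ W.erase v, g v w

section pairSum

variable {ι ι' R : Type*} [DecidableEq ι] [DecidableEq ι'] [AddCommMonoid R]

theorem pairSum_congr {W : Finset ι} {g g' : ι → ι → R}
    (h : ∀ v ∈ W, ∀ w ∈ W, w ≠ v → g v w = g' v w) : pairSum W g = pairSum W g' :=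
  Finset.sum_congr rfl fun v hv => Finset.sum_congr rfl fun w hw =>
    h v hv w (Finset.mem_of_mem_erase hw) (Finset.ne_of_mem_erase hw)

theorem pairSum_image {f : ι → ι'} (hf : Function.Injective f) (W : Finset ι) (g : ι' → ι' → R) :
    pairSum (W.image f) g = pairSum W fun v w => g (f v) (f w) := by
  rw [pairSum, pairSum, Finset.sum_image hf.injOn]
  refine Finset.sum_congr rfl fun v _ => ?_
  rw [← Finset.image_erase hf, Finset.sum_image hf.injOn]

theorem pairSum_insert {W : Finset ι} {s : ι} (hs : s ∉ W) (g : ι → ι → R) :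
    pairSum (insert s W) g = pairSum W g + ∑ v ∈ W, (g v s + g s v) := by
  rw [pairSum, Finset.sum_insert hs, Finset.erase_insert hs, Finset.sum_add_distrib]
  have : ∀ v ∈ W, ∑ w ∈ (insert s W).erase v, g v w = g v s + ∑ w ∈ W.erase v, g v w := by
    intro v hv
    have hne : s ≠ v := by rintro rfl; exact hs hv
    rw [Finset.erase_insert_of_ne hne, Finset.sum_insert]
    exact fun h => hs (Finset.mem_of_mem_erase h)
  rw [Finset.sum_congr rfl this, Finset.sum_add_distrib, pairSum]
  abel

end pairSum

end CyclicWalk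

/-! ### Orientations of a diagram and the chord invariant -/

namespace KnotDiag

open CyclicWalk Equiv.Perm

/-! ### The four darts at a crossing -/

section Darts

variable {n : ℕ} (w : Dart n)

@[simp] theorem rot_fst : (rot n w).1 = w.1 := rfl

@[simp] theorem opp_fst : (opp n w).1 = w.1 := rfl

theorem rot_rot : rot n (rot n w) = opp n w := by
  refine Prod.ext rfl ?_
  change w.2 + 1 + 1 = w.2 + 2
  ring

@[simp] theorem opp_opp : opp n (opp n w) = w := by
  refine Prod.ext rfl ?_
  change w.2 + 2 + 2 = w.2
  rw [add_assoc]
  exact add_zero _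

theorem rot_opp : rot n (opp n w) = opp n (rot n w) := by rw [← rot_rot, rot_rot]

theorem rot_symm : (rot n).symm w = opp n (rot n w) := by
  rw [Equiv.symm_apply_eq, ← rot_opp, rot_rot, opp_opp]

theorem opp_ne : opp n w ≠ w := by
  intro h
  have h2 : w.2 + 2 = w.2 := congrArg Prod.snd h
  rw [add_eq_left] at h2
  exact absurd h2 (by decide)

theorem rot_ne : rot n w ≠ w := by
  intro h
  have h2 : w.2 + 1 = w.2 := congrArg Prod.snd h
  rw [add_eq_left] at h2
  exact absurd h2 (by decide)

theorem opp_rot_ne : opp n (rot n w) ≠ w := by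
  intro h
  apply rot_ne (opp n (rot n w))
  rw [rot_opp, rot_rot, opp_opp]
  exact h.symm

theorem eq_of_fst_eq {v w : Dart n} (h : v.1 = w.1) :
    w = v ∨ w = rot n v ∨ w = opp n v ∨ w = opp n (rot n v) := by
  obtain ⟨c, i⟩ := v
  obtain ⟨d, j⟩ := w
  obtain rfl : c = d := h
  have : ∀ i j : ZMod 4, j = i ∨ j = i + 1 ∨ j = i + 2 ∨ j = i + 1 + 2 := by decide
  exact (this i j).imp (congrArg _) (Or.imp (congrArg (Prod.mk c))
    (Or.imp (congrArg (Prod.mk c)) (congrArg (Prod.mk c))))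

end Darts

namespace Diagram

variable {A : Ambient} (D : Diagram A)

theorem next_apply (w : Dart D.crossings) : D.next w = opp _ (D.edge w) := rfl

theorem nextCorner_apply {n : ℕ} (e : Equiv.Perm (Dart n)) (w : Dart n) :
    nextCorner e w = opp _ (rot _ (e w)) := rot_symm _

theorem opp_next_opp (w : Dart D.crossings) : opp _ (D.next (opp _ w)) = D.next⁻¹ w := by
  rw [eq_inv_iff_eq, next_apply, next_apply, opp_opp, D.edge_edge, opp_opp]

theorem opp_pow_next (w : Dart D.crossings) (k : ℤ) :
    opp _ ((D.next ^ k) w) = (D.next ^ (-k)) (opp _ w) := by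
  have key : ∀ (k : ℕ) w, opp _ ((D.next ^ k) w) = (D.next⁻¹ ^ k) (opp _ w) := by
    intro k
    induction k with
    | zero => simp
    | succ k ih =>
      intro w
      rw [pow_succ, mul_apply, ih, pow_succ, mul_apply, ← opp_next_opp, opp_opp]
  obtain ⟨k, rfl | rfl⟩ := k.eq_nat_or_neg
  · rw [zpow_natCast, key, zpow_neg, zpow_natCast, inv_pow]
  · have := key k ((D.next ^ (-(k : ℤ))) w)
    rw [neg_neg]
    rw [← zpow_natCast, ← mul_apply (D.next ^ (k : ℤ)), ← zpow_add, add_neg_cancel, zpow_zero,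
      one_apply, inv_pow, eq_inv_iff_eq] at this
    rw [zpow_natCast, this]

/-- `opp` reverses the walk, so on a cycle containing both darts it would act as a reflection. Its
midpoint is a dart fixed by `opp` (even distance) or an arc with equal ends (odd distance), and
neither exists. -/
theorem not_sameCycle_opp (w : Dart D.crossings) : ¬ D.next.SameCycle w (opp _ w) := by
  rintro ⟨k, hk⟩
  have key : ∀ j : ℤ, opp _ ((D.next ^ j) w) = (D.next ^ (k - j)) w := by
    intro j
    rw [opp_pow_next, ← hk, ← mul_apply, ← zpow_add, sub_eq_neg_add]
  rcases Int.even_or_odd' k with ⟨j, rfl | rfl⟩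
  · apply opp_ne ((D.next ^ j) w)
    rw [key, two_mul, add_sub_cancel_right]
  · apply D.edge_ne ((D.next ^ j) w)
    have h := D.next_apply ((D.next ^ j) w)
    rw [← mul_apply, ← zpow_one_add] at h
    rw [← opp_opp (D.edge _), ← h, key]
    congr 2
    ring

theorem sameCycle_next (w : Dart D.crossings) : D.next.SameCycle w (D.next w) :=
  ⟨1, by simp⟩

theorem sameCycle_opp_edge (w : Dart D.crossings) :
    D.next.SameCycle (D.edge w) (opp _ w) := by
  simpa [next_apply, D.edge_edge] using D.sameCycle_next (D.edge w)

theorem sameCycle_opp_opp {v w : Dart D.crossings} (h : D.next.SameCycle v w) :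
    D.next.SameCycle (opp _ v) (opp _ w) := by
  obtain ⟨k, rfl⟩ := h
  exact ⟨-k, (D.opp_pow_next v k).symm⟩

/-- Each generator `edge` or `opp` carries the pair of opposite cycles to itself, and by
`one_component` the generated group is transitive. -/
theorem sameCycle_or_opp (v w : Dart D.crossings) :
    D.next.SameCycle v w ∨ D.next.SameCycle v (opp _ w) := by
  obtain ⟨g, hg, rfl⟩ := D.one_component v w
  induction hg using Subgroup.closure_induction_left with
  | one => exact Or.inl (SameCycle.refl _ _)
  | mul_left x hx y _ ih =>
    have step : ∀ u, D.next.SameCycle v u ∨ D.next.SameCycle v (opp _ u) →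
        D.next.SameCycle v (x u) ∨ D.next.SameCycle v (opp _ (x u)) := by
      intro u hu
      rcases hx with rfl | hx
      · rw [or_comm]
        refine hu.imp (fun h => h.trans (D.sameCycle_next u)) fun h => ?_
        exact h.trans (D.sameCycle_opp_edge u).symm
      · rw [Set.mem_singleton_iff.1 hx, opp_opp, or_comm]
        exact hu
    exact step _ ih
  | inv_mul_cancel x hx y _ ih =>
    have step : ∀ u, D.next.SameCycle v u ∨ D.next.SameCycle v (opp _ u) →
        D.next.SameCycle v (x⁻¹ u) ∨ D.next.SameCycle v (opp _ (x⁻¹ u)) := by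
      intro u hu
      rcases hx with rfl | hx
      · have e : D.edge⁻¹ u = D.edge u := by rw [inv_eq_iff_eq, D.edge_edge]
        rw [e, or_comm]
        refine hu.imp (fun h => h.trans (D.sameCycle_next u)) fun h => ?_
        exact h.trans (D.sameCycle_opp_edge u).symm
      · have e : (opp D.crossings)⁻¹ u = opp _ u := by rw [inv_eq_iff_eq, opp_opp]
        rw [Set.mem_singleton_iff.1 hx, e, opp_opp, or_comm]
        exact hu
    exact step _ ih

/-- The darts along which one leaves the crossings when one walks along the knot in one of
the two directions. -/
structure IsOrientation (F : Set (Dart D.crossings)) : Prop where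
  opp_mem : ∀ w, opp _ w ∈ F ↔ w ∉ F
  mem_iff : ∀ v ∈ F, ∀ w, w ∈ F ↔ D.next.SameCycle v w

variable {D}

theorem isOrientation_cycle (x : Dart D.crossings) :
    D.IsOrientation {w | D.next.SameCycle x w} where
  opp_mem w := by
    constructor
    · intro h h'
      exact D.not_sameCycle_opp w (SameCycle.trans (SameCycle.symm h') h)
    · exact (D.sameCycle_or_opp x w).resolve_left
  mem_iff v hv w := ⟨fun h => (SameCycle.symm hv).trans h, fun h => SameCycle.trans hv h⟩

theorem exists_isOrientation (D : Diagram A) : ∃ F, D.IsOrientation F := by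
  by_cases h : Nonempty (Dart D.crossings)
  · obtain ⟨x⟩ := h
    exact ⟨_, isOrientation_cycle x⟩
  · rw [not_nonempty_iff] at h
    exact ⟨∅, fun w => isEmptyElim w, fun w => isEmptyElim w⟩

variable {F : Set (Dart D.crossings)}

namespace IsOrientation

theorem next_mem (hF : D.IsOrientation F) {w : Dart D.crossings} (hw : w ∈ F) : D.next w ∈ F :=
  (hF.mem_iff w hw _).2 (D.sameCycle_next w)

theorem sameCycle (hF : D.IsOrientation F) {v w : Dart D.crossings} (hv : v ∈ F) (hw : w ∈ F) :
    D.next.SameCycle v w :=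
  (hF.mem_iff v hv w).1 hw

/-- An arc is left at one end and entered at the other, so exactly one of its two darts is outgoing.
-/
theorem edge_mem (hF : D.IsOrientation F) (w : Dart D.crossings) : D.edge w ∈ F ↔ w ∉ F := by
  have key : ∀ w, w ∈ F → D.edge w ∉ F := by
    intro w hw h
    exact (hF.opp_mem w).1 ((hF.mem_iff _ h _).2 (D.sameCycle_opp_edge w)) hw
  refine ⟨fun h hw => key w hw h, fun h => ?_⟩
  by_contra h'
  have h1 := hF.next_mem ((hF.opp_mem w).2 h)
  have h2 := hF.next_mem ((hF.opp_mem (D.edge w)).2 h')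
  have h3 : D.next w ∈ F := by
    have := (hF.opp_mem (D.edge w)).2 h'
    rwa [← next_apply] at this
  refine h ((hF.mem_iff _ h3 w).2 (D.sameCycle_next w).symm)

theorem eq_or_eq_opp (hF : D.IsOrientation F) {F' : Set (Dart D.crossings)}
    (hF' : D.IsOrientation F') : F' = F ∨ F' = {w | opp _ w ∈ F} := by
  rcases Set.eq_empty_or_nonempty F with rfl | ⟨x, hx⟩
  · left
    by_contra h
    obtain ⟨w, -⟩ := Set.nonempty_iff_ne_empty.2 h
    exact Set.notMem_empty _ ((hF.opp_mem w).2 (Set.notMem_empty _))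
  · by_cases hx' : x ∈ F'
    · left
      ext w
      rw [hF.mem_iff x hx, hF'.mem_iff x hx']
    · right
      ext w
      have hxo : opp _ x ∈ F' := (hF'.opp_mem x).2 hx'
      rw [hF'.mem_iff _ hxo, Set.mem_ofPred_eq, hF.mem_iff x hx]
      refine ⟨fun h => by simpa using D.sameCycle_opp_opp h, fun h => ?_⟩
      simpa using D.sameCycle_opp_opp h

end IsOrientation

/-- Every crossing has, for each orientation, one dart `w` such that the two strands leave it along
`w` and `rot w`. -/
def IsTail (D : Diagram A) (F : Set (Dart D.crossings)) (w : Dart D.crossings) : Prop :=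
  w ∈ F ∧ rot _ w ∈ F

theorem IsTail.eq_of_fst_eq (hF : D.IsOrientation F) {v w : Dart D.crossings} (hv : D.IsTail F v)
    (hw : D.IsTail F w) (h : v.1 = w.1) : v = w := by
  rcases KnotDiag.eq_of_fst_eq h with rfl | rfl | rfl | rfl
  · rfl
  · have := hw.2
    rw [rot_rot, hF.opp_mem] at this
    exact absurd hv.1 this
  · exact absurd hv.1 ((hF.opp_mem _).1 hw.1)
  · exact absurd hv.2 ((hF.opp_mem _).1 hw.1)

open Classical in
/-- The tails of the crossings. -/
noncomputable def tails (D : Diagram A) (F : Set (Dart D.crossings)) : Finset (Dart D.crossings) :=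
  Finset.univ.filter (D.IsTail F)

@[simp] theorem mem_tails {w : Dart D.crossings} : w ∈ D.tails F ↔ D.IsTail F w := by
  simp [tails]

/-- The weight of the crossings with the tails `v` and `w`. -/
noncomputable def weight (D : Diagram A) (v w : Dart D.crossings) : ZMod 4 × ZMod 3 :=
  chordWeight (Reaches D.next) v (rot _ v) w (rot _ w)

theorem ne_of_fst_ne {v w : Dart D.crossings} (h : v.1 ≠ w.1) : v ≠ w := fun e => h (by rw [e])

theorem reaches_opp (hF : D.IsOrientation F) {a b c : Dart D.crossings} (ha : a ∈ F) (hb : b ∈ F)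
    (hc : c ∈ F) (hab : a ≠ b) (hac : a ≠ c) (hbc : b ≠ c) :
    Reaches D.next (opp _ a) (opp _ b) (opp _ c) ↔ ¬ Reaches D.next a b c := by
  rw [← reaches_inv_iff _ (hF.sameCycle ha hb) (hF.sameCycle ha hc) hab hac hbc]
  refine Reaches.map (opp _).injective (fun x => ?_) a b c
  rw [← opp_next_opp, opp_opp]

theorem tails_opp : D.tails {w | opp _ w ∈ F} = (D.tails F).image (opp _) := by
  ext w
  simp only [mem_tails, Finset.mem_image, IsTail, Set.mem_ofPred_eq]
  refine ⟨fun h => ⟨opp _ w, ⟨h.1, by rw [rot_opp]; exact h.2⟩, opp_opp w⟩, ?_⟩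
  rintro ⟨v, hv, rfl⟩
  rw [rot_opp, opp_opp, opp_opp]
  exact hv

/-- Reversing the knot moves each tail to the opposite dart and reverses the cyclic order, so
`chordWeight_compl` applies to every pair. -/
theorem pairSum_weight_opp (hF : D.IsOrientation F) :
    pairSum (D.tails {w | opp _ w ∈ F}) D.weight = pairSum (D.tails F) D.weight := by
  rw [tails_opp, pairSum_image (opp _).injective]
  refine pairSum_congr fun v hv w hw hne => ?_
  rw [mem_tails] at hv hw
  have hne' : v.1 ≠ w.1 := fun h => hne (IsTail.eq_of_fst_eq hF hv hw h).symm
  unfold weight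
  refine chordWeight_compl ?_ ?_ ?_ ?_ <;>
  · simp only [rot_opp]
    refine reaches_opp hF ?_ ?_ ?_ ?_ ?_ ?_ <;>
    first
    | exact hv.1
    | exact hv.2
    | exact hw.1
    | exact hw.2
    | exact ne_of_fst_ne hne'
    | exact ne_of_fst_ne hne'.symm
    | exact (rot_ne _).symm

/-- The sum of the weights of all pairs of crossings. -/
noncomputable def chordInvariant (D : Diagram A) : ZMod 4 × ZMod 3 :=
  pairSum (D.tails (Classical.choose D.exists_isOrientation)) D.weight

theorem chordInvariant_eq (hF : D.IsOrientation F) :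
    D.chordInvariant = pairSum (D.tails F) D.weight := by
  have h := Classical.choose_spec D.exists_isOrientation
  unfold chordInvariant
  rcases hF.eq_or_eq_opp h with e | e
  · rw [e]
  · rw [e, pairSum_weight_opp hF]

namespace IsErasure

variable {D' : Diagram A} {S : Set (Fin D.crossings)} {f : Dart D'.crossings → Dart D.crossings}

theorem firstReturn (h : D.IsErasure S D' f) : FirstReturn D.next D'.next f := by
  refine ⟨h.injective, fun y => ?_⟩
  obtain ⟨k, hk, hk'⟩ := h.map_next y
  refine ⟨k, hk, fun j hj => ?_⟩
  rw [h.range_eq]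
  exact fun hn => hn (hk' j hj)

theorem map_opp (h : D.IsErasure S D' f) (w : Dart D'.crossings) : f (opp _ w) = opp _ (f w) := by
  rw [← rot_rot, h.map_rot, h.map_rot, rot_rot]

theorem isOrientation (h : D.IsErasure S D' f) (hF : D.IsOrientation F) :
    D'.IsOrientation (f ⁻¹' F) where
  opp_mem w := by rw [Set.mem_preimage, h.map_opp, hF.opp_mem, Set.mem_preimage]
  mem_iff v hv w := by rw [Set.mem_preimage, hF.mem_iff _ hv, h.firstReturn.sameCycle_iff]

theorem fst_notMem (h : D.IsErasure S D' f) (w : Dart D'.crossings) : (f w).1 ∉ S := by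
  have : f w ∈ Set.range f := ⟨w, rfl⟩
  rwa [h.range_eq] at this

theorem mem_tails_iff (h : D.IsErasure S D' f) (w : Dart D.crossings) :
    w ∈ (D'.tails (f ⁻¹' F)).image f ↔ w ∈ D.tails F ∧ w.1 ∉ S := by
  simp only [Finset.mem_image, mem_tails, IsTail, Set.mem_preimage]
  constructor
  · rintro ⟨v, hv, rfl⟩
    rw [h.map_rot] at hv
    exact ⟨hv, h.fst_notMem v⟩
  · rintro ⟨hw, hS⟩
    obtain ⟨v, rfl⟩ : w ∈ Set.range f := by rwa [h.range_eq]
    exact ⟨v, by rwa [h.map_rot], rfl⟩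

/-- The surviving chords keep their cyclic order. Both diagrams can therefore be compared inside
`D`, and only the pairs involving erased crossings matter. -/
theorem chordInvariant_eq (h : D.IsErasure S D' f) (hF : D.IsOrientation F) :
    D'.chordInvariant = pairSum ((D'.tails (f ⁻¹' F)).image f) D.weight := by
  rw [Diagram.chordInvariant_eq (h.isOrientation hF), pairSum_image h.injective]
  refine pairSum_congr fun v _ w _ _ => ?_
  unfold weight
  simp only [← h.map_rot]
  exact (chordWeight_congr (h.firstReturn.reaches_iff _ _ _) (h.firstReturn.reaches_iff _ _ _)
    (h.firstReturn.reaches_iff _ _ _) (h.firstReturn.reaches_iff _ _ _)).symm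

/-- Count darts, four to a crossing, inside and outside the range of `f`. -/
theorem crossings_eq (h : D.IsErasure S D' f) : D.crossings = D'.crossings + S.ncard := by
  classical
  have h1 : (Set.range f).ncard = D'.crossings * 4 := by
    rw [← Set.image_univ, Set.ncard_image_of_injective _ h.injective, Set.ncard_univ]
    simp
  have h2 : (Set.range f)ᶜ.ncard = S.ncard * 4 := by
    have : (Set.range f)ᶜ = S ×ˢ (Set.univ : Set (ZMod 4)) := by
      ext x
      simp [h.range_eq]
    rw [this, Set.ncard_prod, Set.ncard_univ]
    simp
  have h3 := Set.ncard_add_ncard_compl (Set.range f)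
  rw [h1, h2] at h3
  have h4 : Nat.card (Dart D.crossings) = D.crossings * 4 := by simp
  omega

end IsErasure

/-- Erasing nothing: isotopy invariance becomes a special case of the results on erasures. -/
theorem Iso.isErasure {D E : Diagram A} (f : Iso D E) : E.IsErasure ∅ D f.toEquiv where
  injective := f.toEquiv.injective
  range_eq := by simp
  map_rot := f.map_rot
  map_over := f.map_over
  map_next x := ⟨0, by
    rw [next_apply, zero_add, pow_one, next_apply, ← f.map_edge, ← rot_rot, f.map_rot, f.map_rot,
      rot_rot], by simp⟩

theorem Iso.chordInvariant_eq {D E : Diagram A} (f : Iso D E) :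
    D.chordInvariant = E.chordInvariant := by
  obtain ⟨F, hF⟩ := E.exists_isOrientation
  rw [f.isErasure.chordInvariant_eq hF, Diagram.chordInvariant_eq hF]
  congr 1
  ext w
  rw [f.isErasure.mem_tails_iff]
  simp

theorem Iso.crossings_eq {D E : Diagram A} (f : Iso D E) : D.crossings = E.crossings := by
  simpa using f.isErasure.crossings_eq.symm

end Diagram

end KnotDiag

/-! ### The effect of the Reidemeister moves on the chord invariant -/

namespace CyclicWalk

theorem chordWeight_cyc_comp {k : ℕ} {a b : Fin k → ℕ} (h : ∀ i j, a i < a j ↔ b i < b j)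
    (i j i' j' : Fin k) : chordWeight Cyc (a i) (a j) (a i') (a j') =
      chordWeight Cyc (b i) (b j) (b i') (b j') :=
  chordWeight_cyc_congr (a := a ∘ ![i, j, i', j']) (b := b ∘ ![i, j, i', j']) fun _ _ => h _ _

/-- The chord of a loop joins neighbouring points, which no other chord separates. The second
component is not controlled, since the two chords still have comparable directions. -/
theorem kink_weight {p q : ℕ} (hp : 2 ≤ p) (hq : 2 ≤ q) (hpq : p ≠ q) :
    (chordWeight Cyc p q 1 0 + chordWeight Cyc 1 0 p q).1 = 0 := by
  rcases lt_or_gt_of_ne hpq with h | h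
  · have := chordWeight_cyc_comp (a := ![p, q, 1, 0]) (b := ![2, 3, 1, 0]) (by
      intro i j; fin_cases i <;> fin_cases j <;> simp <;> omega)
    have h1 := this 0 1 2 3
    have h2 := this 2 3 0 1
    simp only [Matrix.cons_val] at h1 h2
    rw [h1, h2]
    decide
  · have := chordWeight_cyc_comp (a := ![p, q, 1, 0]) (b := ![3, 2, 1, 0]) (by
      intro i j; fin_cases i <;> fin_cases j <;> simp <;> omega)
    have h1 := this 0 1 2 3
    have h2 := this 2 3 0 1
    simp only [Matrix.cons_val] at h1 h2
    rw [h1, h2]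
    decide

/-- The strands occupy the positions 0, 1 and `m`, `m + 1`. The six lists are the possible relative
orders with the two ends `p`, `q` of a third chord. -/
theorem bigon_order {m p q : ℕ} (hm : 2 ≤ m) (hp : 2 ≤ p) (hq : 2 ≤ q) (hpq : p ≠ q) (hpm : p ≠ m)
    (hpm' : p ≠ m + 1) (hqm : q ≠ m) (hqm' : q ≠ m + 1) :
    ∃ b ∈ ([![0, 1, 2, 3, 4, 5], ![0, 1, 2, 3, 5, 4], ![0, 1, 3, 4, 2, 5], ![0, 1, 3, 4, 5, 2],
      ![0, 1, 4, 5, 2, 3], ![0, 1, 4, 5, 3, 2]] : List (Fin 6 → ℕ)),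
      ∀ i j, (![0, 1, m, m + 1, p, q] : Fin 6 → ℕ) i < ![0, 1, m, m + 1, p, q] j ↔ b i < b j := by
  have : ∀ b : Fin 6 → ℕ, (b 0 = 0 ∧ b 1 = 1 ∧ b 3 = b 2 + 1 ∧ 2 ≤ b 2 ∧ 2 ≤ b 4 ∧ 2 ≤ b 5 ∧
      (b 4 < b 2 ∨ b 3 < b 4) ∧ (b 5 < b 2 ∨ b 3 < b 5) ∧
      (p < q ↔ b 4 < b 5) ∧ (m < p ↔ b 2 < b 4) ∧ (m < q ↔ b 2 < b 5) ∧ b 4 ≠ b 5) →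
      ∀ i j, (![0, 1, m, m + 1, p, q] : Fin 6 → ℕ) i < ![0, 1, m, m + 1, p, q] j ↔ b i < b j := by
    rintro b ⟨h0, h1, h3, h2, h4, h5, h42, h52, e1, e2, e3, h45⟩
    simp only [Fin.forall_fin_succ]
    simp
    omega
  rcases lt_or_gt_of_ne hpq with h1 | h1 <;> rcases lt_or_gt_of_ne hpm with h2 | h2 <;>
    rcases lt_or_gt_of_ne hqm with h3 | h3
  · exact ⟨![0, 1, 4, 5, 2, 3], by simp, this _ (by simp; omega)⟩
  · exact ⟨![0, 1, 3, 4, 2, 5], by simp, this _ (by simp; omega)⟩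
  · omega
  · exact ⟨![0, 1, 2, 3, 4, 5], by simp, this _ (by simp; omega)⟩
  · exact ⟨![0, 1, 4, 5, 3, 2], by simp, this _ (by simp; omega)⟩
  · omega
  · exact ⟨![0, 1, 3, 4, 5, 2], by simp, this _ (by simp; omega)⟩
  · exact ⟨![0, 1, 2, 3, 5, 4], by simp, this _ (by simp; omega)⟩

/-- One chord of the bigon goes from the first strand to the second, the other one goes back. A
third chord is linked with both or with neither: the first components add up to 0 or 4, and the
signs cancel. The two conjuncts are antiparallel and parallel strands. -/
theorem bigon_weight {m p q : ℕ} (hm : 2 ≤ m) (hp : 2 ≤ p) (hq : 2 ≤ q) (hpq : p ≠ q) (hpm : p ≠ m)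
    (hpm' : p ≠ m + 1) (hqm : q ≠ m) (hqm' : q ≠ m + 1) :
    (chordWeight Cyc p q 1 m + chordWeight Cyc 1 m p q) +
      (chordWeight Cyc p q (m + 1) 0 + chordWeight Cyc (m + 1) 0 p q) = 0 ∧
    (chordWeight Cyc p q (m + 1) 1 + chordWeight Cyc (m + 1) 1 p q) +
      (chordWeight Cyc p q 0 m + chordWeight Cyc 0 m p q) = 0 := by
  obtain ⟨b, hb, h⟩ := bigon_order hm hp hq hpq hpm hpm' hqm hqm'
  have key := chordWeight_cyc_comp h
  have h1 := key 4 5 1 2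
  have h2 := key 1 2 4 5
  have h3 := key 4 5 3 0
  have h4 := key 3 0 4 5
  have h5 := key 4 5 3 1
  have h6 := key 3 1 4 5
  have h7 := key 4 5 0 2
  have h8 := key 0 2 4 5
  simp only [Matrix.cons_val] at h1 h2 h3 h4 h5 h6 h7 h8
  rw [h1, h2, h3, h4, h5, h6, h7, h8]
  clear key h h1 h2 h3 h4 h5 h6 h7 h8
  revert b
  decide

/-- The two chords of the bigon are unlinked for antiparallel strands and linked for parallel ones.
-/
theorem bigon_pair_weight {m : ℕ} (hm : 2 ≤ m) :
    chordWeight Cyc 1 m (m + 1) 0 + chordWeight Cyc (m + 1) 0 1 m = (0, 2) ∧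
    chordWeight Cyc (m + 1) 1 0 m + chordWeight Cyc 0 m (m + 1) 1 = (2, 0) := by
  have := chordWeight_cyc_comp (a := ![0, 1, m, m + 1]) (b := ![0, 1, 2, 3]) (by
      intro i j; fin_cases i <;> fin_cases j <;> simp <;> omega)
  have h1 := this 1 2 3 0
  have h2 := this 3 0 1 2
  have h3 := this 3 1 0 2
  have h4 := this 0 2 3 1
  simp only [Matrix.cons_val] at h1 h2 h3 h4
  rw [h1, h2, h3, h4]
  decide

/-- The indices of three pairs of neighbours are exchanged. -/
def neighbour : Fin 6 → Fin 6 := ![1, 0, 3, 2, 5, 4]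

theorem triangle_order {m l : ℕ} (hm : 2 ≤ m) (hl : 2 ≤ l) (h1 : l ≠ m) (h2 : l ≠ m + 1)
    (h3 : m ≠ l + 1) : ∃ b ∈ ([![0, 1, 2, 3, 4, 5], ![0, 1, 4, 5, 2, 3]] : List (Fin 6 → ℕ)),
      ∀ i j, (![0, 1, m, m + 1, l, l + 1] : Fin 6 → ℕ) i < ![0, 1, m, m + 1, l, l + 1] j ↔
        b i < b j := by
  rcases lt_or_gt_of_ne h1 with h | h
  · refine ⟨![0, 1, 4, 5, 2, 3], by simp, ?_⟩
    intro i j; fin_cases i <;> fin_cases j <;> simp <;> omega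
  · refine ⟨![0, 1, 2, 3, 4, 5], by simp, ?_⟩
    intro i j; fin_cases i <;> fin_cases j <;> simp <;> omega

/-- No end of the chord `(p, q)` lies between the old and the new position of an end, so its order
relative to them is unchanged. -/
theorem chordWeight_neighbour {p q u v u' v' : ℕ} (hu : u' = u + 1 ∨ u = u' + 1)
    (hv : v' = v + 1 ∨ v = v' + 1) (h : u ≠ v ∧ u ≠ v' ∧ u' ≠ v ∧ u' ≠ v')
    (hp : p ≠ u ∧ p ≠ u' ∧ p ≠ v ∧ p ≠ v') (hq : q ≠ u ∧ q ≠ u' ∧ q ≠ v ∧ q ≠ v') :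
    chordWeight Cyc p q u' v' = chordWeight Cyc p q u v ∧
    chordWeight Cyc u' v' p q = chordWeight Cyc u v p q := by
  have := chordWeight_cyc_comp (a := ![p, q, u', v']) (b := ![p, q, u, v]) (by
      intro i j; fin_cases i <;> fin_cases j <;> simp <;> omega)
  exact ⟨this 0 1 2 3, this 2 3 0 1⟩

theorem pairSum_insert_three {ι R : Type*} [DecidableEq ι] [AddCommMonoid R] {W : Finset ι}
    {s t u : ι} (hu : u ∉ W) (ht : t ∉ W) (hs : s ∉ W) (htu : t ≠ u) (hsu : s ≠ u) (hst : s ≠ t)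
    (g : ι → ι → R) :
    pairSum (insert s (insert t (insert u W))) g = pairSum W g +
      (∑ v ∈ W, (g v u + g u v) + ∑ v ∈ W, (g v t + g t v) + ∑ v ∈ W, (g v s + g s v)) +
      ((g u t + g t u) + (g u s + g s u) + (g t s + g s t)) := by
  rw [pairSum_insert (by simp [*]), pairSum_insert (by simp [*]), pairSum_insert hu,
    Finset.sum_insert hu, Finset.sum_insert (by simp [*]), Finset.sum_insert hu]
  abel

end CyclicWalk

namespace KnotDiag

open CyclicWalk Equiv.Perm Diagram

/-! ### The permutation of the darts in a move of type 3 -/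

theorem exchange_of_ne {n : ℕ} {x y w : Dart n} (h1 : w ≠ x) (h2 : w ≠ opp n x) (h3 : w ≠ rot n y)
    (h4 : w ≠ opp n (rot n y)) : exchange x y w = w := by
  rw [exchange, mul_apply, Equiv.swap_apply_of_ne_of_ne h1 h4, Equiv.swap_apply_of_ne_of_ne h2 h3]

theorem exchange_apply {n : ℕ} {x y : Dart n} (h : x.1 ≠ y.1) :
    exchange x y x = opp n (rot n y) ∧ exchange x y (opp n (rot n y)) = x ∧
      exchange x y (opp n x) = rot n y ∧ exchange x y (rot n y) = opp n x := by
  have h1 : x ≠ opp n x := (opp_ne x).symm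
  have h2 : x ≠ rot n y := fun e => h (by rw [e]; rfl)
  have h3 : opp n (rot n y) ≠ opp n x := fun e => h (congrArg Prod.fst e.symm :)
  have h4 : opp n (rot n y) ≠ rot n y := opp_ne _
  have h5 : opp n x ≠ opp n (rot n y) := h3.symm
  refine ⟨?_, ?_, ?_, ?_⟩ <;> rw [exchange, mul_apply]
  · rw [Equiv.swap_apply_left, Equiv.swap_apply_of_ne_of_ne h3 h4]
  · rw [Equiv.swap_apply_right, Equiv.swap_apply_of_ne_of_ne h1 h2]
  · rw [Equiv.swap_apply_of_ne_of_ne h1.symm h5, Equiv.swap_apply_left]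
  · rw [Equiv.swap_apply_of_ne_of_ne h2.symm h4.symm, Equiv.swap_apply_right]

theorem exchange_three_of_fst_ne {n : ℕ} {x y z w : Dart n} (hx : w.1 ≠ x.1) (hy : w.1 ≠ y.1)
    (hz : w.1 ≠ z.1) : (exchange x y * exchange y z * exchange z x) w = w := by
  have h : ∀ u v : Dart n, w.1 ≠ u.1 → w.1 ≠ v.1 → exchange u v w = w := fun u v hu hv =>
    exchange_of_ne (fun e => hu (by rw [e])) (fun e => hu (by rw [e]; rfl))
      (fun e => hv (by rw [e]; rfl)) (fun e => hv (by rw [e]; rfl))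
  rw [mul_apply, mul_apply, h z x hz hx, h y z hy hz, h x y hx hy]

/-- The three factors have disjoint supports: each takes two opposite darts at either crossing of
its strand. The table shows that `p` is an involution commuting with `opp`. -/
theorem exchange_three_apply {n : ℕ} {x y z : Dart n} (hxy : x.1 ≠ y.1) (hyz : y.1 ≠ z.1)
    (hzx : z.1 ≠ x.1) {p : Equiv.Perm (Dart n)}
    (hpe : p = exchange x y * exchange y z * exchange z x) :
    (p x = opp n (rot n y) ∧ p (opp n (rot n y)) = x ∧ p (opp n x) = rot n y ∧
      p (rot n y) = opp n x) ∧
    (p y = opp n (rot n z) ∧ p (opp n (rot n z)) = y ∧ p (opp n y) = rot n z ∧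
      p (rot n z) = opp n y) ∧
    (p z = opp n (rot n x) ∧ p (opp n (rot n x)) = z ∧ p (opp n z) = rot n x ∧
      p (rot n x) = opp n z) := by
  have o : ∀ w : Dart n, rot n w ≠ opp n w := fun w h => by
    rw [← rot_rot] at h; exact rot_ne _ h.symm
  have o' : ∀ w : Dart n, opp n (rot n w) ≠ opp n w := fun w h => by
    rw [← rot_opp] at h; exact rot_ne _ h
  -- the darts that are not moved by one of the three factors
  have fl : ∀ {u v : Dart n}, u.1 ≠ v.1 → exchange u v (rot n u) = rot n u ∧
      exchange u v (opp n (rot n u)) = opp n (rot n u) ∧ exchange u v v = v ∧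
      exchange u v (opp n v) = opp n v := fun {u v} h =>
    have h1 : ∀ a b : Dart n, a.1 = u.1 → b.1 = v.1 → a ≠ b := fun a b ha hb e =>
      h (by rw [← ha, ← hb, e])
    have h2 : ∀ a b : Dart n, b.1 = v.1 → a.1 = u.1 → b ≠ a := fun a b hb ha => (h1 a b ha hb).symm
    ⟨exchange_of_ne (rot_ne u) (o u) (h1 _ _ rfl rfl) (h1 _ _ rfl rfl),
      exchange_of_ne (opp_rot_ne u) (o' u) (h1 _ _ rfl rfl) (h1 _ _ rfl rfl),
      exchange_of_ne (h2 _ _ rfl rfl) (h2 _ _ rfl rfl) (rot_ne v).symm (opp_rot_ne v).symm,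
      exchange_of_ne (h2 _ _ rfl rfl) (h2 _ _ rfl rfl) (o v).symm (o' v).symm⟩
  have ff : ∀ {u v w : Dart n}, w.1 ≠ u.1 → w.1 ≠ v.1 → exchange u v w = w := fun hu hv =>
    exchange_of_ne (fun e => hu (by rw [e])) (fun e => hu (by rw [e]; rfl))
      (fun e => hv (by rw [e]; rfl)) (fun e => hv (by rw [e]; rfl))
  obtain ⟨a1, a2, a3, a4⟩ := exchange_apply hxy
  obtain ⟨b1, b2, b3, b4⟩ := exchange_apply hyz
  obtain ⟨c1, c2, c3, c4⟩ := exchange_apply hzx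
  obtain ⟨i1, i2, i3, i4⟩ := fl hxy
  obtain ⟨j1, j2, j3, j4⟩ := fl hyz
  obtain ⟨k1, k2, k3, k4⟩ := fl hzx
  have hp : ∀ w, p w = exchange x y (exchange y z (exchange z x w)) := fun w => by
    rw [hpe, mul_apply, mul_apply]
  have fx : ∀ w : Dart n, w.1 = x.1 → exchange y z w = w := fun w h =>
    ff (by rw [h]; exact hxy) (by rw [h]; exact hzx.symm)
  have fy : ∀ w : Dart n, w.1 = y.1 → exchange z x w = w := fun w h =>
    ff (by rw [h]; exact hyz) (by rw [h]; exact hxy.symm)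
  have fz : ∀ w : Dart n, w.1 = z.1 → exchange x y w = w := fun w h =>
    ff (by rw [h]; exact hzx) (by rw [h]; exact hyz.symm)
  refine ⟨⟨?_, ?_, ?_, ?_⟩, ⟨?_, ?_, ?_, ?_⟩, ⟨?_, ?_, ?_, ?_⟩⟩ <;> rw [hp]
  · rw [k3, fx x rfl, a1]
  · rw [fy (opp n (rot n y)) rfl, j2, a2]
  · rw [k4, fx (opp n x) rfl, a3]
  · rw [fy (rot n y) rfl, j1, a4]
  · rw [fy y rfl, b1, fz (opp n (rot n z)) rfl]
  · rw [k2, b2, i3]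
  · rw [fy (opp n y) rfl, b3, fz (rot n z) rfl]
  · rw [k1, b4, i4]
  · rw [c1, fx (opp n (rot n x)) rfl, i2]
  · rw [c2, j3, fz z rfl]
  · rw [c3, fx (rot n x) rfl, i1]
  · rw [c4, j4, fz (opp n z) rfl]

namespace Diagram

/-! ### Moves of types 1 and 2 -/

variable {A : Ambient} {D : Diagram A} {F : Set (Dart D.crossings)}

theorem edge_eq_rot_nextCorner (x : Dart D.crossings) :
    D.edge x = rot _ (nextCorner D.edge x) := by
  change D.edge x = rot _ ((rot _).symm (D.edge x))
  rw [Equiv.apply_symm_apply]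

/-- Positions along the oriented knot, counted from `x`. -/
theorem exists_position (hF : D.IsOrientation F) {x : Dart D.crossings} (hx : x ∈ F) :
    ∃ pos : Dart D.crossings → ℕ, pos x = 0 ∧
      (∀ a ∈ F, ∀ b ∈ F, pos a = pos b → a = b) ∧
      (∀ a ∈ F, D.next a ≠ x → pos (D.next a) = pos a + 1) ∧
      ∀ a ∈ F, ∀ b ∈ F, ∀ c ∈ F, (Reaches D.next a b c ↔ Cyc (pos a) (pos b) (pos c)) := by
  obtain ⟨pos, h0, h1, h2, h3⟩ := CyclicWalk.exists_position D.next x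
  exact ⟨pos, h0, fun a ha b hb => h1 a b (hF.sameCycle hx ha) (hF.sameCycle hx hb),
    fun a ha => h2 a (hF.sameCycle hx ha), fun a ha b hb c hc =>
    h3 a b c (hF.sameCycle hx ha) (hF.sameCycle hx hb) (hF.sameCycle hx hc)⟩

theorem weight_eq {pos : Dart D.crossings → ℕ}
    (h : ∀ a ∈ F, ∀ b ∈ F, ∀ c ∈ F, (Reaches D.next a b c ↔ Cyc (pos a) (pos b) (pos c)))
    {v w : Dart D.crossings} (hv : D.IsTail F v) (hw : D.IsTail F w) :
    D.weight v w = chordWeight Cyc (pos v) (pos (rot _ v)) (pos w) (pos (rot _ w)) :=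
  chordWeight_congr (h _ hv.1 _ hw.1 _ hv.2) (h _ hv.1 _ hw.2 _ hv.2)
    (h _ hw.1 _ hv.1 _ hw.2) (h _ hw.1 _ hv.2 _ hw.2)

theorem pos_ne {pos : Dart D.crossings → ℕ} (h : ∀ a ∈ F, ∀ b ∈ F, pos a = pos b → a = b)
    {v w : Dart D.crossings} (hv : v ∈ F) (hw : w ∈ F) (hne : v ≠ w) : pos v ≠ pos w :=
  fun e => hne (h v hv w hw e)

theorem chordInvariant_of_isOmega1 {x : Dart D.crossings} {D' : Diagram A}
    (h : D.IsOmega1 x D') :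
    D.crossings = D'.crossings + 1 ∧ D.chordInvariant.1 = D'.chordInvariant.1 := by
  obtain ⟨⟨hx, -⟩, f, hf, -⟩ := h
  refine ⟨by simpa using hf.crossings_eq, ?_⟩
  have he : D.edge x = rot _ x := by rw [edge_eq_rot_nextCorner, hx]
  have hF := isOrientation_cycle x
  set F := {w | D.next.SameCycle x w}
  have hxF : x ∈ F := SameCycle.refl _ _
  have hn : D.next x = opp _ (rot _ x) := by rw [next_apply, he]
  have hsF : opp _ (rot _ x) ∈ F := hn ▸ hF.next_mem hxF
  have hrs : rot _ (opp _ (rot _ x)) = x := by rw [rot_opp, rot_rot, opp_opp]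
  -- The knot leaves along `x`, runs around the loop and continues along `opp (rot x)`; the chord
  -- goes from position 1 back to position 0.
  have hs : D.IsTail F (opp _ (rot _ x)) := ⟨hsF, by rwa [hrs]⟩
  obtain ⟨pos, p0, pinj, psucc, hR⟩ := exists_position hF hxF
  have p1 : pos (opp _ (rot _ x)) = 1 := by
    rw [← hn, psucc x hxF (by rw [hn]; exact opp_rot_ne x), p0]
  have key : D.tails F = insert (opp _ (rot _ x)) ((D'.tails (f ⁻¹' F)).image f) := by
    ext w
    rw [Finset.mem_insert, hf.mem_tails_iff, mem_tails, Set.mem_singleton_iff]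
    constructor
    · intro hw
      by_cases h : w.1 = x.1
      · exact Or.inl (IsTail.eq_of_fst_eq hF hw hs h)
      · exact Or.inr ⟨hw, h⟩
    · rintro (rfl | h)
      · exact hs
      · exact h.1
  rw [hf.chordInvariant_eq hF, chordInvariant_eq hF, key, pairSum_insert, Prod.fst_add,
    Prod.fst_sum, Finset.sum_eq_zero, add_zero]
  · intro v hv
    rw [hf.mem_tails_iff, mem_tails, Set.mem_singleton_iff] at hv
    obtain ⟨hv, hvx⟩ := hv
    rw [weight_eq hR hv hs, weight_eq hR hs hv, hrs, p0, p1]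
    have a1 := pos_ne pinj hv.1 hxF (ne_of_fst_ne hvx)
    have a2 := pos_ne pinj hv.2 hxF (ne_of_fst_ne hvx)
    have a3 := pos_ne pinj hv.1 hsF (ne_of_fst_ne hvx)
    have a4 := pos_ne pinj hv.2 hsF (ne_of_fst_ne hvx)
    exact kink_weight (by omega) (by omega) (pos_ne pinj hv.1 hv.2 (rot_ne v).symm)
  · rw [hf.mem_tails_iff]
    simp

theorem chordInvariant_of_isOmega2 {x : Dart D.crossings} {D' : Diagram A}
    (h : D.IsOmega2 x D') : D.crossings = D'.crossings + 2 ∧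
      (D.chordInvariant = D'.chordInvariant + (0, 2) ∨
        D.chordInvariant = D'.chordInvariant + (2, 0)) := by
  obtain ⟨⟨hx, hne, -, -⟩, f, hf, -⟩ := h
  set y := nextCorner D.edge x with hy
  refine ⟨by rw [hf.crossings_eq, Set.ncard_pair hne.symm], ?_⟩
  have hex : D.edge x = rot _ y := edge_eq_rot_nextCorner x
  have hey : D.edge y = rot _ x := by rw [edge_eq_rot_nextCorner, hx]
  have hF := isOrientation_cycle x
  set F := {w | D.next.SameCycle x w}
  have hxF : x ∈ F := SameCycle.refl _ _
  have hnx : D.next x = opp _ (rot _ y) := by rw [next_apply, hex]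
  have hyF' : opp _ (rot _ y) ∈ F := hnx ▸ hF.next_mem hxF
  obtain ⟨pos, p0, pinj, psucc, hR⟩ := exists_position hF hxF
  have p1 : pos (opp _ (rot _ y)) = 1 := by
    rw [← hnx, psucc x hxF (by rw [hnx]; exact ne_of_fst_ne hne), p0]
  -- The change of the invariant splits into contributions with the other chords, which will vanish,
  -- and the mutual weight of the two erased chords.
  have main : ∀ s t, D.IsTail F s → D.IsTail F t → s.1 = x.1 → t.1 = y.1 →
      D.chordInvariant = D'.chordInvariant +
        ∑ v ∈ (D'.tails (f ⁻¹' F)).image f,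
          ((D.weight v t + D.weight t v) + (D.weight v s + D.weight s v)) +
        (D.weight t s + D.weight s t) := by
    intro s t hs ht hsx hty
    have ht' : t ∉ (D'.tails (f ⁻¹' F)).image f := by
      rw [hf.mem_tails_iff]; simp [hty]
    have hs' : s ∉ insert t ((D'.tails (f ⁻¹' F)).image f) := by
      rw [Finset.mem_insert, hf.mem_tails_iff, not_or]
      refine ⟨ne_of_fst_ne (by rw [hsx, hty]; exact hne.symm), by simp [hsx]⟩
    have key : D.tails F = insert s (insert t ((D'.tails (f ⁻¹' F)).image f)) := by
      ext w
      rw [Finset.mem_insert, Finset.mem_insert, hf.mem_tails_iff, mem_tails]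
      constructor
      · intro hw
        by_cases h1 : w.1 = x.1
        · exact Or.inl (IsTail.eq_of_fst_eq hF hw hs (h1.trans hsx.symm))
        by_cases h2 : w.1 = y.1
        · exact Or.inr (Or.inl (IsTail.eq_of_fst_eq hF hw ht (h2.trans hty.symm)))
        · exact Or.inr (Or.inr ⟨hw, by simp [h1, h2]⟩)
      · rintro (rfl | rfl | h)
        exacts [hs, ht, h.1]
    rw [hf.chordInvariant_eq hF, chordInvariant_eq hF, key, pairSum_insert hs',
      pairSum_insert ht', Finset.sum_insert ht']
    simp only [Finset.sum_add_distrib]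
    abel
  have pne : ∀ v ∈ (D'.tails (f ⁻¹' F)).image f, D.IsTail F v ∧ v.1 ≠ x.1 ∧ v.1 ≠ y.1 := by
    intro v hv
    rw [hf.mem_tails_iff, mem_tails] at hv
    simpa [not_or] using hv
  -- The first side runs from `x.1` to `y.1`. If `y` is outgoing, the second side runs back, so the
  -- strands are antiparallel; otherwise they are parallel.
  by_cases hyF : y ∈ F
  · left
    have hny : D.next y = opp _ (rot _ x) := by rw [next_apply, hey]
    have hxF' : opp _ (rot _ x) ∈ F := hny ▸ hF.next_mem hyF
    have p2 : pos (opp _ (rot _ x)) = pos y + 1 := by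
      rw [← hny, psucc y hyF (by rw [hny]; exact opp_rot_ne x)]
    have rs : ∀ u : Dart D.crossings, rot _ (opp _ (rot _ u)) = u := fun u => by
      rw [rot_opp, rot_rot, opp_opp]
    have hs : D.IsTail F (opp _ (rot _ x)) := ⟨hxF', by rwa [rs]⟩
    have ht : D.IsTail F (opp _ (rot _ y)) := ⟨hyF', by rwa [rs]⟩
    have b1 := pos_ne pinj hyF hxF (ne_of_fst_ne hne)
    have b2 := pos_ne pinj hyF hyF' (opp_rot_ne y).symm
    rw [main _ _ hs ht rfl rfl, Finset.sum_eq_zero, add_zero, weight_eq hR ht hs,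
      weight_eq hR hs ht, rs, rs, p0, p1, p2, (bigon_pair_weight (by omega)).1]
    intro v hv
    obtain ⟨hv, hvx, hvy⟩ := pne v hv
    have a1 := pos_ne pinj hv.1 hxF (ne_of_fst_ne hvx)
    have a2 := pos_ne pinj hv.2 hxF (ne_of_fst_ne hvx)
    have a3 := pos_ne pinj hv.1 hxF' (ne_of_fst_ne hvx)
    have a4 := pos_ne pinj hv.2 hxF' (ne_of_fst_ne hvx)
    have a5 := pos_ne pinj hv.1 hyF (ne_of_fst_ne hvy)
    have a6 := pos_ne pinj hv.2 hyF (ne_of_fst_ne hvy)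
    have a7 := pos_ne pinj hv.1 hyF' (ne_of_fst_ne hvy)
    have a8 := pos_ne pinj hv.2 hyF' (ne_of_fst_ne hvy)
    rw [weight_eq hR hv hs, weight_eq hR hs hv, weight_eq hR hv ht, weight_eq hR ht hv, rs, rs,
      p0, p1, p2]
    exact (bigon_weight (by omega) (by omega) (by omega) (pos_ne pinj hv.1 hv.2 (rot_ne v).symm)
      a5 (by omega) a6 (by omega)).1
  · right
    have hxF' : rot _ x ∈ F := by rwa [← hey, hF.edge_mem]
    have hoy : opp _ y ∈ F := (hF.opp_mem y).2 hyF
    have hnr : D.next (rot _ x) = opp _ y := by rw [next_apply, ← hey, D.edge_edge]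
    have p2 : pos (opp _ y) = pos (rot _ x) + 1 := by
      rw [← hnr, psucc _ hxF' (by rw [hnr]; exact ne_of_fst_ne hne)]
    have hs : D.IsTail F x := ⟨hxF, hxF'⟩
    have ht : D.IsTail F (opp _ y) := ⟨hoy, by rwa [rot_opp]⟩
    have b1 := pos_ne pinj hxF' hxF (rot_ne x)
    have b2 := pos_ne pinj hxF' hyF' (ne_of_fst_ne hne.symm)
    rw [main _ _ hs ht rfl rfl, Finset.sum_eq_zero, add_zero, weight_eq hR ht hs,
      weight_eq hR hs ht, rot_opp, p0, p1, p2, (bigon_pair_weight (by omega)).2]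
    intro v hv
    obtain ⟨hv, hvx, hvy⟩ := pne v hv
    have a1 := pos_ne pinj hv.1 hxF (ne_of_fst_ne hvx)
    have a2 := pos_ne pinj hv.2 hxF (ne_of_fst_ne hvx)
    have a3 := pos_ne pinj hv.1 hxF' (ne_of_fst_ne hvx)
    have a4 := pos_ne pinj hv.2 hxF' (ne_of_fst_ne hvx)
    have a5 := pos_ne pinj hv.1 hoy (ne_of_fst_ne hvy)
    have a6 := pos_ne pinj hv.2 hoy (ne_of_fst_ne hvy)
    have a7 := pos_ne pinj hv.1 hyF' (ne_of_fst_ne hvy)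
    have a8 := pos_ne pinj hv.2 hyF' (ne_of_fst_ne hvy)
    rw [weight_eq hR hv hs, weight_eq hR hs hv, weight_eq hR hv ht, weight_eq hR ht hv, rot_opp,
      p0, p1, p2]
    exact (bigon_weight (by omega) (by omega) (by omega) (pos_ne pinj hv.1 hv.2 (rot_ne v).symm)
      a3 (by omega) a4 (by omega)).2

end Diagram

end KnotDiag

set_option linter.unusedSimpArgs false

namespace CyclicWalk

/-! ### Exchanging neighbouring ends of three chords -/

theorem neighbour_neighbour (i : Fin 6) : neighbour (neighbour i) = i := by
  revert i
  decide

/-- Three pairs of positions are exchanged. Chords outside the triangle do not see this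
(`chordWeight_neighbour`), so only the three pairs inside matter; `hb` is that finite check, for
both cyclic orders of the three strands. -/
theorem pairSum_neighbour {ι : Type*} [DecidableEq ι] {W : Finset ι} {s : Fin 3 → ι}
    (hs : Function.Injective s) (hW : ∀ k, s k ∉ W) {t h t' h' : ι → ℕ} {a : Fin 6 → ℕ}
    {m l : ℕ} (ha : a = ![0, 1, m, m + 1, l, l + 1]) (hm : 2 ≤ m) (hl : 2 ≤ l) (h1 : l ≠ m)
    (h2 : l ≠ m + 1) (h3 : m ≠ l + 1) (hv : ∀ v ∈ W, t' v = t v ∧ h' v = h v)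
    (hva : ∀ v ∈ W, ∀ i, t v ≠ a i ∧ h v ≠ a i) {i j : Fin 3 → Fin 6}
    (ht : ∀ k, t (s k) = a (i k)) (hh : ∀ k, h (s k) = a (j k))
    (ht' : ∀ k, t' (s k) = a (neighbour (i k))) (hh' : ∀ k, h' (s k) = a (neighbour (j k)))
    (hij : ∀ k, i k ≠ j k ∧ neighbour (i k) ≠ j k)
    (hb : ∀ b ∈ ([![0, 1, 2, 3, 4, 5], ![0, 1, 4, 5, 2, 3]] : List (Fin 6 → ℕ)),
      pairSum Finset.univ (fun k k' => chordWeight Cyc (b (neighbour (i k))) (b (neighbour (j k)))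
        (b (neighbour (i k'))) (b (neighbour (j k')))) =
      pairSum Finset.univ (fun k k' => chordWeight Cyc (b (i k)) (b (j k)) (b (i k'))
        (b (j k'))) + (2, 0)) :
    pairSum (insert (s 0) (insert (s 1) (insert (s 2) W)))
        (fun v w => chordWeight Cyc (t' v) (h' v) (t' w) (h' w)) =
      pairSum (insert (s 0) (insert (s 1) (insert (s 2) W)))
        (fun v w => chordWeight Cyc (t v) (h v) (t w) (h w)) + (2, 0) := by
  obtain ⟨b, hbm, hab⟩ := triangle_order hm hl h1 h2 h3
  rw [← ha] at hab
  have hinj : ∀ i j, i ≠ j → a i ≠ a j := by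
    intro i j
    rw [ha]
    fin_cases i <;> fin_cases j <;> simp <;> omega
  have hnb : ∀ i, a (neighbour i) = a i + 1 ∨ a i = a (neighbour i) + 1 := by
    intro i
    rw [ha]
    fin_cases i <;> simp [neighbour]
  have hside : ∀ k, ∀ v ∈ W,
      chordWeight Cyc (t' v) (h' v) (t' (s k)) (h' (s k)) +
        chordWeight Cyc (t' (s k)) (h' (s k)) (t' v) (h' v) =
      chordWeight Cyc (t v) (h v) (t (s k)) (h (s k)) +
        chordWeight Cyc (t (s k)) (h (s k)) (t v) (h v) := by
    intro k v hvW
    rw [(hv v hvW).1, (hv v hvW).2, ht, hh, ht', hh']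
    have h4 : i k ≠ neighbour (j k) := fun e => (hij k).2 (by rw [e, neighbour_neighbour])
    have h5 : neighbour (i k) ≠ neighbour (j k) := fun e => (hij k).1 (by
      rw [← neighbour_neighbour (i k), e, neighbour_neighbour])
    obtain ⟨e1, e2⟩ := chordWeight_neighbour (hnb (i k)) (hnb (j k))
      ⟨hinj _ _ (hij k).1, hinj _ _ h4, hinj _ _ (hij k).2, hinj _ _ h5⟩
      ⟨(hva v hvW _).1, (hva v hvW _).1, (hva v hvW _).1, (hva v hvW _).1⟩
      ⟨(hva v hvW _).2, (hva v hvW _).2, (hva v hvW _).2, (hva v hvW _).2⟩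
    rw [e1, e2]
  have hWW : pairSum W (fun v w => chordWeight Cyc (t' v) (h' v) (t' w) (h' w)) =
      pairSum W (fun v w => chordWeight Cyc (t v) (h v) (t w) (h w)) :=
    pairSum_congr fun v hvW w hwW _ => by
      rw [(hv v hvW).1, (hv v hvW).2, (hv w hwW).1, (hv w hwW).2]
  have hpair := hb b hbm
  have huniv : (Finset.univ : Finset (Fin 3)) = insert 0 (insert 1 (insert 2 ∅)) := by decide
  rw [huniv, pairSum_insert_three (by simp) (by simp) (by simp) (by decide) (by decide)
    (by decide), pairSum_insert_three (by simp) (by simp) (by simp) (by decide) (by decide)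
    (by decide)] at hpair
  simp only [pairSum, Finset.sum_empty, add_zero, zero_add] at hpair
  have n01 : s 0 ≠ s 1 := hs.ne (by decide)
  have n02 : s 0 ≠ s 2 := hs.ne (by decide)
  have n12 : s 1 ≠ s 2 := hs.ne (by decide)
  rw [pairSum_insert_three (hW 2) (hW 1) (hW 0) n12 n02 n01,
    pairSum_insert_three (hW 2) (hW 1) (hW 0) n12 n02 n01]
  rw [Finset.sum_congr rfl (hside 2), Finset.sum_congr rfl (hside 1),
    Finset.sum_congr rfl (hside 0)]
  have key := chordWeight_cyc_comp hab
  simp only [ht, hh, ht', hh', key]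
  rw [hpair, hWW, ← add_assoc]

end CyclicWalk

namespace KnotDiag

namespace Diagram

open CyclicWalk Equiv.Perm

variable {A : Ambient} {D : Diagram A}

/-- The effect of a move of type 3 in terms of the oriented diagram: the chords keep their
weights in the new diagram if one exchanges their ends by the permutation `p`. -/
theorem exists_pairSum_of_isOmega3 {x : Dart D.crossings} {D' : Diagram A}
    {x' : Dart D'.crossings} (h : D.IsOmega3 x D' x') {F : Set (Dart D.crossings)}
    (hF : D.IsOrientation F) {pos : Dart D.crossings → ℕ}
    (hR : ∀ a ∈ F, ∀ b ∈ F, ∀ c ∈ F, (Reaches D.next a b c ↔ Cyc (pos a) (pos b) (pos c)))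
    {y z : Dart D.crossings} (hy : y = nextCorner D.edge x) (hz : z = nextCorner D.edge y)
    {p : Equiv.Perm (Dart D.crossings)} (hp : p = exchange x y * exchange y z * exchange z x) :
    D'.chordInvariant = pairSum (D.tails F) fun v w => chordWeight Cyc (pos (p v))
      (pos (p (rot _ v))) (pos (p w)) (pos (p (rot _ w))) := by
  obtain ⟨⟨hzx, nxy, nyz, nzx, -, -⟩, f, frot, -, fedge, -⟩ := h
  rw [← hy] at hzx nxy nyz nzx fedge
  rw [← hz] at hzx nyz nzx fedge
  rw [← hp] at fedge
  obtain ⟨⟨x1, x2, x3, x4⟩, ⟨y1, y2, y3, y4⟩, ⟨z1, z2, z3, z4⟩⟩ :=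
    exchange_three_apply nxy nyz nzx hp
  have pfix : ∀ w, w.1 ≠ x.1 → w.1 ≠ y.1 → w.1 ≠ z.1 → p w = w := fun w h1 h2 h3 => by
    rw [hp]
    exact exchange_three_of_fst_ne h1 h2 h3
  have ex : D.edge x = rot _ y := by rw [hy, edge_eq_rot_nextCorner]
  have ey : D.edge y = rot _ z := by rw [hz, edge_eq_rot_nextCorner]
  have ez : D.edge z = rot _ x := by rw [edge_eq_rot_nextCorner, hzx]
  have cases : ∀ P : Dart D.crossings → Prop,
      (P x ∧ P (rot _ x) ∧ P (opp _ x) ∧ P (opp _ (rot _ x))) →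
      (P y ∧ P (rot _ y) ∧ P (opp _ y) ∧ P (opp _ (rot _ y))) →
      (P z ∧ P (rot _ z) ∧ P (opp _ z) ∧ P (opp _ (rot _ z))) →
      (∀ w, p w = w → p (opp _ w) = opp _ w → P w) → ∀ w, P w := by
    intro P px py pz po w
    by_cases h1 : w.1 = x.1
    · rcases eq_of_fst_eq h1.symm with e | e | e | e <;> rw [e]
      exacts [px.1, px.2.1, px.2.2.1, px.2.2.2]
    by_cases h2 : w.1 = y.1
    · rcases eq_of_fst_eq h2.symm with e | e | e | e <;> rw [e]
      exacts [py.1, py.2.1, py.2.2.1, py.2.2.2]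
    by_cases h3 : w.1 = z.1
    · rcases eq_of_fst_eq h3.symm with e | e | e | e <;> rw [e]
      exacts [pz.1, pz.2.1, pz.2.2.1, pz.2.2.2]
    exact po w (pfix w h1 h2 h3) (pfix _ h1 h2 h3)
  have fopp : ∀ w, f (opp _ w) = opp _ (f w) := fun w => by
    rw [← rot_rot, frot, frot, rot_rot]
  -- `p` commutes with `opp` and preserves the outgoing darts, so `f ∘ p` identifies the walk along
  -- `D` with the walk along `D'`. The chords, however, are carried over by `f`, which respects
  -- `rot`. In the cyclic order of `D` their ends hence appear shifted by `p`.
  have popp : ∀ w, p (opp _ w) = opp _ (p w) := by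
    refine cases _ ?_ ?_ ?_ ?_
    · simp only [x1, x2, x3, x4, z1, z2, z3, z4, opp_opp, and_self]
    · simp only [x1, x2, x3, x4, y1, y2, y3, y4, opp_opp, and_self]
    · simp only [z1, z2, z3, z4, y1, y2, y3, y4, opp_opp, and_self]
    · intro w h1 h2
      rw [h1, h2]
  have pp : ∀ w, p (p w) = w := by
    refine cases _ ?_ ?_ ?_ ?_
    · simp only [x1, x2, x3, x4, z1, z2, z3, z4, and_self]
    · simp only [x1, x2, x3, x4, y1, y2, y3, y4, and_self]
    · simp only [z1, z2, z3, z4, y1, y2, y3, y4, and_self]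
    · intro w h1 h2
      rw [h1, h1]
  have rx : rot _ x ∈ F ↔ z ∉ F := by rw [← ez, hF.edge_mem]
  have ry : rot _ y ∈ F ↔ x ∉ F := by rw [← ex, hF.edge_mem]
  have rz : rot _ z ∈ F ↔ y ∉ F := by rw [← ey, hF.edge_mem]
  have pF : ∀ w, p w ∈ F ↔ w ∈ F := by
    refine cases _ ?_ ?_ ?_ ?_
    · simp only [x1, x2, x3, x4, z1, z2, z3, z4, hF.opp_mem, rx, ry, rz, not_not, and_self]
    · simp only [x1, x2, x3, x4, y1, y2, y3, y4, hF.opp_mem, rx, ry, rz, not_not, and_self]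
    · simp only [z1, z2, z3, z4, y1, y2, y3, y4, hF.opp_mem, rx, ry, rz, not_not, and_self]
    · intro w h1 h2
      rw [h1]
  have gnext : ∀ w, f (p (D.next w)) = D'.next (f (p w)) := fun w => by
    rw [next_apply, next_apply, fedge, ← fopp, ← popp]
  have ginj : Function.Injective fun w => f (p w) := f.injective.comp p.injective
  have hfr : FirstReturn D'.next D.next fun w => f (p w) :=
    ⟨ginj, fun w => ⟨0, by simp [gnext], by simp⟩⟩
  have fp : ∀ w, f w = f (p (p w)) := fun w => by rw [pp]
  have hF' : D'.IsOrientation {w | f.symm w ∈ F} := by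
    constructor
    · intro w
      obtain ⟨w, rfl⟩ := f.surjective w
      simp only [Set.mem_ofPred_eq, ← fopp, Equiv.symm_apply_apply, hF.opp_mem]
    · intro v hv w
      obtain ⟨v, rfl⟩ := f.surjective v
      obtain ⟨w, rfl⟩ := f.surjective w
      rw [Set.mem_ofPred_eq, Equiv.symm_apply_apply] at hv ⊢
      rw [fp v, fp w, hfr.sameCycle_iff, ← hF.mem_iff _ ((pF v).2 hv), pF]
  have htails : D'.tails {w | f.symm w ∈ F} = (D.tails F).image f := by
    ext w
    obtain ⟨w, rfl⟩ := f.surjective w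
    rw [mem_tails, IsTail, ← frot, f.injective.mem_finset_image, mem_tails, IsTail]
    simp
  rw [chordInvariant_eq hF', htails, pairSum_image f.injective]
  refine pairSum_congr fun v hv w hw _ => ?_
  rw [mem_tails] at hv hw
  have hR' : ∀ a ∈ F, ∀ b ∈ F, ∀ c ∈ F, (Reaches D'.next (f a) (f b) (f c) ↔
      Cyc (pos (p a)) (pos (p b)) (pos (p c))) := by
    intro a ha b hb c hc
    rw [← hR _ ((pF a).2 ha) _ ((pF b).2 hb) _ ((pF c).2 hc), fp a, fp b, fp c]
    exact hfr.reaches_iff _ _ _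
  unfold weight
  rw [← frot, ← frot]
  exact chordWeight_congr (hR' _ hv.1 _ hw.1 _ hv.2) (hR' _ hv.1 _ hw.2 _ hv.2)
    (hR' _ hw.1 _ hv.1 _ hw.2) (hR' _ hw.1 _ hv.2 _ hw.2)

theorem crossings_of_isOmega3 {x : Dart D.crossings} {D' : Diagram A}
    {x' : Dart D'.crossings} (h : D.IsOmega3 x D' x') : D.crossings = D'.crossings := by
  obtain ⟨-, f, -⟩ := h
  have := Fintype.card_congr f
  simpa using this

theorem chordInvariant_of_isOmega3 {x : Dart D.crossings} {D' : Diagram A}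
    {x' : Dart D'.crossings} (h : D.IsOmega3 x D' x') :
    D'.chordInvariant = D.chordInvariant + (2, 0) := by
  have hF := isOrientation_cycle x
  set F := {w | D.next.SameCycle x w}
  have hxF : x ∈ F := SameCycle.refl _ _
  obtain ⟨pos, p0, pinj, psucc, hR⟩ := exists_position hF hxF
  obtain ⟨y, hy⟩ : ∃ y, y = nextCorner D.edge x := ⟨_, rfl⟩
  obtain ⟨z, hz⟩ : ∃ z, z = nextCorner D.edge y := ⟨_, rfl⟩
  obtain ⟨p, hp⟩ : ∃ p, p = exchange x y * exchange y z * exchange z x := ⟨_, rfl⟩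
  rw [exists_pairSum_of_isOmega3 h hF hR hy hz hp]
  obtain ⟨⟨hzx, nxy, nyz, nzx, -, -⟩, -⟩ := h
  rw [← hy] at hzx nxy nyz nzx
  rw [← hz] at hzx nyz nzx
  obtain ⟨⟨x1, x2, x3, x4⟩, ⟨y1, y2, y3, y4⟩, ⟨z1, z2, z3, z4⟩⟩ :=
    exchange_three_apply nxy nyz nzx hp
  have ex : D.edge x = rot _ y := by rw [hy, edge_eq_rot_nextCorner]
  have ey : D.edge y = rot _ z := by rw [hz, edge_eq_rot_nextCorner]
  have ez : D.edge z = rot _ x := by rw [edge_eq_rot_nextCorner, hzx]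
  have rs : ∀ u : Dart D.crossings, rot _ (opp _ (rot _ u)) = u := fun u => by
    rw [rot_opp, rot_rot, opp_opp]
  have nx : D.next x = opp _ (rot _ y) := by rw [next_apply, ex]
  have hx2 : opp _ (rot _ y) ∈ F := nx ▸ hF.next_mem hxF
  have p1 : pos (opp _ (rot _ y)) = 1 := by
    rw [← nx, psucc x hxF (by rw [nx]; exact ne_of_fst_ne nxy.symm), p0]
  -- the second strand passes the crossings of `y` and `z` along `b` and `b'`
  have strand : ∀ b b', b ∈ F → D.next b = b' → b ≠ x → b' ≠ x →  b ≠ opp _ (rot _ y) →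
      b' ∈ F ∧ pos b' = pos b + 1 ∧ 2 ≤ pos b := by
    intro b b' hb e hbx hb'x hby
    have q1 := pos_ne pinj hb hxF hbx
    have q2 := pos_ne pinj hb hx2 hby
    exact ⟨e ▸ hF.next_mem hb, by rw [← e, psucc b hb (by rwa [e])], by omega⟩
  -- The common part of four cases. The strands leave the crossings along `x`, `opp (rot y)`, then
  -- `b`, `b'` and `c`, `c'`, numbered 0 to 5; `i` and `j` give the numbers of tail and head of the
  -- chord at each crossing.
  have finish : ∀ (b b' c c' : Dart D.crossings), b ∈ F → b' ∈ F → c ∈ F → c' ∈ F →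
      pos b' = pos b + 1 → pos c' = pos c + 1 → 2 ≤ pos b → 2 ≤ pos c →
      c ≠ b → c ≠ b' → c' ≠ b →
      (∀ w : Dart D.crossings, w ∈ ({b, b', c, c'} : Set _) → w.1 ∈ ({x.1, y.1, z.1} : Set _)) →
      ∀ (s : Fin 3 → Dart D.crossings) (i j : Fin 3 → Fin 6), (∀ k, D.IsTail F (s k)) →
      (∀ k, (s k).1 = ![x.1, y.1, z.1] k) →
      (∀ k, s k = ![x, opp _ (rot _ y), b, b', c, c'] (i k) ∧
        rot _ (s k) = ![x, opp _ (rot _ y), b, b', c, c'] (j k)) →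
      (∀ k, p (s k) = ![x, opp _ (rot _ y), b, b', c, c'] (neighbour (i k)) ∧
        p (rot _ (s k)) = ![x, opp _ (rot _ y), b, b', c, c'] (neighbour (j k))) →
      (∀ k, i k ≠ j k ∧ neighbour (i k) ≠ j k) →
      (∀ b ∈ ([![0, 1, 2, 3, 4, 5], ![0, 1, 4, 5, 2, 3]] : List (Fin 6 → ℕ)),
      pairSum Finset.univ (fun k k' => chordWeight Cyc (b (neighbour (i k))) (b (neighbour (j k)))
        (b (neighbour (i k'))) (b (neighbour (j k')))) =
      pairSum Finset.univ (fun k k' => chordWeight Cyc (b (i k)) (b (j k)) (b (i k'))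
        (b (j k'))) + (2, 0)) →
      (pairSum (D.tails F) fun v w => chordWeight Cyc (pos (p v))
      (pos (p (rot _ v))) (pos (p w)) (pos (p (rot _ w)))) = D.chordInvariant + (2, 0) := by
    intro b b' c c' hb hb' hc hc' eb ec hb2 hc2 ncb ncb' nc'b hcr s i j hs hs1 hsij hps hij hdec
    have hpos : ∀ k : Fin 6, pos (![x, opp _ (rot _ y), b, b', c, c'] k) =
        ![0, 1, pos b, pos b + 1, pos c, pos c + 1] k := by
      intro k
      fin_cases k
      exacts [p0, p1, rfl, eb, rfl, ec]
    have hmem : ∀ k : Fin 6, (![x, opp _ (rot _ y), b, b', c, c'] k) ∈ F := by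
      intro k
      fin_cases k
      exacts [hxF, hx2, hb, hb', hc, hc']
    have hcr' : ∀ k : Fin 6, (![x, opp _ (rot _ y), b, b', c, c'] k).1 ∈
        ({x.1, y.1, z.1} : Set _) := by
      intro k
      fin_cases k
      exacts [by simp, by simp, hcr _ (by simp), hcr _ (by simp), hcr _ (by simp),
        hcr _ (by simp)]
    have hsinj : Function.Injective s := by
      intro k k' e
      have := congrArg Prod.fst e
      rw [hs1, hs1] at this
      revert this
      fin_cases k <;> fin_cases k' <;> simp [nxy, nyz, nzx, nxy.symm, nyz.symm, nzx.symm]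
    set W := (D.tails F).filter fun w => w.1 ≠ x.1 ∧ w.1 ≠ y.1 ∧ w.1 ≠ z.1 with hWdef
    have hW : ∀ v, v ∈ W ↔ D.IsTail F v ∧ v.1 ≠ x.1 ∧ v.1 ≠ y.1 ∧ v.1 ≠ z.1 := by
      intro v
      rw [hWdef, Finset.mem_filter, mem_tails]
    have key : D.tails F = insert (s 0) (insert (s 1) (insert (s 2) W)) := by
      ext w
      rw [Finset.mem_insert, Finset.mem_insert, Finset.mem_insert, hW, mem_tails]
      constructor
      · intro hw
        by_cases e0 : w.1 = x.1
        · exact Or.inl (IsTail.eq_of_fst_eq hF hw (hs 0) (e0.trans (hs1 0).symm))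
        by_cases e1 : w.1 = y.1
        · exact Or.inr (Or.inl (IsTail.eq_of_fst_eq hF hw (hs 1) (e1.trans (hs1 1).symm)))
        by_cases e2 : w.1 = z.1
        · exact Or.inr (Or.inr (Or.inl
            (IsTail.eq_of_fst_eq hF hw (hs 2) (e2.trans (hs1 2).symm))))
        exact Or.inr (Or.inr (Or.inr ⟨hw, e0, e1, e2⟩))
      · rintro (rfl | rfl | rfl | h)
        exacts [hs 0, hs 1, hs 2, h.1]
    have hD : D.chordInvariant = pairSum (D.tails F) fun v w =>
        chordWeight Cyc (pos v) (pos (rot _ v)) (pos w) (pos (rot _ w)) := by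
      rw [chordInvariant_eq hF]
      refine pairSum_congr fun v hv w hw _ => ?_
      rw [mem_tails] at hv hw
      exact weight_eq hR hv hw
    rw [hD, key]
    refine pairSum_neighbour hsinj ?_ rfl hb2 hc2 (pos_ne pinj hc hb ncb) ?_ ?_ ?_ ?_
      (fun k => by rw [← hpos, (hsij k).1]) (fun k => by rw [← hpos, (hsij k).2])
      (fun k => by rw [← hpos, (hps k).1]) (fun k => by rw [← hpos, (hps k).2]) hij hdec
    · intro k
      rw [hW, hs1]
      fin_cases k <;> simp
    · rw [← eb]
      exact pos_ne pinj hc hb' ncb'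
    · rw [← ec]
      exact pos_ne pinj hb hc' nc'b.symm
    · intro v hv
      rw [hW] at hv
      have pfix : ∀ w, w.1 = v.1 → p w = w := fun w hw => by
        rw [hp]
        exact exchange_three_of_fst_ne (hw ▸ hv.2.1) (hw ▸ hv.2.2.1) (hw ▸ hv.2.2.2)
      rw [pfix v rfl, pfix (rot _ v) rfl]
      exact ⟨rfl, rfl⟩
    · intro v hv k
      rw [hW] at hv
      rw [← hpos]
      have hne : ∀ w : Dart D.crossings, w.1 = v.1 →
          w ≠ ![x, opp _ (rot _ y), b, b', c, c'] k := by
        intro w hw e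
        have := hcr' k
        rw [← e, hw] at this
        simp only [Set.mem_insert_iff, Set.mem_singleton_iff] at this
        tauto
      exact ⟨pos_ne pinj hv.1.1 (hmem k) (hne v rfl),
        pos_ne pinj hv.1.2 (hmem k) (hne (rot _ v) rfl)⟩
  -- The first side is oriented from `x.1` to `y.1`. The cases tell whether the second and the third
  -- side run in the same sense around the triangle; each yields its own pattern of chords, settled
  -- by `decide`.
  by_cases hyF : y ∈ F
  · have ny : D.next y = opp _ (rot _ z) := by rw [next_apply, ey]
    obtain ⟨b1, b2, b3⟩ := strand y _ hyF ny (ne_of_fst_ne nxy.symm) (ne_of_fst_ne nzx)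
      (opp_rot_ne y).symm
    by_cases hzF : z ∈ F
    · have nz : D.next z = opp _ (rot _ x) := by rw [next_apply, ez]
      obtain ⟨c1, c2, c3⟩ := strand z _ hzF nz (ne_of_fst_ne nzx) (opp_rot_ne x)
        (ne_of_fst_ne nyz.symm)
      refine finish y _ z _ hyF b1 hzF c1 b2 c2 b3 c3 (ne_of_fst_ne nyz.symm)
        (opp_rot_ne z).symm (ne_of_fst_ne nxy) (by simp)
        ![opp _ (rot _ x), opp _ (rot _ y), opp _ (rot _ z)] ![5, 1, 3] ![0, 2, 4] ?_ ?_ ?_ ?_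
        (by decide) (by decide)
      · intro k
        fin_cases k
        exacts [⟨c1, (rs x).symm ▸ hxF⟩, ⟨hx2, (rs y).symm ▸ hyF⟩, ⟨b1, (rs z).symm ▸ hzF⟩]
      · intro k
        fin_cases k <;> rfl
      · intro k
        fin_cases k
        exacts [⟨rfl, rs x⟩, ⟨rfl, rs y⟩, ⟨rfl, rs z⟩]
      · intro k
        fin_cases k
        exacts [⟨z2, (congrArg p (rs x)).trans x1⟩, ⟨x2, (congrArg p (rs y)).trans y1⟩,
          ⟨y2, (congrArg p (rs z)).trans z1⟩]
    · have hc : rot _ x ∈ F := by rwa [← ez, hF.edge_mem]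
      have nz : D.next (rot _ x) = opp _ z := by rw [next_apply, ← ez, D.edge_edge]
      obtain ⟨c1, c2, c3⟩ := strand _ _ hc nz (rot_ne x) (ne_of_fst_ne nzx) (ne_of_fst_ne nxy)
      refine finish y _ _ _ hyF b1 hc c1 b2 c2 b3 c3 (ne_of_fst_ne nxy)
        (ne_of_fst_ne nzx.symm) (ne_of_fst_ne nyz.symm) (by simp)
        ![x, opp _ (rot _ y), opp _ z] ![0, 1, 5] ![4, 2, 3] ?_ ?_ ?_ ?_
        (by decide) (by decide)
      · intro k
        fin_cases k
        exacts [⟨hxF, hc⟩, ⟨hx2, (rs y).symm ▸ hyF⟩, ⟨c1, (rot_opp z).symm ▸ b1⟩]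
      · intro k
        fin_cases k <;> rfl
      · intro k
        fin_cases k
        exacts [⟨rfl, rfl⟩, ⟨rfl, rs y⟩, ⟨rfl, rot_opp z⟩]
      · intro k
        fin_cases k
        exacts [⟨x1, z4⟩, ⟨x2, (congrArg p (rs y)).trans y1⟩,
          ⟨z3, (congrArg p (rot_opp z)).trans y2⟩]
  · have hb : rot _ z ∈ F := by rwa [← ey, hF.edge_mem]
    have ny : D.next (rot _ z) = opp _ y := by rw [next_apply, ← ey, D.edge_edge]
    obtain ⟨b1, b2, b3⟩ := strand _ _ hb ny (ne_of_fst_ne nzx) (ne_of_fst_ne nxy.symm)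
      (ne_of_fst_ne nyz.symm)
    by_cases hzF : z ∈ F
    · have nz : D.next z = opp _ (rot _ x) := by rw [next_apply, ez]
      obtain ⟨c1, c2, c3⟩ := strand z _ hzF nz (ne_of_fst_ne nzx) (opp_rot_ne x)
        (ne_of_fst_ne nyz.symm)
      refine finish _ _ z _ hb b1 hzF c1 b2 c2 b3 c3 (rot_ne z).symm
        (ne_of_fst_ne nyz.symm) (ne_of_fst_ne nzx.symm) (by simp)
        ![opp _ (rot _ x), opp _ y, z] ![5, 3, 4] ![0, 1, 2] ?_ ?_ ?_ ?_
        (by decide) (by decide)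
      · intro k
        fin_cases k
        exacts [⟨c1, (rs x).symm ▸ hxF⟩, ⟨b1, (rot_opp y).symm ▸ hx2⟩, ⟨hzF, hb⟩]
      · intro k
        fin_cases k <;> rfl
      · intro k
        fin_cases k
        exacts [⟨rfl, rs x⟩, ⟨rfl, rot_opp y⟩, ⟨rfl, rfl⟩]
      · intro k
        fin_cases k
        exacts [⟨z2, (congrArg p (rs x)).trans x1⟩, ⟨y3, (congrArg p (rot_opp y)).trans x2⟩,
          ⟨z1, y4⟩]
    · have hc : rot _ x ∈ F := by rwa [← ez, hF.edge_mem]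
      have nz : D.next (rot _ x) = opp _ z := by rw [next_apply, ← ez, D.edge_edge]
      obtain ⟨c1, c2, c3⟩ := strand _ _ hc nz (rot_ne x) (ne_of_fst_ne nzx) (ne_of_fst_ne nxy)
      have hzz : rot _ (rot _ z) = opp _ z := rot_rot z
      refine finish _ _ _ _ hb b1 hc c1 b2 c2 b3 c3 (ne_of_fst_ne nzx.symm)
        (ne_of_fst_ne nxy) (by rw [← rot_rot]; exact rot_ne _) (by simp)
        ![x, opp _ y, rot _ z] ![0, 3, 2] ![4, 1, 5] ?_ ?_ ?_ ?_
        (by decide) (by decide)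
      · intro k
        fin_cases k
        exacts [⟨hxF, hc⟩, ⟨b1, (rot_opp y).symm ▸ hx2⟩, ⟨hb, hzz.symm ▸ c1⟩]
      · intro k
        fin_cases k <;> rfl
      · intro k
        fin_cases k
        exacts [⟨rfl, rfl⟩, ⟨rfl, rot_opp y⟩, ⟨rfl, hzz⟩]
      · intro k
        fin_cases k
        exacts [⟨x1, z4⟩, ⟨y3, (congrArg p (rot_opp y)).trans x2⟩,
          ⟨y4, (congrArg p hzz).trans z3⟩]

end Diagram

end KnotDiag

/-! ### The clique complex has no simplices of dimension three -/

namespace KnotDiag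

open Diagram

variable {A : Ambient}

/-- The number of crossings of a diagram up to isotopy. -/
def DiagramClass.crossings : DiagramClass A → ℕ :=
  Quotient.lift Diagram.crossings fun _ _ ⟨f⟩ => f.crossings_eq

/-- The chord invariant of a diagram up to isotopy. -/
noncomputable def DiagramClass.chordInvariant : DiagramClass A → ZMod 4 × ZMod 3 :=
  Quotient.lift Diagram.chordInvariant fun _ _ ⟨f⟩ => f.chordInvariant_eq

/-- What a move that leads from `d` to `d'` may do to the number of crossings and to the
chord invariant. -/
def MayMove (c c' : ℕ) (u u' : ZMod 4 × ZMod 3) : Prop :=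
  (c = c' + 1 ∧ u.1 = u'.1) ∨ (c = c' + 2 ∧ (u = u' + (0, 2) ∨ u = u' + (2, 0))) ∨
    (c = c' ∧ u' = u + (2, 0))

/-- The ends form an unordered pair and a move of type 1 or 2 is listed in one direction only,
whence the two alternatives. -/
theorem MoveClass.mayMove {m : MoveClass A} {d d' : DiagramClass A} (h : m.ends = s(d, d')) :
    MayMove d.crossings d'.crossings d.chordInvariant d'.chordInvariant ∨
      MayMove d'.crossings d.crossings d'.chordInvariant d.chordInvariant := by
  induction m using Quot.ind with
  | mk m =>
    have key : ∃ e e' : DiagramClass A, m.ends = s(e, e') ∧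
        MayMove e.crossings e'.crossings e.chordInvariant e'.chordInvariant := by
      cases m with
      | omega1 D x D' k => exact ⟨⟦D⟧, ⟦D'⟧, rfl, Or.inl (chordInvariant_of_isOmega1 k)⟩
      | omega2 D x D' k => exact ⟨⟦D⟧, ⟦D'⟧, rfl, Or.inr (Or.inl (chordInvariant_of_isOmega2 k))⟩
      | omega3 D x D' x' k =>
        exact ⟨⟦D⟧, ⟦D'⟧, rfl,
          Or.inr (Or.inr ⟨crossings_of_isOmega3 k, chordInvariant_of_isOmega3 k⟩)⟩
    obtain ⟨e, e', he, hm⟩ := key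
    have h' : s(e, e') = s(d, d') := he.symm.trans h
    rw [Sym2.eq_iff] at h'
    rcases h' with ⟨rfl, rfl⟩ | ⟨rfl, rfl⟩
    exacts [Or.inl hm, Or.inr hm]

theorem crossings_ne_of_triangle {m m₁ m₂ : MoveClass A} {d d' e : DiagramClass A}
    (h : m.ends = s(d, d')) (h₁ : m₁.ends = s(d, e)) (h₂ : m₂.ends = s(d', e)) :
    d.crossings ≠ d'.crossings := by
  intro heq
  have t := MoveClass.mayMove h
  have t₁ := MoveClass.mayMove h₁
  have t₂ := MoveClass.mayMove h₂
  simp only [MayMove] at t t₁ t₂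
  rw [heq] at t t₁
  generalize d.chordInvariant = u at t t₁ t₂
  generalize d'.chordInvariant = u' at t t₁ t₂
  generalize e.chordInvariant = v at t t₁ t₂
  generalize d'.crossings = c at t t₁ t₂
  generalize e.crossings = c' at t t₁ t₂
  -- Equal crossing numbers leave only type 3, whose direction is irrelevant as (2,0) has order two.
  have t : u' = u + (2, 0) := by
    rcases t with (t | t | t) | (t | t | t)
    · omega
    · omega
    · exact t.2
    · omega
    · omega
    · rw [t.2, add_assoc, show ((2, 0) + (2, 0) : ZMod 4 × ZMod 3) = 0 by decide, add_zero]
  subst t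
  have e1 : ∀ a b : ZMod 4, a = b → a + 2 = b → False := by decide
  have e2 : ∀ a b : ZMod 4 × ZMod 3, (a = b + (0, 2) ∨ a = b + (2, 0)) →
      (a + (2, 0) = b + (0, 2) ∨ a + (2, 0) = b + (2, 0)) → False := by decide
  have e3 : ∀ a b : ZMod 4 × ZMod 3, (b = a + (0, 2) ∨ b = a + (2, 0)) →
      (b = a + (2, 0) + (0, 2) ∨ b = a + (2, 0) + (2, 0)) → False := by decide
  have e4 : ∀ a b : ZMod 4 × ZMod 3, (b = a + (2, 0) ∨ a = b + (2, 0)) →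
      (b = a + (2, 0) + (2, 0) ∨ a + (2, 0) = b + (2, 0)) → False := by decide
  -- The number of crossings of `e` determines the type and the direction of both remaining moves:
  -- `e1` excludes two moves of type 1, `e2` and `e3` two of type 2, `e4` two of type 3.
  rcases Nat.lt_trichotomy c c' with hc | hc | hc
  · rcases t₁ with (t₁ | t₁ | t₁) | (t₁ | t₁ | t₁) <;> try omega
    all_goals rcases t₂ with (t₂ | t₂ | t₂) | (t₂ | t₂ | t₂) <;> try omega
    · exact e1 _ _ t₁.2.symm t₂.2.symm
    · exact e3 _ _ t₁.2 t₂.2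
  · rcases t₁ with (t₁ | t₁ | t₁) | (t₁ | t₁ | t₁) <;> try omega
    all_goals rcases t₂ with (t₂ | t₂ | t₂) | (t₂ | t₂ | t₂) <;> try omega
    · exact e4 _ _ (Or.inl t₁.2) (Or.inl t₂.2)
    · exact e4 _ _ (Or.inl t₁.2) (Or.inr t₂.2)
    · exact e4 _ _ (Or.inr t₁.2) (Or.inl t₂.2)
    · exact e4 _ _ (Or.inr t₁.2) (Or.inr t₂.2)
  · rcases t₁ with (t₁ | t₁ | t₁) | (t₁ | t₁ | t₁) <;> try omega
    all_goals rcases t₂ with (t₂ | t₂ | t₂) | (t₂ | t₂ | t₂) <;> try omega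
    · exact e1 _ _ t₁.2 t₂.2
    · exact e2 _ _ t₁.2 t₂.2

theorem crossings_le_of_ends {m : MoveClass A} {d d' : DiagramClass A} (h : m.ends = s(d, d')) :
    d.crossings ≤ d'.crossings + 2 := by
  have := MoveClass.mayMove h
  simp only [MayMove] at this
  omega

/-- Any two vertices have a common neighbour in the simplex, so the crossing numbers are distinct
and pairwise at most 2 apart. Four integers cannot be like that. -/
theorem isEmpty_simplex (K : KnotType A) [LinearOrder (DiagramClass A)] {n : ℕ} (hn : 3 ≤ n) :
    IsEmpty (CliqueComplex.Simplex (reidemeisterGraph K) n) := by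
  refine ⟨fun s => ?_⟩
  have link : ∀ i j : Fin (n + 1), i ≠ j →
      ∃ m : MoveClass A, m.ends = s(s.vertex i, s.vertex j) := by
    intro i j hij
    rcases lt_or_gt_of_ne hij with h | h
    · exact ⟨_, (s.isLink i j h).1⟩
    · exact ⟨_, (s.isLink j i h).1.trans Sym2.eq_swap⟩
  have hne : ∀ i j k : Fin (n + 1), i ≠ j → i ≠ k → j ≠ k →
      (s.vertex i).crossings ≠ (s.vertex j).crossings ∧
        (s.vertex i).crossings ≤ (s.vertex j).crossings + 2 := by
    intro i j k hij hik hjk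
    obtain ⟨m, hm⟩ := link i j hij
    obtain ⟨m₁, hm₁⟩ := link i k hik
    obtain ⟨m₂, hm₂⟩ := link j k hjk
    exact ⟨crossings_ne_of_triangle hm hm₁ hm₂, crossings_le_of_ends hm⟩
  let f : Fin 4 → Fin (n + 1) := Fin.castLE (by omega)
  have hf : Function.Injective f := Fin.castLE_injective _
  have h : ∀ i j k : Fin 4, i ≠ j → i ≠ k → j ≠ k →
      (s.vertex (f i)).crossings ≠ (s.vertex (f j)).crossings ∧
        (s.vertex (f i)).crossings ≤ (s.vertex (f j)).crossings + 2 :=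
    fun i j k h1 h2 h3 => hne _ _ _ (hf.ne h1) (hf.ne h2) (hf.ne h3)
  have h01 := h 0 1 2 (by decide) (by decide) (by decide)
  have h02 := h 0 2 1 (by decide) (by decide) (by decide)
  have h03 := h 0 3 1 (by decide) (by decide) (by decide)
  have h12 := h 1 2 0 (by decide) (by decide) (by decide)
  have h13 := h 1 3 0 (by decide) (by decide) (by decide)
  have h23 := h 2 3 0 (by decide) (by decide) (by decide)
  have h10 := h 1 0 2 (by decide) (by decide) (by decide)
  have h20 := h 2 0 1 (by decide) (by decide) (by decide)
  have h30 := h 3 0 1 (by decide) (by decide) (by decide)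
  have h21 := h 2 1 0 (by decide) (by decide) (by decide)
  have h31 := h 3 1 0 (by decide) (by decide) (by decide)
  have h32 := h 3 2 0 (by decide) (by decide) (by decide)
  omega

end KnotDiag

/-! ### Suspensions of double edges, and the second homology group -/

namespace CliqueComplex

set_option linter.unusedSimpArgs false

variable {α β : Type*} [LinearOrder α] {G : Graph α β}

/-- The 1-simplex with the vertices `x < y`. -/
def Simplex.segment {x y : α} {e : β} (h : x < y) (he : G.IsLink e x y) : Simplex G 1 where
  vertex := ![x, y]
  edge _ _ _ := e
  vertex_mem i := by
    fin_cases i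
    exacts [he.left_mem, he.right_mem]
  strictMono := by
    rw [Fin.strictMono_iff_lt_succ]
    intro i
    fin_cases i
    exact h
  isLink i j hij := by
    fin_cases i <;> fin_cases j <;> simp at hij
    exact he

/-- The 2-simplex with the vertices `x < y < z`. -/
def Simplex.triangle {x y z : α} {e f g : β} (hxy : x < y) (hyz : y < z) (he : G.IsLink e x y)
    (hf : G.IsLink f x z) (hg : G.IsLink g y z) : Simplex G 2 where
  vertex := ![x, y, z]
  edge i j _ := if i = 0 then if j = 1 then e else f else g
  vertex_mem i := by
    fin_cases i
    exacts [he.left_mem, he.right_mem, hf.right_mem]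
  strictMono := by
    rw [Fin.strictMono_iff_lt_succ]
    intro i
    fin_cases i
    exacts [hxy, hyz]
  isLink i j hij := by
    fin_cases i <;> fin_cases j <;> simp at hij
    exacts [he, hf, hg]

open Simplex

theorem Simplex.ext_one {s t : Simplex G 1} (hv : s.vertex = t.vertex)
    (he : s.edge 0 1 (by decide) = t.edge 0 1 (by decide)) : s = t := by
  refine Simplex.ext hv ?_
  funext i j h
  fin_cases i <;> fin_cases j <;> simp at h
  exact he

section triangle

variable {x y z : α} {e f g : β} (hxy : x < y) (hyz : y < z) (he : G.IsLink e x y)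
    (hf : G.IsLink f x z) (hg : G.IsLink g y z)

theorem face_zero_triangle : (triangle hxy hyz he hf hg).face 0 = segment hyz hg :=
  Simplex.ext_one (by funext i; fin_cases i <;> rfl) rfl

theorem face_one_triangle : (triangle hxy hyz he hf hg).face 1 = segment (hxy.trans hyz) hf :=
  Simplex.ext_one (by funext i; fin_cases i <;> rfl) rfl

theorem face_two_triangle : (triangle hxy hyz he hf hg).face 2 = segment hxy he :=
  Simplex.ext_one (by funext i; fin_cases i <;> rfl) rfl

theorem boundary_triangle :
    boundary G 1 (Finsupp.single (triangle hxy hyz he hf hg) 1) =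
      Finsupp.single (segment hyz hg) 1 - Finsupp.single (segment (hxy.trans hyz) hf) 1 +
        Finsupp.single (segment hxy he) 1 := by
  rw [boundary, Finsupp.linearCombination_single, one_smul, Fin.sum_univ_three,
    face_zero_triangle, face_one_triangle, face_two_triangle]
  simp [sub_eq_add_neg]

theorem exists_face_triangle (s : Simplex G 1) :
    (∃ i, (triangle hxy hyz he hf hg).face i = s) ↔
      s = segment hxy he ∨ s = segment (hxy.trans hyz) hf ∨ s = segment hyz hg := by
  rw [Fin.exists_fin_succ, Fin.exists_fin_two]
  change _ ∨ (triangle hxy hyz he hf hg).face 1 = s ∨ (triangle hxy hyz he hf hg).face 2 = s ↔ _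
  rw [face_zero_triangle, face_one_triangle, face_two_triangle, eq_comm (b := s),
    eq_comm (b := s), eq_comm (b := s)]
  tauto

theorem range_triangle : Set.range (triangle hxy hyz he hf hg).vertex = {x, y, z} := by
  change Set.range ![x, y, z] = _
  ext w
  simp [Fin.exists_fin_succ, eq_comm (b := w)]
  tauto

end triangle

theorem range_segment {x y : α} {e : β} (h : x < y) (he : G.IsLink e x y) :
    Set.range (segment h he).vertex = {x, y} := by
  change Set.range ![x, y] = _
  ext w
  simp [Fin.exists_fin_succ, eq_comm (b := w)]
  tauto

/-- The triangles with a common vertex `c` over the edges between `a` and `b`. -/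
theorem exists_cone {a b c : α} (hab : a < b) (hca : c ≠ a) (hcb : c ≠ b) {r s : β}
    (hr : G.IsLink r a c) (hs : G.IsLink s b c) :
    ∃ (T : (e : β) → G.IsLink e a b → Simplex G 2) (ε : ℤ) (ρ : Chain G 1) (R S : Simplex G 1),
      (ε = 1 ∨ ε = -1) ∧ Set.range R.vertex = {a, c} ∧ Set.range S.vertex = {b, c} ∧
      ∀ e he, (boundary G 1 (Finsupp.single (T e he) 1) =
          ε • (Finsupp.single (segment hab he) 1 + ρ)) ∧
        (∀ f, (∃ i, (T e he).face i = f) ↔ f = segment hab he ∨ f = R ∨ f = S) ∧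
        Set.range (T e he).vertex = {a, b, c} := by
  -- The edge over `a < b` is face 0 or 2 of the triangle if `c` comes first or last, and face 1 if
  -- `c` lies between; this determines the sign. `ρ` does not depend on the edge `e`.
  rcases lt_or_gt_of_ne hca with h | h
  · refine ⟨fun e he => triangle h hab hr.symm hs.symm he, 1,
      Finsupp.single (segment h hr.symm) 1 - Finsupp.single (segment (h.trans hab) hs.symm) 1,
      segment h hr.symm, segment (h.trans hab) hs.symm, Or.inl rfl, ?_, ?_, fun e he =>
        ⟨?_, fun f => ?_, ?_⟩⟩
    · rw [range_segment, Set.pair_comm]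
    · rw [range_segment, Set.pair_comm]
    · rw [boundary_triangle, one_smul]
      abel
    · rw [exists_face_triangle]
      tauto
    · rw [range_triangle, Set.insert_comm, Set.pair_comm c b]
  · rcases lt_or_gt_of_ne hcb with h' | h'
    · refine ⟨fun e he => triangle h h' hr he hs.symm, -1,
        -Finsupp.single (segment h hr) 1 - Finsupp.single (segment h' hs.symm) 1,
        segment h hr, segment h' hs.symm, Or.inr rfl, ?_, ?_, fun e he =>
          ⟨?_, fun f => ?_, ?_⟩⟩
      · rw [range_segment]
      · rw [range_segment, Set.pair_comm]
      · rw [boundary_triangle, neg_one_smul]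
        abel
      · rw [exists_face_triangle]
        tauto
      · rw [range_triangle, Set.pair_comm]
    · refine ⟨fun e he => triangle hab h' he hr hs, 1,
        Finsupp.single (segment h' hs) 1 - Finsupp.single (segment h hr) 1,
        segment h hr, segment h' hs, Or.inl rfl, ?_, ?_, fun e he =>
          ⟨?_, fun f => ?_, ?_⟩⟩
      · rw [range_segment]
      · rw [range_segment]
      · rw [boundary_triangle, one_smul]
        abel
      · rw [exists_face_triangle]
      · rw [range_triangle]

theorem vertices_ne {n : ℕ} {s t : Simplex G n} {x : α} (hs : x ∈ Set.range s.vertex)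
    (ht : x ∉ Set.range t.vertex) : s ≠ t := by
  rintro rfl
  exact ht hs

/-- The edges `p` and `q` form a circle, and coning it from `c` and from `d` gives two discs that
make up its suspension: 4 vertices, 6 edges, 4 triangles. -/
theorem exists_sphere_of_lt {a b c d : α} (hab : a < b) (hca : c ≠ a) (hcb : c ≠ b) (hda : d ≠ a)
    (hdb : d ≠ b) (hcd : c ≠ d) {p q r s t u : β} (hpq : p ≠ q) (hp : G.IsLink p a b)
    (hq : G.IsLink q a b) (hr : G.IsLink r a c) (hs : G.IsLink s b c) (ht : G.IsLink t a d)
    (hu : G.IsLink u b d) :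
    ∃ T : Finset (Simplex G 2), IsSphere T ∧ T.Nonempty ∧
      (∀ k ∈ T, {a, b} ⊆ Set.range k.vertex ∧ Set.range k.vertex ⊆ {a, b, c, d}) ∧
      ∃ z : cycles G 2, (∀ k ∈ T, z.1 k = 1 ∨ z.1 k = -1) ∧ ∀ k ∉ T, z.1 k = 0 := by
  classical
  have taut : ∀ p q r s r' s' : Prop, ((p ∨ r ∨ s) ∨ (q ∨ r ∨ s) ∨ (p ∨ r' ∨ s') ∨ (q ∨ r' ∨ s')) ↔
      (p ∨ q ∨ r ∨ s ∨ r' ∨ s') := by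
    intros
    tauto
  have taut' : ∀ p q r s : Prop, ((p ∨ q ∨ r) ∨ (p ∨ q ∨ r) ∨ (p ∨ q ∨ s) ∨ (p ∨ q ∨ s)) ↔
      (p ∨ q ∨ r ∨ s) := by
    intros
    tauto
  obtain ⟨C, ε, ρ, R, S, hε, hR, hS, hC⟩ := exists_cone hab hca hcb hr hs
  obtain ⟨D, ε', ρ', R', S', hε', hR', hS', hD⟩ := exists_cone hab hda hdb ht hu
  obtain ⟨bp, fp, vp⟩ := hC p hp
  obtain ⟨bq, fq, vq⟩ := hC q hq
  obtain ⟨bp', fp', vp'⟩ := hD p hp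
  obtain ⟨bq', fq', vq'⟩ := hD q hq
  generalize C p hp = cp at *
  generalize C q hq = cq at *
  generalize D p hp = dp at *
  generalize D q hq = dq at *
  have hPQ : segment hab hp ≠ segment hab hq := by
    intro h
    have : (segment hab hp).edge 0 1 (by decide) = (segment hab hq).edge 0 1 (by decide) := by
      rw [h]
    exact hpq this
  have hP := range_segment hab hp
  have hQ := range_segment hab hq
  generalize segment hab hp = P at *
  generalize segment hab hq = Q at *
  have nab : a ≠ b := hab.ne
  have nPR : P ≠ R := vertices_ne (x := b) (by simp [hP]) (by simp [hR, hab.ne', hcb.symm])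
  have nQR : Q ≠ R := vertices_ne (x := b) (by simp [hQ]) (by simp [hR, hab.ne', hcb.symm])
  have nPS : P ≠ S := vertices_ne (x := a) (by simp [hP]) (by simp [hS, hab.ne, hca.symm])
  have nQS : Q ≠ S := vertices_ne (x := a) (by simp [hQ]) (by simp [hS, hab.ne, hca.symm])
  have nPR' : P ≠ R' := vertices_ne (x := b) (by simp [hP]) (by simp [hR', hab.ne', hdb.symm])
  have nQR' : Q ≠ R' := vertices_ne (x := b) (by simp [hQ]) (by simp [hR', hab.ne', hdb.symm])
  have nPS' : P ≠ S' := vertices_ne (x := a) (by simp [hP]) (by simp [hS', hab.ne, hda.symm])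
  have nQS' : Q ≠ S' := vertices_ne (x := a) (by simp [hQ]) (by simp [hS', hab.ne, hda.symm])
  have nRS : R ≠ S := vertices_ne (x := a) (by simp [hR]) (by simp [hS, hab.ne, hca.symm])
  have nRS' : R ≠ S' := vertices_ne (x := a) (by simp [hR]) (by simp [hS', hab.ne, hda.symm])
  have nRR' : R ≠ R' := vertices_ne (x := c) (by simp [hR]) (by simp [hR', hca, hcd])
  have nSR' : S ≠ R' := vertices_ne (x := c) (by simp [hS]) (by simp [hR', hca, hcd])
  have nSS' : S ≠ S' := vertices_ne (x := c) (by simp [hS]) (by simp [hS', hcb, hcd])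
  have nR'S' : R' ≠ S' := vertices_ne (x := a) (by simp [hR']) (by simp [hS', hab.ne, hda.symm])
  have n1 : cp ≠ cq := by
    rintro rfl
    have := (fq P).1 ((fp P).2 (Or.inl rfl))
    simp [hPQ, nPR, nPS] at this
  have n2 : dp ≠ dq := by
    rintro rfl
    have := (fq' P).1 ((fp' P).2 (Or.inl rfl))
    simp [hPQ, nPR', nPS'] at this
  have n3 : cp ≠ dp := vertices_ne (x := c) (by simp [vp]) (by simp [vp', hca, hcb, hcd])
  have n4 : cp ≠ dq := vertices_ne (x := c) (by simp [vp]) (by simp [vq', hca, hcb, hcd])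
  have n5 : cq ≠ dp := vertices_ne (x := c) (by simp [vq]) (by simp [vp', hca, hcb, hcd])
  have n6 : cq ≠ dq := vertices_ne (x := c) (by simp [vq]) (by simp [vq', hca, hcb, hcd])
  have hedges : edges ({cp, cq, dp, dq} : Finset (Simplex G 2)) = {P, Q, R, S, R', S'} := by
    ext f
    simp only [edges, Finset.mem_insert, Finset.mem_singleton, Set.mem_ofPred_eq, exists_eq_or_imp,
      exists_eq_left, fp, fq, fp', fq', Set.mem_insert_iff, Set.mem_singleton_iff]
    exact taut _ _ _ _ _ _
  have hverts : vertices ({cp, cq, dp, dq} : Finset (Simplex G 2)) = {a, b, c, d} := by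
    have : ∀ k : Simplex G 2, ∀ v, (∃ i, k.vertex i = v) ↔ v ∈ Set.range k.vertex :=
      fun k v => Iff.rfl
    ext v
    simp only [vertices, Finset.mem_insert, Finset.mem_singleton, Set.mem_ofPred_eq,
      exists_eq_or_imp, exists_eq_left, this, vp, vq, vp', vq', Set.mem_insert_iff,
      Set.mem_singleton_iff]
    exact taut' _ _ _ _
  refine ⟨{cp, cq, dp, dq}, ⟨?_, ?_, ?_⟩, ⟨cp, by simp⟩, ?_, ?_⟩
  · have pair : ∀ f, ∀ k k' : Simplex G 2, k ≠ k' →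
        (∀ l, (l ∈ ({cp, cq, dp, dq} : Finset (Simplex G 2)) ∧ ∃ i, l.face i = f) ↔
          l = k ∨ l = k') →
        {l ∈ (({cp, cq, dp, dq} : Finset (Simplex G 2)) : Set (Simplex G 2)) |
          ∃ i, l.face i = f}.ncard = 2 := by
      intro f k k' hne h
      have h' : {l ∈ (({cp, cq, dp, dq} : Finset (Simplex G 2)) : Set (Simplex G 2)) |
          ∃ i, l.face i = f} = {k, k'} := Set.ext h
      rw [h', Set.ncard_pair hne]
    have mem : ∀ f l, (l ∈ ({cp, cq, dp, dq} : Finset (Simplex G 2)) ∧ ∃ i, l.face i = f) ↔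
        (l = cp ∧ (f = P ∨ f = R ∨ f = S)) ∨ (l = cq ∧ (f = Q ∨ f = R ∨ f = S)) ∨
        (l = dp ∧ (f = P ∨ f = R' ∨ f = S')) ∨ (l = dq ∧ (f = Q ∨ f = R' ∨ f = S')) := by
      intro f l
      simp only [Finset.mem_insert, Finset.mem_singleton, or_and_right]
      refine or_congr ?_ (or_congr ?_ (or_congr ?_ ?_)) <;> refine and_congr_right ?_ <;> rintro rfl
      exacts [fp f, fq f, fp' f, fq' f]
    rw [hedges]
    rintro f (rfl | rfl | rfl | rfl | rfl | rfl)
    · exact pair _ cp dp n3 fun l => by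
        rw [mem]
        simp [hPQ, hPQ.symm, nPR, nPS, nPR', nPS', nQR, nQS, nQR', nQS', nRS, nRR', nRS', nSR', nSS', nR'S',
          nPR.symm, nPS.symm, nPR'.symm, nPS'.symm, nQR.symm, nQS.symm, nQR'.symm, nQS'.symm, nRS.symm, nRR'.symm, nRS'.symm, nSR'.symm, nSS'.symm, nR'S'.symm]
    · exact pair _ cq dq n6 fun l => by
        rw [mem]
        simp [hPQ, hPQ.symm, nPR, nPS, nPR', nPS', nQR, nQS, nQR', nQS', nRS, nRR', nRS', nSR', nSS', nR'S',
          nPR.symm, nPS.symm, nPR'.symm, nPS'.symm, nQR.symm, nQS.symm, nQR'.symm, nQS'.symm, nRS.symm, nRR'.symm, nRS'.symm, nSR'.symm, nSS'.symm, nR'S'.symm]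
    · exact pair _ cp cq n1 fun l => by
        rw [mem]
        simp [hPQ, hPQ.symm, nPR, nPS, nPR', nPS', nQR, nQS, nQR', nQS', nRS, nRR', nRS', nSR', nSS', nR'S',
          nPR.symm, nPS.symm, nPR'.symm, nPS'.symm, nQR.symm, nQS.symm, nQR'.symm, nQS'.symm, nRS.symm, nRR'.symm, nRS'.symm, nSR'.symm, nSS'.symm, nR'S'.symm]
    · exact pair _ cp cq n1 fun l => by
        rw [mem]
        simp [hPQ, hPQ.symm, nPR, nPS, nPR', nPS', nQR, nQS, nQR', nQS', nRS, nRR', nRS', nSR', nSS', nR'S',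
          nPR.symm, nPS.symm, nPR'.symm, nPS'.symm, nQR.symm, nQS.symm, nQR'.symm, nQS'.symm, nRS.symm, nRR'.symm, nRS'.symm, nSR'.symm, nSS'.symm, nR'S'.symm]
    · exact pair _ dp dq n2 fun l => by
        rw [mem]
        simp [hPQ, hPQ.symm, nPR, nPS, nPR', nPS', nQR, nQS, nQR', nQS', nRS, nRR', nRS', nSR', nSS', nR'S',
          nPR.symm, nPS.symm, nPR'.symm, nPS'.symm, nQR.symm, nQS.symm, nQR'.symm, nQS'.symm, nRS.symm, nRR'.symm, nRS'.symm, nSR'.symm, nSS'.symm, nR'S'.symm]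
    · exact pair _ dp dq n2 fun l => by
        rw [mem]
        simp [hPQ, hPQ.symm, nPR, nPS, nPR', nPS', nQR, nQS, nQR', nQS', nRS, nRR', nRS', nSR', nSS', nR'S',
          nPR.symm, nPS.symm, nPR'.symm, nPS'.symm, nQR.symm, nQS.symm, nQR'.symm, nQS'.symm, nRS.symm, nRR'.symm, nRS'.symm, nSR'.symm, nSS'.symm, nR'S'.symm]
  · set rel : Simplex G 2 → Simplex G 2 → Prop := fun x y =>
      y ∈ ({cp, cq, dp, dq} : Finset (Simplex G 2)) ∧ ∃ i j, x.face i = y.face j with hrel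
    have step : ∀ f x y, y ∈ ({cp, cq, dp, dq} : Finset (Simplex G 2)) →
        (∃ i, x.face i = f) → (∃ i, y.face i = f) → rel x y := by
      rintro f x y hy ⟨i, hi⟩ ⟨j, hj⟩
      exact ⟨hy, i, j, hi.trans hj.symm⟩
    have s1 : rel cp cq := step R _ _ (by simp) ((fp _).2 (by simp)) ((fq _).2 (by simp))
    have s2 : rel cq cp := step R _ _ (by simp) ((fq _).2 (by simp)) ((fp _).2 (by simp))
    have s3 : rel cp dp := step P _ _ (by simp) ((fp _).2 (by simp)) ((fp' _).2 (by simp))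
    have s4 : rel dp cp := step P _ _ (by simp) ((fp' _).2 (by simp)) ((fp _).2 (by simp))
    have s5 : rel cq dq := step Q _ _ (by simp) ((fq _).2 (by simp)) ((fq' _).2 (by simp))
    have s6 : rel dq cq := step Q _ _ (by simp) ((fq' _).2 (by simp)) ((fq _).2 (by simp))
    intro x hx y hy
    have h_to : Relation.ReflTransGen rel x cp := by
      simp only [Finset.mem_insert, Finset.mem_singleton] at hx
      rcases hx with rfl | rfl | rfl | rfl
      exacts [.refl, .single s2, .single s4, (Relation.ReflTransGen.single s6).tail s2]
    have h_from : Relation.ReflTransGen rel cp y := by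
      simp only [Finset.mem_insert, Finset.mem_singleton] at hy
      rcases hy with rfl | rfl | rfl | rfl
      exacts [.refl, .single s1, .single s3, (Relation.ReflTransGen.single s1).tail s5]
    exact h_to.trans h_from
  · have e1 : ({cp, cq, dp, dq} : Finset (Simplex G 2)).card = 4 := by
      simp [n1, n2, n3, n4, n5, n6]
    have e2 : ({P, Q, R, S, R', S'} : Set (Simplex G 1)).ncard = 6 := by
      rw [Set.ncard_insert_of_notMem (by simp [hPQ, nPR, nPS, nPR', nPS']),
        Set.ncard_insert_of_notMem (by simp [nQR, nQS, nQR', nQS']),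
        Set.ncard_insert_of_notMem (by simp [nRS, nRR', nRS']),
        Set.ncard_insert_of_notMem (by simp [nSR', nSS']), Set.ncard_pair nR'S']
    have e3 : ({a, b, c, d} : Set α).ncard = 4 := by
      rw [Set.ncard_insert_of_notMem (by simp [nab, hca.symm, hda.symm]),
        Set.ncard_insert_of_notMem (by simp [hcb.symm, hdb.symm]), Set.ncard_pair hcd]
    rw [hedges, hverts, e1, e2, e3]
    norm_num
  · intro k hk
    simp only [Finset.mem_insert, Finset.mem_singleton] at hk
    rcases hk with rfl | rfl | rfl | rfl
    · rw [vp]; grind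
    · rw [vq]; grind
    · rw [vp']; grind
    · rw [vq']; grind
  -- In each cone the part `ρ` of the boundary cancels between `p` and `q`. What remains, corrected
  -- by the sign, is the circle `P - Q`, the same for both cones.
  · refine ⟨⟨ε • (Finsupp.single cp 1 - Finsupp.single cq 1) -
        ε' • (Finsupp.single dp 1 - Finsupp.single dq 1), ?_⟩, ?_, ?_⟩
    · have h1 : ε • ε = 1 := by rcases hε with rfl | rfl <;> rfl
      have h2 : ε' • ε' = 1 := by rcases hε' with rfl | rfl <;> rfl
      change _ ∈ LinearMap.ker (boundary G 1)
      rw [LinearMap.mem_ker, map_sub, map_smul, map_smul, map_sub, map_sub, bp, bq, bp', bq',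
        ← smul_sub, ← smul_sub, ← smul_assoc, ← smul_assoc, h1, h2]
      simp
    · intro k hk
      simp only [Finset.mem_insert, Finset.mem_singleton] at hk
      rcases hk with rfl | rfl | rfl | rfl <;>
      simp [Finsupp.single_apply, n1, n2, n3, n4, n5, n6, n1.symm, n2.symm, n3.symm, n4.symm,
        n5.symm, n6.symm] <;> omega
    · intro k hk
      simp only [Finset.mem_insert, Finset.mem_singleton, not_or] at hk
      simp [Finsupp.single_apply, Ne.symm hk.1, Ne.symm hk.2.1, Ne.symm hk.2.2.1,
        Ne.symm hk.2.2.2]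

theorem exists_sphere {a b c d : α} (hab : a ≠ b) (hca : c ≠ a) (hcb : c ≠ b) (hda : d ≠ a)
    (hdb : d ≠ b) (hcd : c ≠ d) {p q r s t u : β} (hpq : p ≠ q) (hp : G.IsLink p a b)
    (hq : G.IsLink q a b) (hr : G.IsLink r a c) (hs : G.IsLink s b c) (ht : G.IsLink t a d)
    (hu : G.IsLink u b d) :
    ∃ T : Finset (Simplex G 2), IsSphere T ∧ T.Nonempty ∧
      (∀ k ∈ T, {a, b} ⊆ Set.range k.vertex ∧ Set.range k.vertex ⊆ {a, b, c, d}) ∧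
      ∃ z : cycles G 2, (∀ k ∈ T, z.1 k = 1 ∨ z.1 k = -1) ∧ ∀ k ∉ T, z.1 k = 0 := by
  rcases lt_or_gt_of_ne hab with h | h
  · exact exists_sphere_of_lt h hca hcb hda hdb hcd hpq hp hq hr hs ht hu
  · have := exists_sphere_of_lt h hcb hca hdb hda hcd hpq hp.symm hq.symm hs hr hu ht
    rwa [Set.pair_comm b a, Set.insert_comm b a] at this

/-! ### Homology in the top dimension and freeness of the group of cycles -/

theorem subsingleton_homology (n : ℕ) [IsEmpty (Simplex G n)] : Subsingleton (Homology G n) :=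
  (Submodule.Quotient.mk_surjective _).subsingleton

theorem range_boundary_eq_bot (n : ℕ) [IsEmpty (Simplex G (n + 1))] :
    LinearMap.range (boundary G n) = ⊥ := by
  rw [LinearMap.range_eq_bot]
  exact LinearMap.ext fun c => by rw [Subsingleton.elim c 0, map_zero, map_zero]

/-- The homology in the top dimension. -/
noncomputable def homologyEquivCycles (n : ℕ) [IsEmpty (Simplex G (n + 1))] :
    Homology G n ≃ₗ[ℤ] cycles G n :=
  Submodule.quotEquivOfEqBot _ (by
    rw [range_boundary_eq_bot, Submodule.submoduleOf, Submodule.comap_bot,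
      Submodule.ker_subtype])

/-- Evaluating a relation at an element of `T i` isolates the coefficient of `z i`, up to sign. -/
theorem linearIndependent_of_disjoint {κ : Type*} {M : Submodule ℤ (κ →₀ ℤ)} {z : ℕ → M}
    {T : ℕ → Finset κ} (hT : ∀ i, (T i).Nonempty) (hd : ∀ i j, i ≠ j → Disjoint (T i) (T j))
    (h : ∀ i, ∀ k ∈ T i, (z i).1 k = 1 ∨ (z i).1 k = -1) (h' : ∀ i, ∀ k ∉ T i, (z i).1 k = 0) :
    LinearIndependent ℤ z := by
  rw [linearIndependent_iff']
  intro s g hg i hi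
  obtain ⟨k, hk⟩ := hT i
  have h1 : ∑ j ∈ s, g j * (z j).1 k = 0 := by
    have := congrArg (fun c : M => c.1 k) hg
    simpa [Finsupp.finsetSum_apply] using this
  rw [Finset.sum_eq_single i (fun j _ hj => by
    rw [h' j k (Finset.disjoint_left.1 (hd i j hj.symm) hk), mul_zero]) (fun h => absurd hi h)] at h1
  rcases h i k hk with h2 | h2 <;> rw [h2] at h1 <;> omega

/-- Echelon form. The leading coefficients at place `n` of the elements of `N` supported on the
places up to `n` form a principal ideal `I n`; let `x n` realize a generator. The `x n` with nonzero
leading coefficient are independent by triangularity, and they span because the last coordinate can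
be divided out successively. -/
theorem free_of_submodule_finsupp_nat (N : Submodule ℤ (ℕ →₀ ℤ)) : Module.Free ℤ N := by
  let F : ℕ → Submodule ℤ (ℕ →₀ ℤ) := fun n => N ⊓ Finsupp.supported ℤ ℤ (Set.Iio n)
  let I : ℕ → Submodule ℤ ℤ := fun n => (F (n + 1)).map (Finsupp.lapply n)
  have hI : ∀ n, ∃ x ∈ F (n + 1), ∀ y ∈ F (n + 1), ∃ q : ℤ, y n = q * x n := by
    intro n
    have hp : (I n).IsPrincipal := IsPrincipalIdealRing.principal (I n)
    obtain ⟨d, hd⟩ := hp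
    have : d ∈ I n := hd ▸ Submodule.mem_span_singleton_self d
    obtain ⟨x, hx, hxd⟩ := this
    refine ⟨x, hx, fun y hy => ?_⟩
    have : y n ∈ I n := ⟨y, hy, rfl⟩
    rw [hd, Submodule.mem_span_singleton] at this
    obtain ⟨q, hq⟩ := this
    refine ⟨q, ?_⟩
    rw [← hq, ← hxd]
    rfl
  choose x hx hmul using hI
  have hzero : ∀ m n, m < n → x m n = 0 := by
    intro m n h
    have := (hx m).2
    rw [SetLike.mem_coe, Finsupp.mem_supported'] at this
    exact this n (by simp; omega)
  let b : {n // x n n ≠ 0} → N := fun n => ⟨x n, (hx n).1⟩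
  have hli : LinearIndependent ℤ b := by
    rw [linearIndependent_iff']
    intro s
    induction s using Finset.induction_on_max with
    | empty => simp
    | insert a s ha ih =>
      intro g hg
      have has : a ∉ s := fun h => lt_irrefl _ (ha a h)
      rw [Finset.sum_insert has] at hg
      have h1 : g a * x a a = 0 := by
        have := congrArg (fun c : N => c.1 a) hg
        simp only [b, Submodule.coe_add, Submodule.coe_smul, Submodule.coe_sum, Finsupp.add_apply,
          Finsupp.smul_apply, Finsupp.finsetSum_apply, smul_eq_mul, ZeroMemClass.coe_zero,
          Finsupp.coe_zero, Pi.zero_apply] at this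
        rwa [Finset.sum_eq_zero fun i hi => by rw [hzero _ _ (ha i hi), mul_zero], add_zero] at this
      have h2 : g a = 0 := (mul_eq_zero.1 h1).resolve_right a.2
      rw [h2, zero_smul, zero_add] at hg
      intro i hi
      rcases Finset.mem_insert.1 hi with rfl | hi
      exacts [h2, ih g hg i hi]
  have hspan : ∀ n, ∀ y : N, y.1 ∈ F n → y ∈ Submodule.span ℤ (Set.range b) := by
    intro n
    induction n with
    | zero =>
      intro y hy
      have : y.1 ∈ Finsupp.supported ℤ ℤ (Set.Iio 0) := hy.2
      rw [show Set.Iio 0 = (∅ : Set ℕ) by ext; simp, Finsupp.supported_empty, Submodule.mem_bot] at this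
      rw [Subtype.ext (a1 := y) (a2 := 0) this]
      exact zero_mem _
    | succ n ih =>
      intro y hy
      obtain ⟨q, hq⟩ := hmul n y hy
      have hb : q • (⟨x n, (hx n).1⟩ : N) ∈ Submodule.span ℤ (Set.range b) ∨ q * x n n = 0 := by
        by_cases h : x n n = 0
        · exact Or.inr (by rw [h, mul_zero])
        · exact Or.inl (Submodule.smul_mem _ _ (Submodule.subset_span ⟨⟨n, h⟩, rfl⟩))
      have hsupp : ∀ w : ℕ →₀ ℤ, w ∈ F (n + 1) → w n = 0 → w ∈ F n := by
        refine fun w hw h0 => ⟨hw.1, ?_⟩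
        have := hw.2
        rw [SetLike.mem_coe, Finsupp.mem_supported'] at this ⊢
        intro k hk
        rcases eq_or_ne k n with rfl | hkn
        · exact h0
        · exact this k (by simp at hk ⊢; omega)
      rcases hb with hb | hb
      · rw [← sub_add_cancel y (q • ⟨x n, (hx n).1⟩)]
        refine add_mem (ih _ (hsupp _ (sub_mem hy (Submodule.smul_mem _ _ (hx n))) ?_)) hb
        simp [hq]
      · exact ih y (hsupp _ hy (hq.trans hb))
  refine Module.Free.of_basis (Module.Basis.mk hli ?_)
  rintro y -
  obtain ⟨n, hn⟩ := y.1.support.bddAbove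
  refine hspan (n + 1) y ⟨y.2, ?_⟩
  rw [SetLike.mem_coe, Finsupp.mem_supported]
  exact fun k hk => Nat.lt_succ_of_le (hn hk)

theorem free_of_submodule_finsupp {κ : Type*} [Countable κ] (N : Submodule ℤ (κ →₀ ℤ)) :
    Module.Free ℤ N := by
  obtain ⟨f, hf⟩ := exists_injective_nat κ
  have := free_of_submodule_finsupp_nat (N.map (Finsupp.lmapDomain ℤ ℤ f))
  exact Module.Free.of_equiv
    (Submodule.equivMapOfInjective (Finsupp.lmapDomain ℤ ℤ f) (Finsupp.mapDomain_injective hf) N).symm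

/-- The group of cycles has a basis, countable because the chain group is countable and infinite
because of the independent sequence `z`. -/
theorem nonempty_homology_equiv (n : ℕ) [IsEmpty (Simplex G (n + 1))] [Countable (Simplex G n)]
    {z : ℕ → cycles G n} (hz : LinearIndependent ℤ z) :
    Nonempty (Homology G n ≃ₗ[ℤ] (ℕ →₀ ℤ)) := by
  have := free_of_submodule_finsupp (cycles G n)
  let b := Module.Free.chooseBasis ℤ (cycles G n)
  have h1 : Countable (Chain G n) := inferInstance
  have h2 : Countable (Module.Free.ChooseBasisIndex ℤ (cycles G n)) := b.injective.countable
  have h3 : Infinite (Module.Free.ChooseBasisIndex ℤ (cycles G n)) := by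
    by_contra hfin
    rw [not_infinite_iff_finite] at hfin
    have : Module.Finite ℤ (cycles G n) := Module.Finite.of_basis b
    exact not_finite_iff_infinite.2 (inferInstance : Infinite ℕ) hz.finite
  obtain ⟨e⟩ := nonempty_equiv_of_countable (α := Module.Free.ChooseBasisIndex ℤ (cycles G n))
    (β := ℕ)
  exact ⟨(homologyEquivCycles n).trans (b.repr.trans (Finsupp.domLCongr e))⟩

end CliqueComplex

/-! ### Countability -/

namespace CliqueComplex

theorem countable_simplex {α β : Type*} [LinearOrder α] [Countable α] [Countable β] (G : Graph α β)
    (n : ℕ) : Countable (Simplex G n) := by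
  refine Function.Injective.countable (f := fun s : Simplex G n => (s.vertex, s.edge)) ?_
  intro s t h
  exact Simplex.ext (congrArg Prod.fst h) (congrArg Prod.snd h)

end CliqueComplex

namespace KnotDiag

instance countable_diagram (A : Ambient) : Countable (Diagram A) := by
  refine Function.Injective.countable (f := fun D : Diagram A =>
    (⟨D.crossings, D.edge, D.outer⟩ : Σ n : ℕ, Equiv.Perm (Dart n) × Set (Dart n))) ?_
  rintro ⟨n, e, _, _, _, _, o, _, _⟩ ⟨n', e', _, _, _, _, o', _, _⟩ h
  simp only [Sigma.mk.injEq] at h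
  obtain ⟨rfl, h⟩ := h
  cases h
  rfl

instance countable_move (A : Ambient) : Countable (Move A) := by
  let f : Move A → ℕ × (Σ D : Diagram A, Dart D.crossings) ×
      (Σ D : Diagram A, Option (Dart D.crossings))
    | .omega1 D x D' _ => (1, ⟨D, x⟩, ⟨D', none⟩)
    | .omega2 D x D' _ => (2, ⟨D, x⟩, ⟨D', none⟩)
    | .omega3 D x D' x' _ => (3, ⟨D, x⟩, ⟨D', some x'⟩)
  refine Function.Injective.countable (f := f) ?_
  intro m m' h
  cases m <;> cases m' <;> simp [f] at h
  all_goals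
    obtain ⟨⟨rfl, h⟩, rfl, h'⟩ := h
    cases h
    cases h'
    rfl

end KnotDiag

/-! ### Kinks -/

namespace KnotDiag

open Equiv.Perm

variable {A : Ambient}

namespace Diagram

theorem zmod_four_cases : ∀ j : ZMod 4, j = 0 ∨ j = 1 ∨ j = 2 ∨ j = 3 := by decide

theorem mem_outer_iff_of_sameRegion (D : Diagram A) {x y : Dart D.crossings}
    (h : D.SameRegion x y) : x ∈ D.outer ↔ y ∈ D.outer := by
  cases A with
  | sphere => simp [D.outer_sphere rfl]
  | plane =>
    have hne : D.crossings ≠ 0 := fun h0 => Nat.not_lt_zero x.1 (by have := x.1.2; omega)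
    obtain ⟨z, hz⟩ := D.outer_plane rfl hne
    rw [hz]
    exact ⟨fun hx => SameCycle.trans hx h, fun hy => SameCycle.trans hy h.symm⟩

/-- The diagram `D'` is obtained from `D` by adding a small loop with one crossing to the arc
that starts with `x`. The loop lies to the left of `x`. The maps `ι` and `ν` enumerate the darts
at the old crossings and at the new one, and the parity of `i` tells which strand is the upper one. -/
structure IsKink (D : Diagram A) (x : Dart D.crossings) (i : ZMod 4) (D' : Diagram A)
    (ι : Dart D.crossings → Dart D'.crossings) (ν : ZMod 4 → Dart D'.crossings) : Prop where
  old_injective : Function.Injective ι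
  new_injective : Function.Injective ν
  old_ne_new : ∀ z j, ι z ≠ ν j
  old_or_new : ∀ w, (∃ z, ι z = w) ∨ ∃ j, ν j = w
  rot_old : ∀ z, rot _ (ι z) = ι (rot _ z)
  rot_new : ∀ j, rot _ (ν j) = ν (j + 1)
  over_old : ∀ z, IsOver (ι z) ↔ IsOver z
  over_new : ∀ j, IsOver (ν j) ↔ j + i = 1 ∨ j + i = 3
  edge_old : ∀ z, z ≠ x → z ≠ D.edge x → D'.edge (ι z) = ι (D.edge z)
  edge_old_left : D'.edge (ι x) = ν 0
  edge_old_right : D'.edge (ι (D.edge x)) = ν 1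
  edge_two : D'.edge (ν 2) = ν 3
  outer_old : ∀ z, ι z ∈ D'.outer ↔ z ∈ D.outer
  outer_two : ν 2 ∉ D'.outer

namespace IsKink

variable {D D' : Diagram A} {x : Dart D.crossings} {i : ZMod 4}
  {ι : Dart D.crossings → Dart D'.crossings} {ν : ZMod 4 → Dart D'.crossings}

theorem edge_zero (h : D.IsKink x i D' ι ν) : D'.edge (ν 0) = ι x := by
  rw [← h.edge_old_left, D'.edge_edge]

theorem edge_one (h : D.IsKink x i D' ι ν) : D'.edge (ν 1) = ι (D.edge x) := by
  rw [← h.edge_old_right, D'.edge_edge]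

theorem edge_three (h : D.IsKink x i D' ι ν) : D'.edge (ν 3) = ν 2 := by
  rw [← h.edge_two, D'.edge_edge]

theorem opp_old (h : D.IsKink x i D' ι ν) (z) : opp _ (ι z) = ι (opp _ z) := by
  rw [← rot_rot, h.rot_old, h.rot_old, rot_rot]

theorem opp_new (h : D.IsKink x i D' ι ν) (j) : opp _ (ν j) = ν (j + 2) := by
  rw [← rot_rot, h.rot_new, h.rot_new, add_assoc]
  rfl

theorem fst_new (h : D.IsKink x i D' ι ν) (j k) : (ν j).1 = (ν k).1 := by
  have : ∀ j, (ν (j + 1)).1 = (ν j).1 := fun j => by rw [← h.rot_new, rot_fst]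
  have h0 : ∀ j, (ν j).1 = (ν 0).1 := by
    intro j
    rcases zmod_four_cases j with rfl | rfl | rfl | rfl
    exacts [rfl, this 0, (this 1).trans (this 0), (this 2).trans ((this 1).trans (this 0))]
  rw [h0 j, h0 k]

theorem fst_old_ne (h : D.IsKink x i D' ι ν) (z j) : (ι z).1 ≠ (ν j).1 := by
  intro e
  have := eq_of_fst_eq e.symm
  simp only [h.rot_new, h.opp_new] at this
  rcases this with e | e | e | e <;> exact h.old_ne_new _ _ e

theorem mem_range_old (h : D.IsKink x i D' ι ν) (w : Dart D'.crossings) (j) :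
    w ∈ Set.range ι ↔ w.1 ≠ (ν j).1 := by
  constructor
  · rintro ⟨z, rfl⟩
    exact h.fst_old_ne z j
  · intro hw
    rcases h.old_or_new w with ⟨z, rfl⟩ | ⟨k, rfl⟩
    exacts [⟨z, rfl⟩, absurd (h.fst_new k j) hw]

theorem next_left (h : D.IsKink x i D' ι ν) : D'.next (ι x) = ν 2 := by
  rw [next_apply, h.edge_old_left, h.opp_new]
  rfl

theorem next_right (h : D.IsKink x i D' ι ν) : D'.next (ι (D.edge x)) = ν 3 := by
  rw [next_apply, h.edge_old_right, h.opp_new]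
  rfl

theorem next_zero (h : D.IsKink x i D' ι ν) : D'.next (ν 0) = ι (opp _ x) := by
  rw [next_apply, h.edge_zero, h.opp_old]

theorem next_one (h : D.IsKink x i D' ι ν) : D'.next (ν 1) = ι (D.next x) := by
  rw [next_apply, h.edge_one, h.opp_old, next_apply]

theorem next_two (h : D.IsKink x i D' ι ν) : D'.next (ν 2) = ν 1 := by
  rw [next_apply, h.edge_two, h.opp_new]
  rfl

theorem next_three (h : D.IsKink x i D' ι ν) : D'.next (ν 3) = ν 0 := by
  rw [next_apply, h.edge_three, h.opp_new]
  rfl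

theorem next_old (h : D.IsKink x i D' ι ν) {z} (h1 : z ≠ x) (h2 : z ≠ D.edge x) :
    D'.next (ι z) = ι (D.next z) := by
  rw [next_apply, h.edge_old z h1 h2, h.opp_old, next_apply]

theorem nextCorner_two (h : D.IsKink x i D' ι ν) : nextCorner D'.edge (ν 2) = ν 2 := by
  rw [nextCorner_apply, h.edge_two, h.rot_new, h.opp_new]
  rfl

theorem isErasure (h : D.IsKink x i D' ι ν) (j) : D'.IsErasure {(ν j).1} D ι where
  injective := h.old_injective
  range_eq := by
    ext w
    exact h.mem_range_old w j
  map_rot z := (h.rot_old z).symm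
  map_over := h.over_old
  -- The walk in `D'` makes a detour through the new crossing only on the arc of `x`, in one
  -- direction or the other, meeting that crossing twice.
  map_next z := by
    by_cases h1 : z = x
    · subst h1
      refine ⟨2, ?_, ?_⟩
      · rw [pow_succ, pow_two, mul_apply, mul_apply, h.next_left, h.next_two, h.next_one]
      · intro k hk
        interval_cases k
        · rw [pow_one, h.next_left]
          exact h.fst_new _ _
        · rw [pow_two, mul_apply, h.next_left, h.next_two]
          exact h.fst_new _ _
    · by_cases h2 : z = D.edge x
      · subst h2
        refine ⟨2, ?_, ?_⟩
        · rw [pow_succ, pow_two, mul_apply, mul_apply, h.next_right, h.next_three, h.next_zero,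
            next_apply, D.edge_edge]
        · intro k hk
          interval_cases k
          · rw [pow_one, h.next_right]
            exact h.fst_new _ _
          · rw [pow_two, mul_apply, h.next_right, h.next_three]
            exact h.fst_new _ _
      · exact ⟨0, by rw [pow_one, h.next_old h1 h2], by simp⟩

theorem isOmega1 (h : D.IsKink x i D' ι ν) : D'.IsOmega1 (ν 2) D :=
  ⟨⟨h.nextCorner_two, h.outer_two⟩, ι, h.isErasure 2, fun z => (h.outer_old z).symm⟩

theorem crossings_eq (h : D.IsKink x i D' ι ν) : D'.crossings = D.crossings + 1 := by
  rw [(h.isErasure 0).crossings_eq, Set.ncard_singleton]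

variable {D'' : Diagram A} {ι' : Dart D'.crossings → Dart D''.crossings}
  {ν' : ZMod 4 → Dart D''.crossings}

/-- A second loop attached to the outer side of the first turns the monogon into a bigon. The shift
`i + 1` puts the same strand on top at both crossings. One of the two regions touching the bigon at
its corners is the new monogon, which is bounded, so the merging leaves the unbounded region as it
was. -/
theorem isOmega2 (h : D.IsKink x i D' ι ν) (h' : D'.IsKink (ν 3) (i + 1) D'' ι' ν') :
    D''.IsOmega2 (ι' (ν 2)) D := by
  have e1 : D''.edge (ι' (ν 2)) = ν' 1 := by rw [← h.edge_three, h'.edge_old_right]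
  have e2 : nextCorner D''.edge (ι' (ν 2)) = ν' 0 := by
    rw [nextCorner_apply, e1, h'.rot_new, h'.opp_new]
    rfl
  have e3 : nextCorner D''.edge (ν' 0) = ι' (ν 2) := by
    rw [nextCorner_apply, h'.edge_zero, h'.rot_old, h'.opp_old, h.rot_new, h.opp_new]
    rfl
  have hne : ∀ z j, ι z ≠ ν j := h.old_ne_new
  have x1 : ι x ≠ ν 3 := hne _ _
  have old : ∀ z, z ≠ x → z ≠ D.edge x → D''.next (ι' (ι z)) = ι' (ι (D.next z)) := by
    intro z h1 h2
    rw [h'.next_old (hne _ _) (by rw [h.edge_three]; exact hne _ _), h.next_old h1 h2]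
  have s1 : D''.next (ι' (ι x)) = ι' (ν 2) := by
    rw [h'.next_old (hne _ _) (by rw [h.edge_three]; exact hne _ _), h.next_left]
  have s2 : D''.next (ι' (ν 2)) = ν' 3 := by
    rw [next_apply, e1, h'.opp_new]
    rfl
  have s4 : D''.next (ν' 0) = ι' (ν 1) := by
    rw [h'.next_zero, h.opp_new]
    rfl
  have ne13 : ν 1 ≠ ν 3 := h.new_injective.ne (by decide)
  have ne12 : ν 1 ≠ ν 2 := h.new_injective.ne (by decide)
  have ne03 : ν 0 ≠ ν 3 := h.new_injective.ne (by decide)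
  have ne02 : ν 0 ≠ ν 2 := h.new_injective.ne (by decide)
  have s5 : D''.next (ι' (ν 1)) = ι' (ι (D.next x)) := by
    rw [h'.next_old ne13 (by rwa [h.edge_three]), h.next_one]
  have t1 : D''.next (ι' (ι (D.edge x))) = ι' (ν 3) := by
    rw [h'.next_old (hne _ _) (by rw [h.edge_three]; exact hne _ _), h.next_right]
  have t2 : D''.next (ι' (ν 3)) = ν' 2 := h'.next_left
  have t4 : D''.next (ν' 1) = ι' (ν 0) := by
    rw [h'.next_one, h.next_three]
  have t5 : D''.next (ι' (ν 0)) = ι' (ι (opp _ x)) := by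
    rw [h'.next_old ne03 (by rwa [h.edge_three]), h.next_zero]
  have m1 : ∀ j k, (ι' (ν j)).1 = (ι' (ν k)).1 := by
    have : ∀ j, (ι' (ν (j + 1))).1 = (ι' (ν j)).1 := fun j => by
      rw [← h.rot_new, ← h'.rot_old, rot_fst]
    have h0 : ∀ j, (ι' (ν j)).1 = (ι' (ν 0)).1 := by
      intro j
      rcases zmod_four_cases j with rfl | rfl | rfl | rfl
      exacts [rfl, this 0, (this 1).trans (this 0), (this 2).trans ((this 1).trans (this 0))]
    intro j k
    rw [h0 j, h0 k]
  have memν : ∀ j, (ι' (ν j)).1 ∈ ({(ι' (ν 2)).1, (ν' 0).1} : Set (Fin D''.crossings)) :=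
    fun j => Or.inl (m1 _ _)
  have memν' : ∀ j, (ν' j).1 ∈ ({(ι' (ν 2)).1, (ν' 0).1} : Set (Fin D''.crossings)) :=
    fun j => Or.inr (h'.fst_new _ _)
  unfold IsOmega2
  dsimp only
  rw [e2]
  refine ⟨⟨by rw [e2, e3], by rw [e2]; exact (h'.fst_old_ne _ _).symm, ?_, ?_⟩, ι' ∘ ι,
    ⟨h'.old_injective.comp h.old_injective, ?_, fun z => ?_, fun z => ?_, fun z => ?_⟩,
    fun z => ?_⟩
  · rw [e1, h'.over_new, h'.over_old, h.over_new]
    have : 1 + (i + 1) = 2 + i := by ring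
    rw [this]
  · rw [h'.outer_old]
    exact h.outer_two
  · ext w
    simp only [Set.mem_ofPred_eq, Set.mem_insert_iff, Set.mem_singleton_iff, not_or]
    constructor
    · rintro ⟨z, rfl⟩
      refine ⟨fun e => ?_, h'.fst_old_ne _ _⟩
      have := eq_of_fst_eq e.symm
      simp only [h'.rot_old, h'.opp_old, h.rot_new, h.opp_new, Function.comp_apply] at this
      rcases this with e | e | e | e <;> exact hne _ _ (h'.old_injective e)
    · rintro ⟨w1, w2⟩
      obtain ⟨w, rfl⟩ := (h'.mem_range_old w 0).2 w2
      rcases h.old_or_new w with ⟨z, rfl⟩ | ⟨j, rfl⟩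
      exacts [⟨z, rfl⟩, absurd (m1 _ _) w1]
  · simp only [Function.comp_apply, h'.rot_old, h.rot_old]
  · simp only [Function.comp_apply, h'.over_old, h.over_old]
  · by_cases h1 : z = x
    · subst h1
      have p2 : (D''.next ^ 2) (ι' (ι z)) = ν' 3 := by rw [pow_succ', pow_one, mul_apply, s1, s2]
      have p3 : (D''.next ^ 3) (ι' (ι z)) = ν' 0 := by rw [pow_succ', mul_apply, p2, h'.next_three]
      have p4 : (D''.next ^ 4) (ι' (ι z)) = ι' (ν 1) := by rw [pow_succ', mul_apply, p3, s4]
      refine ⟨4, by rw [pow_succ', mul_apply, Function.comp_apply, Function.comp_apply, p4, s5],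
        fun j hj => ?_⟩
      interval_cases j
      · rw [Function.comp_apply, pow_one, s1]
        exact memν _
      · rw [Function.comp_apply, p2]
        exact memν' _
      · rw [Function.comp_apply, p3]
        exact memν' _
      · rw [Function.comp_apply, p4]
        exact memν _
    · by_cases h2 : z = D.edge x
      · subst h2
        have p2 : (D''.next ^ 2) (ι' (ι (D.edge x))) = ν' 2 := by
          rw [pow_succ', pow_one, mul_apply, t1, t2]
        have p3 : (D''.next ^ 3) (ι' (ι (D.edge x))) = ν' 1 := by
          rw [pow_succ', mul_apply, p2, h'.next_two]
        have p4 : (D''.next ^ 4) (ι' (ι (D.edge x))) = ι' (ν 0) := by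
          rw [pow_succ', mul_apply, p3, t4]
        refine ⟨4, by rw [pow_succ', mul_apply, Function.comp_apply, Function.comp_apply, p4, t5,
          next_apply, D.edge_edge], fun j hj => ?_⟩
        interval_cases j
        · rw [Function.comp_apply, pow_one, t1]
          exact memν _
        · rw [Function.comp_apply, p2]
          exact memν' _
        · rw [Function.comp_apply, p3]
          exact memν' _
        · rw [Function.comp_apply, p4]
          exact memν _
      · exact ⟨0, (old z h1 h2).symm, by simp⟩
  · have hν : opp _ (ν' 0) = ν' 2 := h'.opp_new 0
    rw [Function.comp_apply, hν, h'.outer_old, h.outer_old]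
    constructor
    · exact Or.inl
    · rintro (hz | ⟨ho, hr⟩)
      · exact hz
      · have ho : opp _ (ι' (ν 2)) ∈ D''.outer := ho.resolve_right h'.outer_two
        rcases hr with hr | hr
        · rw [D''.mem_outer_iff_of_sameRegion hr, h'.outer_old, h.outer_old] at ho
          exact ho
        · have : ν' 2 = ι' (ι z) := by
            obtain ⟨k, hk⟩ := hr
            rwa [zpow_apply_eq_self_of_apply_eq_self h'.nextCorner_two] at hk
          exact absurd this.symm (h'.old_ne_new _ _)

/-- If two loops are next to each other, then it does not matter which one is the older one. -/
theorem exists_exchange (h : D.IsKink x i D' ι ν) (h' : D'.IsKink (ι x) i D'' ι' ν') :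
    ∃ f, D'.IsKink (ν 1) i D'' f (ι' ∘ ν) ∧ (∀ z, f (ι z) = ι' (ι z)) ∧ ∀ j, f (ν j) = ν' j := by
  have hf : ∀ w, ∃ v, (∀ z, ι z = w → v = ι' (ι z)) ∧ ∀ j, ν j = w → v = ν' j := by
    intro w
    rcases h.old_or_new w with ⟨z, rfl⟩ | ⟨j, rfl⟩
    · exact ⟨ι' (ι z), fun z' e => by rw [e], fun j e => absurd e.symm (h.old_ne_new _ _)⟩
    · exact ⟨ν' j, fun z e => absurd e (h.old_ne_new _ _), fun k e => by rw [h.new_injective e]⟩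
  choose f hf₁ hf₂ using hf
  have f_old : ∀ z, f (ι z) = ι' (ι z) := fun z => hf₁ _ z rfl
  have f_new : ∀ j, f (ν j) = ν' j := fun j => hf₂ _ j rfl
  have hx : D'.edge (ι x) = ν 0 := h.edge_old_left
  have region : ∀ {z w : Dart D''.crossings}, nextCorner D''.edge z = w →
      (z ∈ D''.outer ↔ w ∈ D''.outer) := fun e => D''.mem_outer_iff_of_sameRegion ⟨1, by simpa⟩
  have region' : ∀ {z w : Dart D'.crossings}, nextCorner D'.edge z = w →
      (z ∈ D'.outer ↔ w ∈ D'.outer) := fun e => D'.mem_outer_iff_of_sameRegion ⟨1, by simpa⟩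
  have edge0 : ∀ j : ZMod 4, j ≠ 0 → D''.edge (ι' (ν j)) = ι' (D'.edge (ν j)) := fun j hj =>
    h'.edge_old _ (h.old_ne_new _ _).symm (by rw [hx]; exact h.new_injective.ne hj)
  refine ⟨f, ⟨?_, h'.old_injective.comp h.new_injective, ?_, ?_, ?_, ?_, ?_, ?_, ?_, ?_, ?_, ?_,
    ?_, ?_⟩, f_old, f_new⟩
  · intro v w e
    rcases h.old_or_new v with ⟨z, rfl⟩ | ⟨j, rfl⟩ <;>
    rcases h.old_or_new w with ⟨z', rfl⟩ | ⟨j', rfl⟩ <;>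
    simp only [f_old, f_new] at e
    · exact h'.old_injective e
    · exact absurd e (h'.old_ne_new _ _)
    · exact absurd e.symm (h'.old_ne_new _ _)
    · rw [h'.new_injective e]
  · intro w j e
    rcases h.old_or_new w with ⟨z, rfl⟩ | ⟨k, rfl⟩ <;> simp only [f_old, f_new] at e
    · exact h.old_ne_new _ _ (h'.old_injective e)
    · exact h'.old_ne_new _ _ e.symm
  · intro w
    rcases h'.old_or_new w with ⟨z, rfl⟩ | ⟨k, rfl⟩
    · rcases h.old_or_new z with ⟨z, rfl⟩ | ⟨k, rfl⟩
      exacts [Or.inl ⟨ι z, f_old z⟩, Or.inr ⟨k, rfl⟩]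
    · exact Or.inl ⟨ν k, f_new k⟩
  · intro w
    rcases h.old_or_new w with ⟨z, rfl⟩ | ⟨k, rfl⟩
    · rw [f_old, h'.rot_old, h.rot_old, f_old]
    · rw [f_new, h'.rot_new, h.rot_new, f_new]
  · intro j
    rw [Function.comp_apply, h'.rot_old, h.rot_new, Function.comp_apply]
  · intro w
    rcases h.old_or_new w with ⟨z, rfl⟩ | ⟨k, rfl⟩
    · rw [f_old, h'.over_old]
    · rw [f_new, h'.over_new, h.over_new]
  · intro j
    rw [Function.comp_apply, h'.over_old, h.over_new]
  · intro w h1 h2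
    rw [h.edge_one] at h2
    rcases h.old_or_new w with ⟨z, rfl⟩ | ⟨k, rfl⟩
    · rw [f_old]
      by_cases hz : z = x
      · subst hz
        rw [h'.edge_old_left, hx, f_new]
      · have hz' : z ≠ D.edge x := fun e => h2 (by rw [e])
        rw [h'.edge_old _ (h.old_injective.ne hz) (by rw [hx]; exact h.old_ne_new _ _),
          h.edge_old z hz hz', f_old]
    · rw [f_new]
      rcases zmod_four_cases k with rfl | rfl | rfl | rfl
      · rw [h'.edge_zero, h.edge_zero, f_old]
      · exact absurd rfl h1
      · rw [h'.edge_two, h.edge_two, f_new]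
      · rw [h'.edge_three, h.edge_three, f_new]
  · rw [f_new, h'.edge_one, hx, Function.comp_apply]
  · rw [h.edge_one, f_old, Function.comp_apply, ← h.edge_one, ← edge0 1 (by decide),
      D''.edge_edge]
  · rw [Function.comp_apply, edge0 2 (by decide), h.edge_two, Function.comp_apply]
  -- Apart from its monogon, each corner at the loop lies in a region having a corner elsewhere;
  -- following `nextCorner` transports membership in the unbounded region.
  · have k1 : ν' 0 ∈ D''.outer ↔ ν 0 ∈ D'.outer := by
      rw [← h'.outer_old, ← region (z := ι' (ν 0)) (w := ν' 0)]
      rw [nextCorner_apply, ← hx, h'.edge_old_right, h'.rot_new, h'.opp_new]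
      rfl
    have k3 : ν' 3 ∈ D''.outer ↔ ι x ∈ D'.outer := by
      rw [← h'.outer_old, ← region (z := ι' (ι x)) (w := ν' 3)]
      rw [nextCorner_apply, h'.edge_old_left, h'.rot_new, h'.opp_new]
      rfl
    have k4 : ν' 3 ∈ D''.outer ↔ ν' 1 ∈ D''.outer := by
      refine region ?_
      rw [nextCorner_apply, h'.edge_three, h'.rot_new, h'.opp_new]
      rfl
    have l3 : ι x ∈ D'.outer ↔ ν 3 ∈ D'.outer := by
      refine region' ?_
      rw [nextCorner_apply, h.edge_old_left, h.rot_new, h.opp_new]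
      rfl
    have l4 : ν 3 ∈ D'.outer ↔ ν 1 ∈ D'.outer := by
      refine region' ?_
      rw [nextCorner_apply, h.edge_three, h.rot_new, h.opp_new]
      rfl
    intro w
    rcases h.old_or_new w with ⟨z, rfl⟩ | ⟨k, rfl⟩
    · rw [f_old, h'.outer_old]
    · rw [f_new]
      rcases zmod_four_cases k with rfl | rfl | rfl | rfl
      · exact k1
      · exact k4.symm.trans (k3.trans (l3.trans l4))
      · exact iff_of_false h'.outer_two h.outer_two
      · exact k3.trans l3
  · rw [Function.comp_apply, h'.outer_old]
    exact h.outer_two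

end IsKink

end Diagram

end KnotDiag

/-! ### Existence of kinks -/

namespace KnotDiag

open CyclicWalk Equiv.Perm

/-- A first return map keeps the cycles that meet its range; the only other one is the fixed point
`p`. For a new loop, `p` is the corner of its monogon, which keeps Euler's formula true. -/
theorem card_cycles_eq_add_one {X Y : Type*} [Finite X] [Finite Y] {σ : Equiv.Perm X}
    {τ : Equiv.Perm Y} {f : Y → X} (h : FirstReturn σ τ f) {p : X} (hp : σ p = p)
    (hp' : ∀ y, f y ≠ p) (hc : ∀ w, w ≠ p → ∃ y, SameCycle σ (f y) w) :
    Nat.card (Quotient (SameCycle.setoid σ)) = Nat.card (Quotient (SameCycle.setoid τ)) + 1 := by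
  have fixed : ∀ w, SameCycle σ p w → w = p := by
    rintro w ⟨k, hk⟩
    rwa [zpow_apply_eq_self_of_apply_eq_self hp, eq_comm] at hk
  let g : Quotient (SameCycle.setoid τ) → Quotient (SameCycle.setoid σ) :=
    Quotient.map f fun a b hab => (h.sameCycle_iff a b).2 hab
  let F : Option (Quotient (SameCycle.setoid τ)) → Quotient (SameCycle.setoid σ) :=
    fun o => o.elim (Quotient.mk _ p) g
  have hF : Function.Bijective F := by
    constructor
    · rintro (_ | a) (_ | b) hab
      · rfl
      · induction b using Quotient.inductionOn with
        | _ b => exact absurd (fixed _ (Quotient.exact hab)) (hp' b)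
      · induction a using Quotient.inductionOn with
        | _ a => exact absurd (fixed _ (Quotient.exact hab).symm) (hp' a)
      · induction a using Quotient.inductionOn with
        | _ a =>
          induction b using Quotient.inductionOn with
          | _ b => exact congrArg some (Quotient.sound ((h.sameCycle_iff a b).1 (Quotient.exact hab)))
    · intro w
      induction w using Quotient.inductionOn with
      | _ w =>
        by_cases hw : w = p
        · exact ⟨none, by rw [hw]; rfl⟩
        · obtain ⟨y, hy⟩ := hc w hw
          exact ⟨some (Quotient.mk _ y), Quotient.sound hy⟩
  rw [← Nat.card_congr (Equiv.ofBijective F hF), Finite.card_option]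

/-- The darts at the old crossings when a crossing is added. -/
def oldDart {n : ℕ} (z : Dart n) : Dart (n + 1) := (Fin.castSucc z.1, z.2)

/-- The darts at a new crossing. -/
def newDart (n : ℕ) (i j : ZMod 4) : Dart (n + 1) := (Fin.last n, j + i)

theorem oldDart_injective (n : ℕ) : Function.Injective (oldDart (n := n)) := fun _ _ h =>
  Prod.ext (Fin.castSucc_injective n (congrArg Prod.fst h)) (congrArg Prod.snd h :)

theorem newDart_injective (n : ℕ) (i : ZMod 4) : Function.Injective (newDart n i) := fun _ _ h =>
  add_right_cancel (congrArg Prod.snd h :)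

theorem oldDart_ne_newDart {n : ℕ} (z : Dart n) (i j : ZMod 4) : oldDart z ≠ newDart n i j :=
  fun h => (Fin.castSucc_lt_last z.1).ne (congrArg Prod.fst h)

theorem oldDart_or_newDart {n : ℕ} (i : ZMod 4) (w : Dart (n + 1)) :
    (∃ z, oldDart z = w) ∨ ∃ j, newDart n i j = w := by
  obtain ⟨c, k⟩ := w
  induction c using Fin.lastCases with
  | last => exact Or.inr ⟨k - i, by simp [newDart]⟩
  | cast c => exact Or.inl ⟨(c, k), rfl⟩

theorem exists_kinkEdge {n : ℕ} (e : Equiv.Perm (Dart n)) (he : ∀ z, e (e z) = z)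
    (hne : ∀ z, e z ≠ z) (x : Dart n) (i : ZMod 4) :
    ∃ e' : Equiv.Perm (Dart (n + 1)), (∀ w, e' (e' w) = w) ∧ (∀ w, e' w ≠ w) ∧
      (∀ z, z ≠ x → z ≠ e x → e' (oldDart z) = oldDart (e z)) ∧
      e' (oldDart x) = newDart n i 0 ∧ e' (oldDart (e x)) = newDart n i 1 ∧
      e' (newDart n i 2) = newDart n i 3 := by
  let E : Dart n ⊕ ZMod 4 ≃ Dart (n + 1) :=
    Equiv.ofBijective (Sum.elim oldDart (newDart n i)) ⟨Function.Injective.sumElim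
      (oldDart_injective n) (newDart_injective n i) fun z j => oldDart_ne_newDart z i j, fun w => by
        rcases oldDart_or_newDart i w with ⟨z, hz⟩ | ⟨j, hj⟩
        exacts [⟨Sum.inl z, hz⟩, ⟨Sum.inr j, hj⟩]⟩
  let s : Equiv.Perm (ZMod 4) := Equiv.swap 0 1 * Equiv.swap 2 3
  have hs : ∀ j, s (s j) = j := by decide
  have hs' : ∀ j, s j ≠ j := by decide
  let b : Equiv.Perm (Dart n ⊕ ZMod 4) := Equiv.sumCongr e s
  have hb : ∀ w, b (b w) = w := by
    rintro (w | w)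
    exacts [congrArg Sum.inl (he w), congrArg Sum.inr (hs w)]
  have hb' : ∀ w, b w ≠ w := by
    rintro (w | w) h
    exacts [hne w (Sum.inl_injective h), hs' w (Sum.inr_injective h)]
  -- Start from the disjoint union with a figure eight, joined by 0-1 and 2-3, and conjugate by the
  -- transposition of `e x` and the new dart 0. The arcs at `x` and at 0-1 are cut and reglued, and
  -- a fixed-point-free involution stays one.
  let c : Dart n ⊕ ZMod 4 ≃ Dart (n + 1) := (Equiv.swap (Sum.inl (e x)) (Sum.inr 0)).trans E
  have c_old : ∀ z, z ≠ e x → c (Sum.inl z) = oldDart z := fun z hz => by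
    change E _ = _
    rw [Equiv.swap_apply_of_ne_of_ne (fun h => hz (Sum.inl_injective h)) Sum.inl_ne_inr]
    rfl
  have c_new : ∀ j, j ≠ 0 → c (Sum.inr j) = newDart n i j := fun j hj => by
    change E _ = _
    rw [Equiv.swap_apply_of_ne_of_ne Sum.inr_ne_inl (fun h => hj (Sum.inr_injective h))]
    rfl
  have c_right : c (Sum.inl (e x)) = newDart n i 0 := by
    change E _ = _
    rw [Equiv.swap_apply_left]
    rfl
  have c_zero : c (Sum.inr 0) = oldDart (e x) :=
    congrArg E (Equiv.swap_apply_right (Sum.inl (e x)) (Sum.inr 0))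
  have key : ∀ u, c.permCongr b (c u) = c (b u) := fun u => by
    rw [Equiv.permCongr_apply, Equiv.symm_apply_apply]
  refine ⟨c.permCongr b, fun w => ?_, fun w => ?_, fun z h1 h2 => ?_, ?_, ?_, ?_⟩
  · obtain ⟨u, rfl⟩ := c.surjective w
    rw [key, key, hb]
  · obtain ⟨u, rfl⟩ := c.surjective w
    rw [key]
    exact c.injective.ne (hb' u)
  · rw [← c_old z h2, key]
    exact c_old _ fun h => h1 (e.injective h)
  · rw [← c_old x (hne x).symm, key]
    exact c_right
  · rw [← c_zero, key]
    exact c_new 1 (by decide)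
  · rw [← c_new 2 (by decide), key]
    exact c_new 3 (by decide)

namespace Diagram

variable {A : Ambient}

theorem exists_isKink (D : Diagram A) (x : Dart D.crossings) (i : ZMod 4) :
    ∃ (D' : Diagram A) (ι : Dart D.crossings → Dart D'.crossings)
      (ν : ZMod 4 → Dart D'.crossings), D.IsKink x i D' ι ν := by
  obtain ⟨e', he, hne, edge_old, edge_left, edge_right, edge_two⟩ :=
    exists_kinkEdge D.edge D.edge_edge D.edge_ne x i
  have edge_zero : e' (newDart _ i 0) = oldDart x := by rw [← edge_left, he]
  have edge_one : e' (newDart _ i 1) = oldDart (D.edge x) := by rw [← edge_right, he]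
  have edge_three : e' (newDart _ i 3) = newDart _ i 2 := by rw [← edge_two, he]
  have rot_old : ∀ z : Dart D.crossings, rot _ (oldDart z) = oldDart (rot _ z) := fun z => rfl
  have opp_old : ∀ z : Dart D.crossings, opp _ (oldDart z) = oldDart (opp _ z) := fun z => rfl
  have rot_new : ∀ j, rot _ (newDart D.crossings i j) = newDart _ i (j + 1) := fun j =>
    Prod.ext rfl (add_right_comm j i 1)
  have opp_new : ∀ j, opp _ (newDart D.crossings i j) = newDart _ i (j + 2) := fun j =>
    Prod.ext rfl (add_right_comm j i 2)
  have component : ∀ v w, ∃ g ∈ Subgroup.closure {e', opp (D.crossings + 1)}, g v = w := by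
    let R : Dart (D.crossings + 1) → Dart (D.crossings + 1) → Prop := fun v w =>
      ∃ g ∈ Subgroup.closure {e', opp (D.crossings + 1)}, g v = w
    have refl : ∀ v, R v v := fun v => ⟨1, one_mem _, rfl⟩
    have symm : ∀ {v w}, R v w → R w v := by
      rintro v w ⟨g, hg, rfl⟩
      exact ⟨g⁻¹, inv_mem hg, by simp⟩
    have trans : ∀ {u v w}, R u v → R v w → R u w := by
      rintro u v w ⟨g, hg, rfl⟩ ⟨k, hk, rfl⟩
      exact ⟨k * g, mul_mem hk hg, rfl⟩
    have edge : ∀ {v w}, e' v = w → R v w := fun h =>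
      ⟨e', Subgroup.subset_closure (Or.inl rfl), h⟩
    have opp : ∀ {v w}, opp _ v = w → R v w := fun h =>
      ⟨_, Subgroup.subset_closure (Or.inr rfl), h⟩
    have r0 : R (oldDart x) (newDart _ i 0) := edge edge_left
    have r2 : R (oldDart x) (newDart _ i 2) := trans r0 (opp (opp_new 0))
    have r3 : R (oldDart x) (newDart _ i 3) := trans r2 (edge edge_two)
    have r1 : R (oldDart x) (newDart _ i 1) := trans r3 (opp (opp_new 3))
    have rx : R (oldDart x) (oldDart (D.edge x)) := trans r1 (edge edge_one)
    have rold : ∀ g ∈ Subgroup.closure {D.edge, KnotDiag.opp D.crossings}, ∀ z,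
        R (oldDart z) (oldDart (g z)) := by
      intro g hg
      induction hg using Subgroup.closure_induction with
      | mem g hg =>
        intro z
        rcases hg with rfl | rfl
        · by_cases h1 : z = x
          · rw [h1]
            exact rx
          · by_cases h2 : z = D.edge x
            · rw [h2, D.edge_edge]
              exact symm rx
            · exact edge (edge_old z h1 h2)
        · exact opp (opp_old z)
      | one => exact fun z => refl _
      | mul g k _ _ hg hk => exact fun z => trans (hk z) (hg (k z))
      | inv g _ hg =>
        intro z
        have := hg (g⁻¹ z)
        rw [show g (g⁻¹ z) = z by simp] at this
        exact symm this
    have all : ∀ w, R (oldDart x) w := by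
      intro w
      rcases oldDart_or_newDart i w with ⟨z, rfl⟩ | ⟨j, rfl⟩
      · obtain ⟨g, hg, rfl⟩ := D.one_component x z
        exact rold g hg x
      · rcases zmod_four_cases j with rfl | rfl | rfl | rfl
        exacts [r0, r1, r2, r3]
    exact fun v w => trans (symm (all v)) (all w)
  have nc_left : nextCorner e' (oldDart x) = newDart _ i 3 := by
    rw [nextCorner_apply, edge_left, rot_new, opp_new]
    rfl
  have nc_right : nextCorner e' (oldDart (D.edge x)) = newDart _ i 0 := by
    rw [nextCorner_apply, edge_right, rot_new, opp_new]
    rfl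
  have nc_zero : nextCorner e' (newDart _ i 0) = oldDart (opp _ (rot _ x)) := by
    rw [nextCorner_apply, edge_zero, rot_old, opp_old]
  have nc_one : nextCorner e' (newDart _ i 1) = oldDart (nextCorner D.edge x) := by
    rw [nextCorner_apply, edge_one, rot_old, opp_old, nextCorner_apply]
  have nc_two : nextCorner e' (newDart _ i 2) = newDart _ i 2 := by
    rw [nextCorner_apply, edge_two, rot_new, opp_new]
    rfl
  have nc_three : nextCorner e' (newDart _ i 3) = newDart _ i 1 := by
    rw [nextCorner_apply, edge_three, rot_new, opp_new]
    rfl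
  have hreturn : FirstReturn (nextCorner e') (nextCorner D.edge) oldDart := by
    have notMem : ∀ j, newDart D.crossings i j ∉ Set.range oldDart := by
      rintro j ⟨z, hz⟩
      exact oldDart_ne_newDart _ _ _ hz
    refine ⟨oldDart_injective _, fun z => ?_⟩
    by_cases h1 : z = x
    · rw [h1]
      refine ⟨2, by rw [pow_succ, pow_two, mul_apply, mul_apply, nc_left, nc_three, nc_one],
        fun k hk => ?_⟩
      interval_cases k
      · rw [pow_one, nc_left]
        exact notMem _
      · rw [pow_two, mul_apply, nc_left, nc_three]
        exact notMem _
    · by_cases h2 : z = D.edge x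
      · rw [h2]
        refine ⟨1, by rw [pow_two, mul_apply, nc_right, nc_zero, nextCorner_apply, D.edge_edge],
          fun k hk => ?_⟩
        obtain rfl : k = 0 := by omega
        rw [pow_one, nc_right]
        exact notMem _
      · exact ⟨0, by rw [pow_one, nextCorner_apply, nextCorner_apply, edge_old z h1 h2, rot_old,
          opp_old], by simp⟩
  have sameCycle : ∀ {v w}, nextCorner e' v = w → SameCycle (nextCorner e') v w :=
    fun h => ⟨1, h⟩
  have fixed : ∀ w, SameCycle (nextCorner e') w (newDart _ i 2) → w = newDart _ i 2 := by
    intro w h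
    obtain ⟨k, hk⟩ := h.symm
    rwa [zpow_apply_eq_self_of_apply_eq_self nc_two, eq_comm] at hk
  have c3 : SameCycle (nextCorner e') (oldDart x) (newDart _ i 3) := sameCycle nc_left
  have hcover : ∀ w, w ≠ newDart _ i 2 → ∃ z, SameCycle (nextCorner e') (oldDart z) w := by
    intro w hw
    rcases oldDart_or_newDart i w with ⟨z, rfl⟩ | ⟨j, rfl⟩
    · exact ⟨z, SameCycle.refl _ _⟩
    · rcases zmod_four_cases j with rfl | rfl | rfl | rfl
      exacts [⟨_, sameCycle nc_right⟩, ⟨_, c3.trans (sameCycle nc_three)⟩, absurd rfl hw, ⟨_, c3⟩]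
  have hne0 : D.crossings ≠ 0 := fun h0 => Nat.not_lt_zero x.1 (by have := x.1.2; omega)
  let D' : Diagram A :=
    { crossings := D.crossings + 1
      edge := e'
      edge_edge := he
      edge_ne := hne
      one_component := component
      planar := fun _ => by
        rw [card_cycles_eq_add_one hreturn nc_two (fun y => oldDart_ne_newDart _ _ _) hcover,
          D.planar hne0, add_right_comm]
      -- No old region disappears, so the unbounded region is the one containing the old unbounded
      -- corners; on the sphere this set is empty.
      outer := {w | ∃ z ∈ D.outer, SameCycle (nextCorner e') (oldDart z) w}
      outer_sphere := fun hA => by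
        rw [D.outer_sphere hA]
        simp
      outer_plane := fun hA _ => by
        obtain ⟨y, hy⟩ := D.outer_plane hA hne0
        refine ⟨oldDart y, Set.ext fun w => ⟨?_, fun hw => ⟨y, ?_, hw⟩⟩⟩
        · rintro ⟨z, hz, hw⟩
          rw [hy] at hz
          exact ((hreturn.sameCycle_iff y z).2 hz).trans hw
        · rw [hy]
          exact SameCycle.refl _ _ }
  refine ⟨D', oldDart, newDart _ i, oldDart_injective _, newDart_injective _ i,
    fun z j => oldDart_ne_newDart z i j, oldDart_or_newDart i, rot_old, rot_new, fun z => Iff.rfl,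
    fun j => Iff.rfl, edge_old, edge_left, edge_right, edge_two, fun z => ⟨?_, fun hz => ?_⟩, ?_⟩
  · rintro ⟨y, hy, h⟩
    rwa [← D.mem_outer_iff_of_sameRegion ((hreturn.sameCycle_iff y z).1 h)]
  · exact ⟨z, hz, SameCycle.refl _ _⟩
  · rintro ⟨y, hy, h⟩
    exact oldDart_ne_newDart _ _ _ (fixed _ h)

end Diagram

end KnotDiag

/-! ### Diagrams with many crossings -/

namespace KnotDiag

open CyclicWalk Equiv.Perm

variable {A : Ambient}

/-- The arcs of the figure-eight diagram with one crossing. -/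
def figureEightEdge : Equiv.Perm (Dart 1) :=
  Equiv.prodCongr (Equiv.refl _) (Equiv.swap 0 1 * Equiv.swap 2 3)

instance : DecidableRel (SameCycle.setoid (nextCorner figureEightEdge)).r := fun x y =>
  inferInstanceAs (Decidable (SameCycle (nextCorner figureEightEdge) x y))

/-- The figure-eight diagram with one crossing. -/
def figureEight (A : Ambient) : Diagram A where
  crossings := 1
  edge := figureEightEdge
  edge_edge := by decide
  edge_ne := by decide
  one_component := by
    have h₁ : figureEightEdge ∈ Subgroup.closure {figureEightEdge, opp 1} :=
      Subgroup.subset_closure (Or.inl rfl)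
    have h₂ : opp 1 ∈ Subgroup.closure {figureEightEdge, opp 1} :=
      Subgroup.subset_closure (Or.inr rfl)
    have mem : ∀ j k : Fin 2, figureEightEdge ^ (j : ℕ) * opp 1 ^ (k : ℕ) ∈
        Subgroup.closure {figureEightEdge, opp 1} := fun j k =>
      mul_mem (pow_mem h₁ _) (pow_mem h₂ _)
    have key : ∀ x y, ∃ j k : Fin 2, (figureEightEdge ^ (j : ℕ) * opp 1 ^ (k : ℕ)) x = y := by
      decide
    intro x y
    obtain ⟨j, k, h⟩ := key x y
    exact ⟨_, mem j k, h⟩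
  planar _ := by
    rw [Nat.card_eq_fintype_card]
    decide
  outer := {y | A = Ambient.plane ∧ (nextCorner figureEightEdge).SameCycle (0, 1) y}
  outer_sphere := by
    rintro rfl
    simp
  outer_plane := by
    rintro rfl -
    exact ⟨(0, 1), by simp⟩

/-- The round circle has no dart at which a loop could be attached by `exists_isKink`; its first
crossing has to be supplied by hand. -/
theorem isOmega1_figureEight (D : Diagram A) (hD : D.crossings = 0) :
    (figureEight A).IsOmega1 ((0, 2) : Dart 1) D := by
  have hempty : IsEmpty (Dart D.crossings) := by
    rw [hD]
    infer_instance
  have fixed : nextCorner figureEightEdge (0, 2) = (0, 2) := by decide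
  refine ⟨⟨fixed, ?_⟩, hempty.elim, ⟨fun x => hempty.elim x, ?_, fun x => hempty.elim x,
    fun x => hempty.elim x, fun x => hempty.elim x⟩, fun x => hempty.elim x⟩
  · rintro ⟨-, k, hk⟩
    have : ((0, 1) : Dart 1) = (0, 2) := by
      have := (nextCorner figureEightEdge ^ k).injective
        (hk.trans (zpow_apply_eq_self_of_apply_eq_self fixed k).symm)
      exact this
    exact absurd this (by decide)
  · rw [Set.range_eq_empty, eq_comm, Set.eq_empty_iff_forall_notMem]
    exact fun x hx => hx (Subsingleton.elim (α := Fin 1) _ _)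

theorem knotType_eq_of_isOmega1 {D D' : Diagram A} {x : Dart D.crossings} (h : D.IsOmega1 x D') :
    knotType (⟦D⟧ : DiagramClass A) = knotType ⟦D'⟧ :=
  Quot.sound ⟨Quot.mk _ (Move.omega1 D x D' h), rfl⟩

theorem Diagram.IsKink.knotType_eq {D D' : Diagram A} {x : Dart D.crossings} {i : ZMod 4}
    {ι : Dart D.crossings → Dart D'.crossings} {ν : ZMod 4 → Dart D'.crossings}
    (h : D.IsKink x i D' ι ν) : knotType (⟦D'⟧ : DiagramClass A) = knotType ⟦D⟧ :=
  knotType_eq_of_isOmega1 h.isOmega1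

theorem exists_crossings_eq (K : KnotType A) : ∃ m₀ : ℕ, 0 < m₀ ∧ ∀ m, m₀ ≤ m →
    ∃ D : Diagram A, D.crossings = m ∧ knotType ⟦D⟧ = K := by
  have step : ∀ m, 0 < m → (∃ D : Diagram A, D.crossings = m ∧ knotType ⟦D⟧ = K) →
      ∃ D : Diagram A, D.crossings = m + 1 ∧ knotType ⟦D⟧ = K := by
    rintro m hm ⟨D, rfl, hK⟩
    obtain ⟨D', ι, ν, h⟩ := D.exists_isKink (⟨0, hm⟩, 0) 0
    exact ⟨D', h.crossings_eq, h.knotType_eq.trans hK⟩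
  obtain ⟨D, hD, hK⟩ : ∃ D : Diagram A, 0 < D.crossings ∧ knotType ⟦D⟧ = K := by
    obtain ⟨d, hd⟩ := Quot.exists_rep K
    obtain ⟨D, rfl⟩ := Quotient.exists_rep d
    rcases Nat.eq_zero_or_pos D.crossings with h | h
    · exact ⟨figureEight A, Nat.one_pos, (knotType_eq_of_isOmega1 (isOmega1_figureEight D h)).trans hd⟩
    · exact ⟨D, h, hd⟩
  refine ⟨D.crossings, hD, fun m hm => ?_⟩
  induction m, hm using Nat.le_induction with
  | base => exact ⟨D, rfl, hK⟩
  | succ m hm ih => exact step m (hD.trans_le hm) ih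

end KnotDiag

/-! ### Two neighbouring loops -/

namespace KnotDiag

namespace Diagram

variable {A : Ambient}

/-- The arc that leaves the loop with corner `t` arrives at a crossing whose two other
darts are joined to a loop. -/
def IsLoopBeforeLoop (D : Diagram A) (t : Dart D.crossings) : Prop :=
  D.edge (opp _ (D.edge (opp _ (rot _ t)))) = rot _ (opp _ (D.edge (opp _ (rot _ t))))

/-- The arc that leaves the loop with corner `t` arrives at a crossing whose two other
darts are not joined to a loop, but belong to a region with two corners. -/
def IsLoopBeforeBigon (D : Diagram A) (t : Dart D.crossings) : Prop :=
  D.edge t = rot _ t ∧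
    D.edge (rot _ (opp _ (D.edge (opp _ (rot _ t))))) =
      opp _ (rot _ (D.edge (opp _ (D.edge (opp _ (rot _ t)))))) ∧ ¬ D.IsLoopBeforeLoop t

theorem Iso.map_opp {D E : Diagram A} (f : Iso D E) (w : Dart D.crossings) :
    f.toEquiv (opp _ w) = opp _ (f.toEquiv w) := by
  rw [← rot_rot, f.map_rot, f.map_rot, rot_rot]

theorem Iso.isLoopBeforeLoop_iff {D E : Diagram A} (f : Iso D E) (t : Dart D.crossings) :
    E.IsLoopBeforeLoop (f.toEquiv t) ↔ D.IsLoopBeforeLoop t := by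
  simp only [IsLoopBeforeLoop, ← f.map_rot, ← f.map_edge, ← f.map_opp, f.toEquiv.injective.eq_iff]

theorem Iso.isLoopBeforeBigon_iff {D E : Diagram A} (f : Iso D E) (t : Dart D.crossings) :
    E.IsLoopBeforeBigon (f.toEquiv t) ↔ D.IsLoopBeforeBigon t := by
  simp only [IsLoopBeforeBigon, f.isLoopBeforeLoop_iff, ← f.map_rot, ← f.map_edge, ← f.map_opp,
    f.toEquiv.injective.eq_iff]

theorem Iso.ncard_isLoopBeforeBigon {D E : Diagram A} (f : Iso D E) :
    {t | D.IsLoopBeforeBigon t}.ncard = {t | E.IsLoopBeforeBigon t}.ncard := by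
  rw [← Set.ncard_image_of_injective _ f.toEquiv.injective]
  congr 1
  ext t
  constructor
  · rintro ⟨t, ht, rfl⟩
    exact (f.isLoopBeforeBigon_iff t).2 ht
  · intro ht
    refine ⟨f.toEquiv.symm t, ?_, f.toEquiv.apply_symm_apply t⟩
    rw [Set.mem_ofPred_eq, ← f.isLoopBeforeBigon_iff, f.toEquiv.apply_symm_apply]
    exact ht

/-- The loop with the crossing `s` at an arc of `D` is subdivided, the rest of the
diagram is not changed. -/
theorem IsKink.isLoopBeforeBigon_iff {D E C : Diagram A} {y : Dart D.crossings} {i : ZMod 4}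
    {ι : Dart D.crossings → Dart E.crossings} {s : ZMod 4 → Dart E.crossings}
    (h : D.IsKink y i E ι s) {K : Dart E.crossings → Dart C.crossings}
    (hK : Function.Injective K) (hrot : ∀ z, rot _ (K z) = K (rot _ z))
    (hedge : ∀ z, z ≠ s 2 → z ≠ s 3 → C.edge (K z) = K (E.edge z))
    (h2 : ∀ z, C.edge (K (s 2)) ≠ K z) (h3 : ∀ z, C.edge (K (s 3)) ≠ K z)
    (h23 : C.edge (K (s 3)) ≠ opp _ (rot _ (C.edge (K (s 2))))) :
    (∀ t, C.IsLoopBeforeBigon (K (ι t)) ↔ E.IsLoopBeforeBigon (ι t)) ∧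
      ∀ j, ¬ C.IsLoopBeforeBigon (K (s j)) := by
  have hopp : ∀ z, opp _ (K z) = K (opp _ z) := fun z => by
    rw [← rot_rot, hrot, hrot, rot_rot]
  have old : ∀ z, C.edge (K (ι z)) = K (E.edge (ι z)) := fun z =>
    hedge _ (h.old_ne_new _ _) (h.old_ne_new _ _)
  have e0 : C.edge (K (s 0)) = K (ι y) := by
    rw [hedge _ (h.new_injective.ne (by decide)) (h.new_injective.ne (by decide)), h.edge_zero]
  have e1 : C.edge (K (s 1)) = K (ι (D.edge y)) := by
    rw [hedge _ (h.new_injective.ne (by decide)) (h.new_injective.ne (by decide)), h.edge_one]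
  refine ⟨fun t => ?_, fun j => ?_⟩
  · have hq : opp _ (rot _ (ι t)) = ι (opp _ (rot _ t)) := by rw [h.rot_old, h.opp_old]
    have hq' : opp _ (rot _ (K (ι t))) = K (ι (opp _ (rot _ t))) := by rw [hrot, hopp, hq]
    have o0 : opp _ (s 0) = s 2 := h.opp_new 0
    have o1 : opp _ (s 1) = s 3 := h.opp_new 1
    have r2 : rot _ (s 2) = s 3 := h.rot_new 2
    have r3 : rot _ (s 3) = s 0 := h.rot_new 3
    -- If the arc that leaves `t` is one of the two ends of the arc carrying the loop of `s`, it now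
    -- arrives at `s`, and the property fails in both diagrams. Otherwise nothing relevant has
    -- changed.
    by_cases hy : opp _ (rot _ t) = y
    · refine iff_of_false ?_ ?_
      · rintro ⟨-, h', -⟩
        rw [hq', hy, old, h.edge_old_left, hopp, hrot, o0, r2] at h'
        exact h23 h'
      · rintro ⟨-, -, h'⟩
        apply h'
        rw [IsLoopBeforeLoop, hq, hy, h.edge_old_left, o0, r2, h.edge_two]
    · by_cases hy' : opp _ (rot _ t) = D.edge y
      · refine iff_of_false ?_ ?_
        · rintro ⟨-, h', -⟩
          rw [hq', hy', old, h.edge_old_right, hopp, hrot, o1, r3, e0] at h'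
          apply h3 (rot _ (ι y))
          rw [← hrot, h', rot_opp, rot_rot, opp_opp]
        · rintro ⟨-, h', -⟩
          rw [hq, hy', h.edge_old_right, o1, r3, h.edge_zero, h.edge_three, h.rot_new,
            h.opp_new] at h'
          exact h.old_ne_new _ _ h'
      · simp only [IsLoopBeforeBigon, IsLoopBeforeLoop, old, h.edge_old _ hy hy', hrot,
          hopp, h.opp_old, h.rot_old, hK.eq_iff]
  · rcases zmod_four_cases j with rfl | rfl | rfl | rfl <;> rintro ⟨h', -, -⟩
    · rw [e0, hrot, h.rot_new] at h'
      exact h.old_ne_new _ _ (hK h')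
    · rw [e1, hrot, h.rot_new] at h'
      exact h.old_ne_new _ _ (hK h')
    · exact h2 _ (h'.trans (hrot _))
    · exact h3 _ (h'.trans (hrot _))

section NeighbouringLoops

variable {D E a b : Diagram A} {y : Dart D.crossings}
  {ι₀ : Dart D.crossings → Dart E.crossings} {s : ZMod 4 → Dart E.crossings}
  {ι : Dart E.crossings → Dart a.crossings} {v : ZMod 4 → Dart a.crossings}
  {ι' : Dart a.crossings → Dart b.crossings} {u : ZMod 4 → Dart b.crossings}
  {c : Diagram A} {κ : Dart b.crossings → Dart c.crossings} {w : ZMod 4 → Dart c.crossings}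

/-- The arcs of two neighbouring loops on a loop. -/
theorem edge_neighbouringLoops (hE : D.IsKink y 0 E ι₀ s) (ha : E.IsKink (s 2) 0 a ι v)
    (hb : a.IsKink (ι (s 2)) 0 b ι' u) :
    b.edge (ι' (ι (s 2))) = u 0 ∧ b.edge (u 0) = ι' (ι (s 2)) ∧ b.edge (u 1) = ι' (v 0) ∧
      b.edge (ι' (v 0)) = u 1 ∧ b.edge (ι' (v 1)) = ι' (ι (s 3)) ∧
      b.edge (ι' (ι (s 3))) = ι' (v 1) ∧ b.edge (ι' (v 2)) = ι' (v 3) ∧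
      b.edge (ι' (v 3)) = ι' (v 2) ∧
      ∀ z, z ≠ s 2 → z ≠ s 3 → b.edge (ι' (ι z)) = ι' (ι (E.edge z)) := by
  have hx : a.edge (ι (s 2)) = v 0 := ha.edge_old_left
  have hs : E.edge (s 2) = s 3 := hE.edge_two
  have new : ∀ j, j ≠ 0 → b.edge (ι' (v j)) = ι' (a.edge (v j)) := fun j hj =>
    hb.edge_old _ (ha.old_ne_new _ _).symm (by rw [hx]; exact ha.new_injective.ne hj)
  have old : ∀ z, z ≠ s 2 → b.edge (ι' (ι z)) = ι' (a.edge (ι z)) := fun z hz =>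
    hb.edge_old _ (ha.old_injective.ne hz) (by rw [hx]; exact ha.old_ne_new _ _)
  refine ⟨hb.edge_old_left, hb.edge_zero, by rw [hb.edge_one, hx],
    by rw [← hx, hb.edge_old_right], by rw [new 1 (by decide), ha.edge_one, hs], ?_,
    by rw [new 2 (by decide), ha.edge_two], by rw [new 3 (by decide), ha.edge_three],
    fun z h1 h2 => by rw [old z h1, ha.edge_old z h1 (by rwa [hs])]⟩
  rw [old _ (hE.new_injective.ne (by decide)), ← hs, ha.edge_old_right]

/-- The loop of `u` is followed by that of `v`, whereas the loop of `v` is followed by the crossing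
`s`, whose remaining darts lead to old crossings. -/
theorem isLoopBeforeLoop_neighbouringLoops (hE : D.IsKink y 0 E ι₀ s)
    (ha : E.IsKink (s 2) 0 a ι v) (hb : a.IsKink (ι (s 2)) 0 b ι' u) :
    b.IsLoopBeforeLoop (u 2) ∧ ¬ b.IsLoopBeforeLoop (ι' (v 2)) := by
  obtain ⟨-, -, e1, -, e3, -, e4, -, e6⟩ := edge_neighbouringLoops hE ha hb
  constructor
  · have h1 : opp _ (rot _ (u 2)) = u 1 := by
      rw [hb.rot_new, hb.opp_new]
      rfl
    have h2 : opp _ (ι' (v 0)) = ι' (v 2) := by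
      rw [hb.opp_old, ha.opp_new]
      rfl
    rw [IsLoopBeforeLoop, h1, e1, h2, e4, hb.rot_old, ha.rot_new]
    rfl
  · have h1 : opp _ (rot _ (ι' (v 2))) = ι' (v 1) := by
      rw [hb.rot_old, hb.opp_old, ha.rot_new, ha.opp_new]
      rfl
    have h2 : opp _ (ι' (ι (s 3))) = ι' (ι (s 1)) := by
      rw [hb.opp_old, ha.opp_old, hE.opp_new]
      rfl
    rw [IsLoopBeforeLoop, h1, e3, h2, e6 _ (hE.new_injective.ne (by decide))
      (hE.new_injective.ne (by decide)), hE.edge_one, hb.rot_old, ha.rot_old, hE.rot_new]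
    exact fun h => hE.old_ne_new _ _ (ha.old_injective (hb.old_injective h))

theorem old_or_new_neighbouringLoops (hE : D.IsKink y 0 E ι₀ s)
    (ha : E.IsKink (s 2) 0 a ι v) (hb : a.IsKink (ι (s 2)) 0 b ι' u) {x : Dart b.crossings}
    {i : ZMod 4} (hc : b.IsKink x i c κ w) (t : Dart c.crossings) :
    (∃ z, κ (ι' (ι (ι₀ z))) = t) ∨ (∃ j, κ (ι' (ι (s j))) = t) ∨ (∃ j, κ (ι' (v j)) = t) ∨
      (∃ j, κ (u j) = t) ∨ ∃ j, w j = t := by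
  rcases hc.old_or_new t with ⟨t, rfl⟩ | h
  · rcases hb.old_or_new t with ⟨t, rfl⟩ | ⟨j, rfl⟩
    · rcases ha.old_or_new t with ⟨t, rfl⟩ | ⟨j, rfl⟩
      · rcases hE.old_or_new t with ⟨t, rfl⟩ | ⟨j, rfl⟩
        · exact Or.inl ⟨t, rfl⟩
        · exact Or.inr (Or.inl ⟨j, rfl⟩)
      · exact Or.inr (Or.inr (Or.inl ⟨j, rfl⟩))
    · exact Or.inr (Or.inr (Or.inr (Or.inl ⟨j, rfl⟩)))
  · exact Or.inr (Or.inr (Or.inr (Or.inr h)))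

/-- If the first one of the neighbouring loops is twisted. -/
theorem setOf_isLoopBeforeBigon_left (hE : D.IsKink y 0 E ι₀ s) (ha : E.IsKink (s 2) 0 a ι v)
    (hb : a.IsKink (ι (s 2)) 0 b ι' u) (hc : b.IsKink (u 3) (0 + 1) c κ w) :
    {t | c.IsLoopBeforeBigon t} =
      (fun z => κ (ι' (ι (ι₀ z)))) '' {z | E.IsLoopBeforeBigon (ι₀ z)} := by
  obtain ⟨b1, b2, b3, b4, b5, b6, b7, b8, b9⟩ := edge_neighbouringLoops hE ha hb
  have hu : b.edge (u 3) = u 2 := hb.edge_three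
  have old : ∀ z, c.edge (κ (ι' z)) = κ (b.edge (ι' z)) := fun z =>
    hc.edge_old _ (hb.old_ne_new _ _) (by rw [hu]; exact hb.old_ne_new _ _)
  have new : ∀ j, j ≠ 2 → j ≠ 3 → c.edge (κ (u j)) = κ (b.edge (u j)) := fun j h2 h3 =>
    hc.edge_old _ (hb.new_injective.ne h3) (by rw [hu]; exact hb.new_injective.ne h2)
  have u3 : c.edge (κ (u 3)) = w 0 := hc.edge_old_left
  have u2 : c.edge (κ (u 2)) = w 1 := by rw [← hu, hc.edge_old_right]
  have w1 : c.edge (w 1) = κ (u 2) := by rw [hc.edge_one, hu]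
  have ro : ∀ z, rot _ (κ (ι' z)) = κ (ι' (rot _ z)) := fun z => by rw [hc.rot_old, hb.rot_old]
  have oo : ∀ z, opp _ (κ (ι' z)) = κ (ι' (opp _ z)) := fun z => by rw [hc.opp_old, hb.opp_old]
  have ru : ∀ j, rot _ (κ (u j)) = κ (u (j + 1)) := fun j => by rw [hc.rot_old, hb.rot_new]
  have ou : ∀ j, opp _ (κ (u j)) = κ (u (j + 2)) := fun j => by rw [hc.opp_old, hb.opp_new]
  have inj : Function.Injective fun z => κ (ι' (ι z)) :=
    hc.old_injective.comp (hb.old_injective.comp ha.old_injective)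
  have ne1 : ∀ z j, κ (ι' z) ≠ κ (u j) := fun z j h => hb.old_ne_new _ _ (hc.old_injective h)
  have ne2 : ∀ z j, κ (ι' (ι z)) ≠ κ (ι' (v j)) := fun z j h =>
    ha.old_ne_new _ _ (hb.old_injective (hc.old_injective h))
  have injv : ∀ {j k}, κ (ι' (v j)) = κ (ι' (v k)) → j = k := fun h =>
    ha.new_injective (hb.old_injective (hc.old_injective h))
  have injw : ∀ {j k}, w j = w k → j = k := fun h => hc.new_injective h
  obtain ⟨key, keys⟩ := hE.isLoopBeforeBigon_iff (C := c) inj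
    (fun z => by rw [ro, ha.rot_old]) (fun z h2 h3 => by rw [old, b9 z h2 h3])
    (fun z => by rw [old, b1]; exact (ne1 _ _).symm)
    (fun z => by rw [old, b6]; exact (ne2 _ _).symm)
    (by rw [old, old, b6, b1, ru, ou]; exact ne1 _ _)
  have s13 : b.edge (ι' (ι (s 1))) = ι' (ι (ι₀ (D.edge y))) := by
    rw [b9 _ (hE.new_injective.ne (by decide)) (hE.new_injective.ne (by decide)), hE.edge_one]
  have keyv : ∀ j, ¬ c.IsLoopBeforeBigon (κ (ι' (v j))) := by
    intro j
    rcases zmod_four_cases j with rfl | rfl | rfl | rfl <;> rintro ⟨h, h', -⟩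
    · rw [old, b4, ro] at h
      exact ne1 _ _ h.symm
    · rw [old, b5, ro, ha.rot_new] at h
      exact ne2 _ _ h
    · rw [ro, ha.rot_new, oo, ha.opp_new, show (2 + 1 + 2 : ZMod 4) = 1 from rfl, old, b5, oo,
        ha.opp_old, hE.opp_new, show (3 + 2 : ZMod 4) = 1 from rfl, ro, ha.rot_old, hE.rot_new,
        show (1 + 1 : ZMod 4) = 2 from rfl, old, old, b1, s13, ro, oo] at h'
      exact ne1 _ _ h'.symm
    · rw [old, b8, ro, ha.rot_new] at h
      exact absurd (injv h) (by decide)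
  have keyu : ∀ j, ¬ c.IsLoopBeforeBigon (κ (u j)) := by
    intro j
    rcases zmod_four_cases j with rfl | rfl | rfl | rfl <;> rintro ⟨h, -, -⟩
    · rw [new 0 (by decide) (by decide), b2, ru] at h
      exact ne1 _ _ h
    · rw [new 1 (by decide) (by decide), b3, ru] at h
      exact ne1 _ _ h
    · rw [u2, ru] at h
      exact hc.old_ne_new _ _ h.symm
    · rw [u3, ru] at h
      exact hc.old_ne_new _ _ h.symm
  have keyw : ∀ j, ¬ c.IsLoopBeforeBigon (w j) := by
    intro j
    rcases zmod_four_cases j with rfl | rfl | rfl | rfl <;> rintro ⟨h, h', -⟩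
    · rw [hc.edge_zero, hc.rot_new] at h
      exact hc.old_ne_new _ _ h
    · rw [w1, hc.rot_new] at h
      exact hc.old_ne_new _ _ h
    · rw [hc.rot_new, hc.opp_new, show (2 + 1 + 2 : ZMod 4) = 1 from rfl, w1, ou,
        show (2 + 2 : ZMod 4) = 0 from rfl, ru, show (0 + 1 : ZMod 4) = 1 from rfl,
        new 0 (by decide) (by decide), new 1 (by decide) (by decide), b2, b3, ro, oo, ha.rot_old,
        ha.opp_old] at h'
      exact ne2 _ _ h'.symm
    · rw [hc.edge_three, hc.rot_new] at h
      exact absurd (injw h) (by decide)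
  ext t
  constructor
  · intro ht
    rcases old_or_new_neighbouringLoops hE ha hb hc t with
      ⟨z, rfl⟩ | ⟨j, rfl⟩ | ⟨j, rfl⟩ | ⟨j, rfl⟩ | ⟨j, rfl⟩
    exacts [⟨z, (key z).1 ht, rfl⟩, absurd ht (keys j), absurd ht (keyv j), absurd ht (keyu j),
      absurd ht (keyw j)]
  · rintro ⟨z, hz, rfl⟩
    exact (key z).2 hz

/-- If the second one of the neighbouring loops is twisted. -/
theorem setOf_isLoopBeforeBigon_right (hE : D.IsKink y 0 E ι₀ s) (ha : E.IsKink (s 2) 0 a ι v)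
    (hb : a.IsKink (ι (s 2)) 0 b ι' u) (hc : b.IsKink (ι' (v 3)) (0 + 1) c κ w) :
    {t | c.IsLoopBeforeBigon t} = insert (κ (u 2))
      ((fun z => κ (ι' (ι (ι₀ z)))) '' {z | E.IsLoopBeforeBigon (ι₀ z)}) := by
  obtain ⟨b1, b2, b3, b4, b5, b6, b7, b8, b9⟩ := edge_neighbouringLoops hE ha hb
  have old : ∀ z, c.edge (κ (ι' (ι z))) = κ (b.edge (ι' (ι z))) := fun z =>
    hc.edge_old _ (hb.old_injective.ne (ha.old_ne_new _ _))
      (by rw [b8]; exact hb.old_injective.ne (ha.old_ne_new _ _))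
  have newv : ∀ j, j ≠ 2 → j ≠ 3 → c.edge (κ (ι' (v j))) = κ (b.edge (ι' (v j))) := fun j h2 h3 =>
    hc.edge_old _ (hb.old_injective.ne (ha.new_injective.ne h3))
      (by rw [b8]; exact hb.old_injective.ne (ha.new_injective.ne h2))
  have newu : ∀ j, c.edge (κ (u j)) = κ (b.edge (u j)) := fun j =>
    hc.edge_old _ (hb.old_ne_new _ _).symm (by rw [b8]; exact (hb.old_ne_new _ _).symm)
  have v3 : c.edge (κ (ι' (v 3))) = w 0 := hc.edge_old_left
  have v2 : c.edge (κ (ι' (v 2))) = w 1 := by rw [← b8, hc.edge_old_right]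
  have w1 : c.edge (w 1) = κ (ι' (v 2)) := by rw [hc.edge_one, b8]
  have ro : ∀ z, rot _ (κ (ι' z)) = κ (ι' (rot _ z)) := fun z => by rw [hc.rot_old, hb.rot_old]
  have oo : ∀ z, opp _ (κ (ι' z)) = κ (ι' (opp _ z)) := fun z => by rw [hc.opp_old, hb.opp_old]
  have ru : ∀ j, rot _ (κ (u j)) = κ (u (j + 1)) := fun j => by rw [hc.rot_old, hb.rot_new]
  have ou : ∀ j, opp _ (κ (u j)) = κ (u (j + 2)) := fun j => by rw [hc.opp_old, hb.opp_new]
  have inj : Function.Injective fun z => κ (ι' (ι z)) :=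
    hc.old_injective.comp (hb.old_injective.comp ha.old_injective)
  have ne1 : ∀ z j, κ (ι' z) ≠ κ (u j) := fun z j h => hb.old_ne_new _ _ (hc.old_injective h)
  have ne2 : ∀ z j, κ (ι' (ι z)) ≠ κ (ι' (v j)) := fun z j h =>
    ha.old_ne_new _ _ (hb.old_injective (hc.old_injective h))
  have inju : ∀ {j k}, κ (u j) = κ (u k) → j = k := fun h =>
    hb.new_injective (hc.old_injective h)
  have injw : ∀ {j k}, w j = w k → j = k := fun h => hc.new_injective h
  obtain ⟨key, keys⟩ := hE.isLoopBeforeBigon_iff (C := c) inj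
    (fun z => by rw [ro, ha.rot_old]) (fun z h2 h3 => by rw [old, b9 z h2 h3])
    (fun z => by rw [old, b1]; exact (ne1 _ _).symm)
    (fun z => by rw [old, b6]; exact (ne2 _ _).symm)
    (by rw [old, old, b6, b1, ru, ou]; exact ne1 _ _)
  have keyv : ∀ j, ¬ c.IsLoopBeforeBigon (κ (ι' (v j))) := by
    intro j
    rcases zmod_four_cases j with rfl | rfl | rfl | rfl <;> rintro ⟨h, -, -⟩
    · rw [newv 0 (by decide) (by decide), b4, ro] at h
      exact ne1 _ _ h.symm
    · rw [newv 1 (by decide) (by decide), b5, ro, ha.rot_new] at h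
      exact ne2 _ _ h
    · rw [v2, ro] at h
      exact hc.old_ne_new _ _ h.symm
    · rw [v3, ro] at h
      exact hc.old_ne_new _ _ h.symm
  have keyu : ∀ j, j ≠ 2 → ¬ c.IsLoopBeforeBigon (κ (u j)) := by
    intro j hj
    rcases zmod_four_cases j with rfl | rfl | rfl | rfl <;> rintro ⟨h, -, -⟩
    · rw [newu, b2, ru] at h
      exact ne1 _ _ h
    · rw [newu, b3, ru] at h
      exact ne1 _ _ h
    · exact hj rfl
    · rw [newu, hb.edge_three, ru] at h
      exact absurd (inju h) (by decide)
  have keyu2 : c.IsLoopBeforeBigon (κ (u 2)) := by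
    have h1 : opp _ (rot _ (κ (u 2))) = κ (u 1) := by
      rw [ru, ou]
      rfl
    have h2 : opp _ (κ (ι' (v 0))) = κ (ι' (v 2)) := by
      rw [oo, ha.opp_new]
      rfl
    have h3 : rot _ (κ (ι' (v 2))) = κ (ι' (v 3)) := by
      rw [ro, ha.rot_new]
      rfl
    rw [IsLoopBeforeBigon, IsLoopBeforeLoop, h1, newu, newu, hb.edge_two, b3, h2, h3, v2, v3]
    refine ⟨?_, ?_, fun h => hc.old_ne_new _ _ h.symm⟩
    · rw [ru]
      rfl
    · rw [hc.rot_new, hc.opp_new]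
      rfl
  have keyw : ∀ j, ¬ c.IsLoopBeforeBigon (w j) := by
    intro j
    rcases zmod_four_cases j with rfl | rfl | rfl | rfl <;> rintro ⟨h, h', -⟩
    · rw [hc.edge_zero, hc.rot_new] at h
      exact hc.old_ne_new _ _ h
    · rw [w1, hc.rot_new] at h
      exact hc.old_ne_new _ _ h
    · rw [hc.rot_new, hc.opp_new, show (2 + 1 + 2 : ZMod 4) = 1 from rfl, w1, oo, ha.opp_new,
        show (2 + 2 : ZMod 4) = 0 from rfl, ro, ha.rot_new, show (0 + 1 : ZMod 4) = 1 from rfl,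
        newv 0 (by decide) (by decide), newv 1 (by decide) (by decide), b4, b5, ru, ou] at h'
      exact ne1 _ _ h'
    · rw [hc.edge_three, hc.rot_new] at h
      exact absurd (injw h) (by decide)
  ext t
  constructor
  · intro ht
    rcases old_or_new_neighbouringLoops hE ha hb hc t with
      ⟨z, rfl⟩ | ⟨j, rfl⟩ | ⟨j, rfl⟩ | ⟨j, rfl⟩ | ⟨j, rfl⟩
    · exact Or.inr ⟨z, (key z).1 ht, rfl⟩
    · exact absurd ht (keys j)
    · exact absurd ht (keyv j)
    · by_cases hj : j = 2
      · exact Or.inl (by rw [hj])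
      · exact absurd ht (keyu j hj)
    · exact absurd ht (keyw j)
  · rintro (rfl | ⟨z, hz, rfl⟩)
    · exact keyu2
    · exact (key z).2 hz

/-- Twisting the second loop puts a bigon after the first loop; twisting the first loop puts none
after the second. The numbers of loops before a bigon, an isotopy invariant, therefore differ by
one. -/
theorem not_iso_neighbouringLoops (hE : D.IsKink y 0 E ι₀ s) (ha : E.IsKink (s 2) 0 a ι v)
    (hb : a.IsKink (ι (s 2)) 0 b ι' u) (hc : b.IsKink (u 3) (0 + 1) c κ w) {c' : Diagram A}
    {κ' : Dart b.crossings → Dart c'.crossings} {w' : ZMod 4 → Dart c'.crossings}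
    (hc' : b.IsKink (ι' (v 3)) (0 + 1) c' κ' w') (f : Iso c c') : False := by
  have h := f.ncard_isLoopBeforeBigon
  have inj : Function.Injective fun z => ι' (ι (ι₀ z)) :=
    hb.old_injective.comp (ha.old_injective.comp hE.old_injective)
  have injc : Function.Injective fun z => κ (ι' (ι (ι₀ z))) := hc.old_injective.comp inj
  have injc' : Function.Injective fun z => κ' (ι' (ι (ι₀ z))) := hc'.old_injective.comp inj
  rw [setOf_isLoopBeforeBigon_left hE ha hb hc, setOf_isLoopBeforeBigon_right hE ha hb hc',
    Set.ncard_insert_of_notMem, Set.ncard_image_of_injective _ injc,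
    Set.ncard_image_of_injective _ injc'] at h
  · omega
  · rintro ⟨z, -, hz⟩
    exact hb.old_ne_new _ _ (hc'.old_injective hz)

end NeighbouringLoops

end Diagram

/-- Whether a move of type 1 happens at a loop that precedes a loop. -/
def MoveClass.IsLoopBeforeLoop {A : Ambient} : MoveClass A → Prop :=
  Quot.lift
    (fun
      | .omega1 D x _ _ => D.IsLoopBeforeLoop x
      | .omega2 _ _ _ _ => False
      | .omega3 _ _ _ _ _ => False) (by
    intro m m' hm
    cases hm with
    | @omega1 D x D' h E y E' k f f' hx =>
      -- A monogon has a single corner, so sameness of regions determines the corner.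
      have : y = f.toEquiv x := by
        have hfix : nextCorner E.edge (f.toEquiv x) = f.toEquiv x := by
          rw [Diagram.nextCorner_apply, ← f.map_edge, ← f.map_rot, ← f.map_opp,
            ← Diagram.nextCorner_apply, h.1.1]
        obtain ⟨n, hn⟩ := hx
        rwa [Equiv.Perm.zpow_apply_eq_self_of_apply_eq_self hfix, eq_comm] at hn
      subst this
      exact propext (f.isLoopBeforeLoop_iff x).symm
    | omega2 f f' hx => rfl
    | omega3 f f' hx => rfl
    | omega3_inverse => rfl)

end KnotDiag

namespace KnotDiag

/-! ### Suspended double edges in the Reidemeister graph -/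

variable {A : Ambient}

/-- Two diagrams that are joined by two moves, and two more diagrams that are joined to both. -/
theorem exists_suspension (K : KnotType A) : ∃ m₀ : ℕ, ∀ m, m₀ ≤ m →
    ∃ (a b c d : DiagramClass A) (p q r s t u : MoveClass A),
      a.crossings = m ∧ b.crossings = m + 1 ∧ c.crossings = m + 2 ∧ d.crossings = m + 2 ∧
      c ≠ d ∧ p ≠ q ∧ (reidemeisterGraph K).IsLink p a b ∧ (reidemeisterGraph K).IsLink q a b ∧
      (reidemeisterGraph K).IsLink r a c ∧ (reidemeisterGraph K).IsLink s b c ∧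
      (reidemeisterGraph K).IsLink t a d ∧ (reidemeisterGraph K).IsLink u b d := by
  obtain ⟨m₀, h0, hm₀⟩ := exists_crossings_eq K
  refine ⟨m₀ + 2, fun m hm => ?_⟩
  obtain ⟨D, hD, hK⟩ := hm₀ (m - 2) (by omega)
  -- `E` has an auxiliary loop. Both small loops are placed on it, so that the crossing after the
  -- second one is `s`, which is not followed by a loop, whatever `D` is.
  obtain ⟨E, ι₀, s, hE⟩ := D.exists_isKink (⟨0, by omega⟩, 0) 0
  obtain ⟨a, ι, v, ha⟩ := E.exists_isKink (s 2) 0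
  obtain ⟨b, ι', u, hb⟩ := a.exists_isKink (ι (s 2)) 0
  -- `hf` exhibits `b` as `a` with a loop in a second way. It gives the second edge `q` and the move
  -- of type 2 from `d` to `a`.
  obtain ⟨f, hf, -⟩ := ha.exists_exchange hb
  obtain ⟨c, κ, w, hc⟩ := b.exists_isKink (u 3) (0 + 1)
  obtain ⟨d, κ', w', hd⟩ := b.exists_isKink (ι' (v 3)) (0 + 1)
  have hcE := hE.crossings_eq
  have hca := ha.crossings_eq
  have hcb := hb.crossings_eq
  have hcc := hc.crossings_eq
  have hcd := hd.crossings_eq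
  have ka : knotType ⟦a⟧ = K := ha.knotType_eq.trans (hE.knotType_eq.trans hK)
  have kb : knotType ⟦b⟧ = K := hb.knotType_eq.trans ka
  obtain ⟨l1, l2⟩ := Diagram.isLoopBeforeLoop_neighbouringLoops hE ha hb
  refine ⟨⟦a⟧, ⟦b⟧, ⟦c⟧, ⟦d⟧, Quot.mk _ (.omega1 b (u 2) a hb.isOmega1),
    Quot.mk _ (.omega1 b (ι' (v 2)) a hf.isOmega1),
    Quot.mk _ (.omega2 c (κ (u 2)) a (hb.isOmega2 hc)),
    Quot.mk _ (.omega1 c (w 2) b hc.isOmega1),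
    Quot.mk _ (.omega2 d (κ' (ι' (v 2))) a (hf.isOmega2 hd)),
    Quot.mk _ (.omega1 d (w' 2) b hd.isOmega1), ?_, ?_, ?_, ?_, fun h => ?_, fun h => ?_,
    ⟨Sym2.eq_swap, ka⟩, ⟨Sym2.eq_swap, ka⟩, ⟨Sym2.eq_swap, ka⟩, ⟨Sym2.eq_swap, kb⟩,
    ⟨Sym2.eq_swap, ka⟩, ⟨Sym2.eq_swap, kb⟩⟩
  · change a.crossings = m
    omega
  · change b.crossings = m + 1
    omega
  · change c.crossings = m + 2
    omega
  · change d.crossings = m + 2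
    omega
  · obtain ⟨g⟩ := Quotient.exact h
    exact Diagram.not_iso_neighbouringLoops hE ha hb hc hd g
  · have := congrArg MoveClass.IsLoopBeforeLoop h
    exact l2 (this.mp l1)

end KnotDiag

namespace KnotDiag

variable {A : Ambient}

open CliqueComplex in
theorem exists_spheres (K : KnotType A) [LinearOrder (DiagramClass A)] :
    ∃ (T : ℕ → Finset (Simplex (reidemeisterGraph K) 2)) (z : ℕ → cycles (reidemeisterGraph K) 2),
      (∀ i, IsSphere (T i)) ∧ (∀ i, (T i).Nonempty) ∧ (∀ i j, i ≠ j → Disjoint (T i) (T j)) ∧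
      (∀ i, ∀ k ∈ T i, (z i).1 k = 1 ∨ (z i).1 k = -1) ∧ ∀ i, ∀ k ∉ T i, (z i).1 k = 0 := by
  obtain ⟨m₀, h₀⟩ := exists_suspension K
  have h : ∀ i, ∃ T : Finset (Simplex (reidemeisterGraph K) 2),
      IsSphere T ∧ T.Nonempty ∧
      -- The minimal number of crossings among the vertices of a triangle recovers the index `i`, so
      -- different spheres share no triangle.
      (∀ k ∈ T, (∃ j, (k.vertex j).crossings = m₀ + i) ∧
        ∀ j, m₀ + i ≤ (k.vertex j).crossings) ∧
      ∃ z : cycles (reidemeisterGraph K) 2,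
        (∀ k ∈ T, z.1 k = 1 ∨ z.1 k = -1) ∧ ∀ k ∉ T, z.1 k = 0 := by
    intro i
    obtain ⟨a, b, c, d, p, q, r, s, t, u, ha, hb, hc, hd, hcd, hpq, hp, hq, hr, hs, ht, hu⟩ :=
      h₀ (m₀ + i) (Nat.le_add_right _ _)
    have ne : ∀ {x y : DiagramClass A}, x.crossings ≠ y.crossings → x ≠ y :=
      fun h h' => h (congrArg _ h')
    obtain ⟨T, hT, hT', hV, hz⟩ := exists_sphere (ne (by omega)) (ne (by omega)) (ne (by omega))
      (ne (by omega)) (ne (by omega)) hcd hpq hp hq hr hs ht hu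
    refine ⟨T, hT, hT', fun k hk => ⟨?_, fun j => ?_⟩, hz⟩
    · obtain ⟨j, hj⟩ := (hV k hk).1 (Set.mem_insert a _)
      exact ⟨j, hj ▸ ha⟩
    · rcases (hV k hk).2 ⟨j, rfl⟩ with h | h | h | h <;> rw [h] <;> omega
  choose T hT hne hV z hz hz' using h
  refine ⟨T, z, hT, hne, fun i j hij => ?_, hz, hz'⟩
  rw [Finset.disjoint_left]
  intro k hi hj
  obtain ⟨⟨l, hl⟩, hle⟩ := hV i k hi
  obtain ⟨⟨l', hl'⟩, hle'⟩ := hV j k hj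
  have := hle l'
  have := hle' l
  omega

end KnotDiag

/-! ### The clique complex of the Reidemeister graph -/

theorem mainTheorem12 (A : KnotDiag.Ambient) (K : KnotDiag.KnotType A)
    [LinearOrder (KnotDiag.DiagramClass A)] :
    (∀ n : ℕ, 3 ≤ n →
      IsEmpty (CliqueComplex.Simplex (KnotDiag.reidemeisterGraph K) n) ∧
      Subsingleton (CliqueComplex.Homology (KnotDiag.reidemeisterGraph K) n)) ∧
    Nonempty (CliqueComplex.Homology (KnotDiag.reidemeisterGraph K) 2 ≃ₗ[ℤ] (ℕ →₀ ℤ)) ∧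
    ∃ S : ℕ → CliqueComplex.Homology (KnotDiag.reidemeisterGraph K) 2,
      LinearIndependent ℤ S ∧ ∀ k, CliqueComplex.IsSphereClass (S k) := by
  have hempty := fun n (hn : 3 ≤ n) => KnotDiag.isEmpty_simplex K hn
  have := hempty 3 le_rfl
  have := CliqueComplex.countable_simplex (KnotDiag.reidemeisterGraph K) 2
  obtain ⟨T, z, hT, hne, hd, hz, hz'⟩ := KnotDiag.exists_spheres K
  have hli := CliqueComplex.linearIndependent_of_disjoint hne hd hz hz'
  refine ⟨fun n hn => ⟨hempty n hn, ?_⟩, CliqueComplex.nonempty_homology_equiv 2 hli,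
    fun k => (CliqueComplex.homologyEquivCycles 2).symm (z k),
    hli.map' _ (LinearEquiv.ker _), fun k => ⟨T k, hT k, z k, ?_, hz k, hz' k⟩⟩
  · have := hempty n hn
    exact CliqueComplex.subsingleton_homology n
  · rw [LinearEquiv.eq_symm_apply]
    rfl
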